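/- Let $G\rightrightarrows M$ be a Lie groupoid with source and target $\mathsf{s},\mathsf{t}$, where all manifolds are smooth, finite-dimensional, Hausdorff and second countable. Elements $g,h\in G$ are composable if $\mathsf{s}(g)=\mathsf{t}(h)$. For $p\ge 0$ let $B_pG=\{(g_1,\ldots,g_p)\mid \mathsf{s}(g_i)=\mathsf{t}(g_{i+1}),\ 0<i<p\}$ be the manifold of $p$-arrows (with $B_0G=M$), whose base points are $m_0,\ldots,m_p$, where $m_0=\mathsf{t}(g_1)$ and $m_i=\mathsf{s}(g_i)$ for $i>0$. Let $\partial_i\colon B_{p+1}G\to B_pG$, $0\le i\le p+1$, be the face map which drops the $i$-th base point: $\partial_0$ and $\partial_{p+1}$ omit $g_1$ and $g_{p+1}$ respectively, and $\partial_i$ replaces $g_i,g_{i+1}$ by $g_ig_{i+1}$ for $0<i<p+1$ (for $p=0$: $\partial_0=\mathsf{s}$, $\partial_1=\mathsf{t}$). The groupoid complex $\mathsf{C}^\bullet(G)$ has $\mathsf{C}^p(G)=C^\infty(B_pG)$ (real valued functions) and differential $\delta=\sum_{i=0}^{p+1}(-1)^i\partial_i^*$; its cohomology is the differentiable cohomology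 of $G$. Let $K\rightrightarrows M$ be a wide Lie subgroupoid of $G$, i.e. a Lie groupoid over the same base with an injective immersion $K\hookrightarrow G$ which is a morphism of groupoids over $\mathrm{id}_M$. It acts on $B_pG$ in $p+1$ commuting ways: for $0\le i\le p$ and $a\in K$ with $\mathsf{t}(a)=m_i$, $$(g_1,\ldots,g_p)\cdot_i a=\begin{cases}(a^{-1}g_1,g_2,\ldots,g_p)& i=0,\\ (g_1,\ldots,g_ia,a^{-1}g_{i+1},\ldots,g_p)&0<i<p,\\ (g_1,\ldots,g_{p-1},g_pa)&i=p,\end{cases}$$ and $m\cdot_0 a=\mathsf{s}(a)$ if $p=0$. Let $\mathsf{C}^\bullet(G)^K\subset \mathsf{C}^\bullet(G)$ be the subcomplex of cochains that are invariant under all these $K$-actions, and $\widetilde{\mathsf{C}}^\bullet(G)^K\subset\mathsf{C}^\bullet(G)^K$ the normalized $K$-invariant subcomplex, of those $f$ with $f(g_1,\ldots,g_p)=0$ whenever $g_i\in K$ for some $i$. A properly supported normalized (left invariant) Haar system on $K$ is a family $\mu=\{\mu_m\}_{m\in M}$ of Borel measures on the fibres $\mathsf{t}^{-1}(m)\subset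 K$ such that (i) $m\mapsto\int_{\mathsf{t}^{-1}(m)} f\,d\mu_m$ is smooth for every compactly supported $f\in C^\infty(K)$; (ii) $(L_g)_*\mu_{\mathsf{s}(g)}=\mu_{\mathsf{t}(g)}$ for all $g\in K$, where $L_g(a)=ga$; (iii) $\mathsf{t}$ restricts to a proper map $\operatorname{supp}(\mu)\to M$, where $\operatorname{supp}(\mu)$ is the closure in $K$ of $\bigcup_m\operatorname{supp}(\mu_m)$; (iv) $\mu_m(\mathsf{t}^{-1}(m))=1$ for all $m$. For such $\mu$ and $0\le i\le p$ put $$(\operatorname{Av}^{(i)}f)(x)=\int_{\mathsf{t}^{-1}(m_i)}f(x\cdot_i a)\,d\mu_{m_i}(a)\qquad (x\in B_pG\text{ with base points }m_0,\ldots,m_p),\qquad \operatorname{Av}=\operatorname{Av}^{(0)}\circ\cdots\circ\operatorname{Av}^{(p)}.$$ **Theorem.** Suppose that $K$ is proper, i.e. that $(\mathsf{t},\mathsf{s})\colon K\to M\times M$ is a proper map. Then: 1. $K$ admits a properly supported normalized Haar system. 2. Let $\mu$ be any such Haar system. For every $f\in C^\infty(B_pG)$ the integrals defining $\operatorname{Av}^{(i)}f$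 exist, $\operatorname{Av}^{(i)}f\in C^\infty(B_pG)$, and $\operatorname{Av}^{(i)}\operatorname{Av}^{(j)}f=\operatorname{Av}^{(j)}\operatorname{Av}^{(i)}f$ for all $0\le i,j\le p$. Moreover $\operatorname{Av}$ takes values in $\mathsf{C}^\bullet(G)^K$, and $\operatorname{Av}\colon \mathsf{C}^\bullet(G)\to\mathsf{C}^\bullet(G)^K$ is a cochain map and a homotopy equivalence of cochain complexes, with homotopy inverse given by the inclusion $\iota\colon\mathsf{C}^\bullet(G)^K\to\mathsf{C}^\bullet(G)$. 3. The inclusion $\widetilde{\mathsf{C}}^\bullet(G)^K\to\mathsf{C}^\bullet(G)$ is a homotopy equivalence of cochain complexes; in particular it is a quasi-isomorphism, so that $\widetilde{\mathsf{C}}^\bullet(G)^K$ computes the differentiable cohomology of $G$. -/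

import Mathlib

open scoped Manifold ContDiff

/-- A (Hausdorff, finite-dimensional) Lie groupoid `G ⇉ M`. The arrow `g` goes from `src g` to
`tgt g`, and `mul g h` is the product `g h`, which is meaningful only if `src g = tgt h`: outside
of the composable pairs the value of `mul` is irrelevant. -/
structure LieGroupoid (EM EG M G : Type*)
    [NormedAddCommGroup EM] [NormedSpace ℝ EM] [TopologicalSpace M] [ChartedSpace EM M]
    [NormedAddCommGroup EG] [NormedSpace ℝ EG] [TopologicalSpace G] [ChartedSpace EG G] where
  src : G → M
  tgt : G → M
  one : M → G
  inv : G → G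
  mul : G → G → G
  src_one : ∀ m, src (one m) = m
  tgt_one : ∀ m, tgt (one m) = m
  src_inv : ∀ g, src (inv g) = tgt g
  tgt_inv : ∀ g, tgt (inv g) = src g
  src_mul : ∀ g h, src g = tgt h → src (mul g h) = src h
  tgt_mul : ∀ g h, src g = tgt h → tgt (mul g h) = tgt g
  mul_assoc : ∀ g h k, src g = tgt h → src h = tgt k → mul (mul g h) k = mul g (mul h k)
  one_mul : ∀ g, mul (one (tgt g)) g = g
  mul_one : ∀ g, mul g (one (src g)) = g
  inv_mul : ∀ g, mul (inv g) g = one (src g)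
  mul_inv : ∀ g, mul g (inv g) = one (tgt g)
  isSubmersion_src : Manifold.IsSubmersion 𝓘(ℝ, EG) 𝓘(ℝ, EM) ∞ src
  isSubmersion_tgt : Manifold.IsSubmersion 𝓘(ℝ, EG) 𝓘(ℝ, EM) ∞ tgt
  contMDiff_one : ContMDiff 𝓘(ℝ, EM) 𝓘(ℝ, EG) ∞ one
  contMDiff_inv : ContMDiff 𝓘(ℝ, EG) 𝓘(ℝ, EG) ∞ inv
  /-- The multiplication is smooth on the submanifold of composable pairs of `G × G`. -/
  contMDiffOn_mul : ContMDiffOn (𝓘(ℝ, EG).prod 𝓘(ℝ, EG)) 𝓘(ℝ, EG) ∞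
    (fun q : G × G => mul q.1 q.2) {q : G × G | src q.1 = tgt q.2}

namespace LieGroupoid

section Groupoid

variable {EM EG EK M G K : Type*}
  [NormedAddCommGroup EM] [NormedSpace ℝ EM] [TopologicalSpace M] [ChartedSpace EM M]
  [NormedAddCommGroup EG] [NormedSpace ℝ EG] [TopologicalSpace G] [ChartedSpace EG G]
  [NormedAddCommGroup EK] [NormedSpace ℝ EK] [TopologicalSpace K] [ChartedSpace EK K]

/-- A wide Lie subgroupoid of `𝒢`: a Lie groupoid `K ⇉ M` over the same base, together with an
injective immersion `incl : K → G` that is a morphism of groupoids over the identity of `M`. -/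
structure WideSubgroupoid (𝒢 : LieGroupoid EM EG M G) (EK K : Type*)
    [NormedAddCommGroup EK] [NormedSpace ℝ EK] [TopologicalSpace K] [ChartedSpace EK K]
    extends LieGroupoid EM EK M K where
  incl : K → G
  incl_injective : Function.Injective incl
  isImmersion_incl : Manifold.IsImmersion 𝓘(ℝ, EK) 𝓘(ℝ, EG) ∞ incl
  src_incl : ∀ k, 𝒢.src (incl k) = src k
  tgt_incl : ∀ k, 𝒢.tgt (incl k) = tgt k
  incl_one : ∀ m, incl (one m) = 𝒢.one m
  incl_mul : ∀ k l, src k = tgt l → incl (mul k l) = 𝒢.mul (incl k) (incl l)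

/-- A Lie groupoid is proper if `(t, s) : G → M × M` is a proper map. -/
def IsProper (𝒢 : LieGroupoid EM EG M G) : Prop :=
  IsProperMap (fun g : G => (𝒢.tgt g, 𝒢.src g))

/-! ### The nerve -/

/-- The space `B_p G` of `p`-arrows `(g_1, …, g_p)`, together with their base points
`m_0, …, m_p`. In the zero-based numbering of `Fin p`, the arrow `arr j` is `g_{j+1}`, and it goes
from `m_{j+1}` to `m_j`. The base points are determined by the arrows if `p ≠ 0`, and
`B_0 G = M`. -/
@[ext]
structure Nerve (𝒢 : LieGroupoid EM EG M G) (p : ℕ) where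
  base : Fin (p + 1) → M
  arr : Fin p → G
  tgt_arr : ∀ j : Fin p, 𝒢.tgt (arr j) = base j.castSucc
  src_arr : ∀ j : Fin p, 𝒢.src (arr j) = base j.succ

theorem mul_mul_inv_mul (𝒢 : LieGroupoid EM EG M G) (g a h : G) (h1 : 𝒢.src g = 𝒢.tgt a)
    (h2 : 𝒢.tgt h = 𝒢.tgt a) : 𝒢.mul (𝒢.mul g a) (𝒢.mul (𝒢.inv a) h) = 𝒢.mul g h := by
  have e1 : 𝒢.src (𝒢.inv a) = 𝒢.tgt h := by rw [𝒢.src_inv, h2]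
  have e2 : 𝒢.src a = 𝒢.tgt (𝒢.inv a) := (𝒢.tgt_inv a).symm
  rw [𝒢.mul_assoc _ _ _ h1 (by rw [𝒢.tgt_mul _ _ e1, e2]), ← 𝒢.mul_assoc _ _ _ e2 e1,
    𝒢.mul_inv, ← h2, 𝒢.one_mul]

theorem val_succAbove {n : ℕ} (i : Fin (n + 1)) (j : Fin n) :
    (i.succAbove j : ℕ) = if (j : ℕ) < i then (j : ℕ) else j + 1 := by
  simp only [Fin.succAbove, Fin.lt_def, Fin.val_castSucc]
  split_ifs <;> simp

namespace Nerve

variable {𝒢 : LieGroupoid EM EG M G}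

theorem src_eq {p : ℕ} (x : 𝒢.Nerve p) (j : Fin p) (i : Fin (p + 1)) (h : (j : ℕ) + 1 = i) :
    𝒢.src (x.arr j) = x.base i := by
  rw [x.src_arr]; congr 1; ext; simpa using h

theorem tgt_eq {p : ℕ} (x : 𝒢.Nerve p) (j : Fin p) (i : Fin (p + 1)) (h : (j : ℕ) = i) :
    𝒢.tgt (x.arr j) = x.base i := by
  rw [x.tgt_arr]; congr 1; ext; simpa using h

theorem src_eq_tgt {p : ℕ} (x : 𝒢.Nerve p) (j k : Fin p) (h : (j : ℕ) + 1 = k) :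
    𝒢.src (x.arr j) = 𝒢.tgt (x.arr k) := by
  rw [x.src_eq j k.castSucc (by simpa using h), x.tgt_arr]

/-- The face map `∂_i : B_{p+1} G → B_p G`, which drops the `i`-th base point:
`(g_1, …, g_{p+1})` is mapped to `(g_2, …, g_{p+1})` if `i = 0`, to
`(g_1, …, g_i g_{i+1}, …, g_{p+1})` if `0 < i < p + 1`, and to `(g_1, …, g_p)` if `i = p + 1`. -/
def face {p : ℕ} (i : Fin (p + 2)) (x : 𝒢.Nerve (p + 1)) : 𝒢.Nerve p where
  base j := x.base (i.succAbove j)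
  arr j :=
    if (j : ℕ) + 1 < i then x.arr j.castSucc
    else if (j : ℕ) + 1 = i then 𝒢.mul (x.arr j.castSucc) (x.arr j.succ)
    else x.arr j.succ
  tgt_arr j := by
    split_ifs with h1 h2
    · apply x.tgt_eq; rw [val_succAbove]; simp only [Fin.val_castSucc]; grind
    · rw [𝒢.tgt_mul _ _ (x.src_eq_tgt _ _ (by simp))]
      apply x.tgt_eq; rw [val_succAbove]; simp only [Fin.val_castSucc]; grind
    · apply x.tgt_eq; rw [val_succAbove]; simp only [Fin.val_castSucc, Fin.val_succ]; grind
  src_arr j := by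
    split_ifs with h1 h2
    · apply x.src_eq; rw [val_succAbove]; simp only [Fin.val_castSucc, Fin.val_succ]; grind
    · rw [𝒢.src_mul _ _ (x.src_eq_tgt _ _ (by simp))]
      apply x.src_eq; rw [val_succAbove]; simp only [Fin.val_succ]; grind
    · apply x.src_eq; rw [val_succAbove]; simp only [Fin.val_succ]; grind

/-- The `i`-th right action of `G` on `B_p G`, with anchor `m_i`: an arrow `a` with `t(a) = m_i`
acts by `(g_1, …, g_p) ↦ (g_1, …, g_i a, a⁻¹ g_{i+1}, …, g_p)`, where the factor `g_i a` is absent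
if `i = 0` and the factor `a⁻¹ g_{i+1}` is absent if `i = p`. The `i`-th base point becomes
`s(a)`; in particular, the action on `B_0 G = M` maps `t(a)` to `s(a)`. -/
def act {p : ℕ} (i : Fin (p + 1)) (x : 𝒢.Nerve p) (a : G) (ha : 𝒢.tgt a = x.base i) :
    𝒢.Nerve p where
  base j := if j = i then 𝒢.src a else x.base j
  arr j :=
    if (j : ℕ) + 1 = i then 𝒢.mul (x.arr j) a
    else if (j : ℕ) = i then 𝒢.mul (𝒢.inv a) (x.arr j)
    else x.arr j
  tgt_arr j := by
    simp only [Fin.ext_iff, Fin.val_castSucc]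
    split_ifs with h1 h2 h3
    · omega
    · rw [𝒢.tgt_mul _ _ (by rw [ha, x.src_eq j i h1]), x.tgt_arr]
    · rw [𝒢.tgt_mul _ _ (by rw [𝒢.src_inv, ha, x.tgt_eq j i h3]), 𝒢.tgt_inv]
    · exact x.tgt_arr j
  src_arr j := by
    simp only [Fin.ext_iff, Fin.val_succ]
    split_ifs with h1 h2
    · rw [𝒢.src_mul _ _ (by rw [ha, x.src_eq j i h1])]
    · rw [𝒢.src_mul _ _ (by rw [𝒢.src_inv, ha, x.tgt_eq j i h2]), x.src_arr]
    · exact x.src_arr j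

theorem arr_congr {p : ℕ} (x : 𝒢.Nerve p) {j k : Fin p} (h : (j : ℕ) = k) :
    x.arr j = x.arr k := by
  rw [Fin.ext h]

theorem base_congr {p : ℕ} (x : 𝒢.Nerve p) {j k : Fin (p + 1)} (h : (j : ℕ) = k) :
    x.base j = x.base k := by
  rw [Fin.ext h]

theorem face_face {p : ℕ} (i j : Fin (p + 2)) (hij : i ≤ j) (x : 𝒢.Nerve (p + 2)) :
    face i (face j.succ x) = face j (face i.castSucc x) := by
  rw [Fin.le_def] at hij
  ext k
  · simp only [face]
    apply base_congr
    simp only [val_succAbove, Fin.val_succ, Fin.val_castSucc]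
    grind
  · simp only [face, Fin.val_succ, Fin.val_castSucc]
    have e : x.arr k.castSucc.succ = x.arr k.succ.castSucc := x.arr_congr (by simp)
    have a1 := x.src_eq_tgt k.castSucc.castSucc k.succ.castSucc (by simp)
    have a2 := x.src_eq_tgt k.succ.castSucc k.succ.succ (by simp)
    have a3 := 𝒢.mul_assoc _ _ _ a1 a2
    rw [e]
    split_ifs <;> first | rfl | omega | exact a3 | exact a3.symm

theorem face_act_self {p : ℕ} (i : Fin (p + 2)) (x : 𝒢.Nerve (p + 1)) (a : G)
    (ha : 𝒢.tgt a = x.base i) : face i (act i x a ha) = face i x := by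
  ext k
  · simp [face, act, Fin.succAbove_ne]
  · simp only [face, act, Fin.val_succ, Fin.val_castSucc]
    split_ifs <;> first | rfl | omega | skip
    rename_i h _
    exact 𝒢.mul_mul_inv_mul _ _ _ ((x.src_eq k.castSucc i (by simpa using h)).trans ha.symm)
      ((x.tgt_eq k.succ i (by simpa using h)).trans ha.symm)

theorem face_act_succAbove {p : ℕ} (j : Fin (p + 2)) (i : Fin (p + 1)) (x : 𝒢.Nerve (p + 1))
    (a : G) (ha : 𝒢.tgt a = x.base (j.succAbove i)) :
    face j (act (j.succAbove i) x a ha) = act i (face j x) a ha := by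
  ext k
  · simp [face, act]
  · simp only [face, act, Fin.val_succ, Fin.val_castSucc]
    have hi := val_succAbove j i
    have h0 := x.src_eq_tgt k.castSucc k.succ (by simp)
    split_ifs at hi ⊢ <;> first | rfl | omega | skip
    · exact 𝒢.mul_assoc _ _ _ (by rw [𝒢.src_inv, ha, x.tgt_eq _ _ (by simpa)]) h0
    · exact (𝒢.mul_assoc _ _ _ h0 (by rw [ha, x.src_eq _ _ (by simpa)])).symm

theorem face_castSucc_eq_act {p : ℕ} (j : Fin (p + 1)) (x : 𝒢.Nerve (p + 1)) (a : G)
    (ha : x.arr j = a) (hb : 𝒢.tgt a = (face j.succ x).base j) :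
    face j.castSucc x = act j (face j.succ x) a hb := by
  subst ha
  ext k
  · simp only [face, act]
    split_ifs with h
    · subst h
      rw [x.src_arr]
      exact x.base_congr (by simp)
    · apply x.base_congr
      simp only [Fin.ext_iff] at h
      simp only [val_succAbove, Fin.val_succ, Fin.val_castSucc]
      grind
  · simp only [face, act, Fin.val_succ, Fin.val_castSucc]
    have e1 : (k : ℕ) + 1 = j → x.arr k.succ = x.arr j := fun h => x.arr_congr (by simpa)
    have e2 : (k : ℕ) = j → x.arr k.castSucc = x.arr j := fun h => x.arr_congr (by simpa)
    have h0 := x.src_eq_tgt k.castSucc k.succ (by simp)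
    split_ifs <;> first | rfl | omega | skip
    · rw [e1 (by assumption)]
    · rw [← e2 (by assumption), ← 𝒢.mul_assoc _ _ _ (𝒢.src_inv _) h0, 𝒢.inv_mul, h0, 𝒢.one_mul]

theorem exists_arr_face_eq {p : ℕ} (i : Fin (p + 2)) (j : Fin (p + 1)) (x : 𝒢.Nerve (p + 1))
    (h1 : i ≠ j.castSucc) (h2 : i ≠ j.succ) : ∃ k, (face i x).arr k = x.arr j := by
  simp only [ne_eq, Fin.ext_iff, Fin.val_castSucc, Fin.val_succ] at h1 h2
  rcases lt_or_gt_of_ne h1 with h | h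
  · refine ⟨⟨j - 1, by omega⟩, ?_⟩
    simp only [face]
    split_ifs <;> first | omega | skip
    exact x.arr_congr (by simp; omega)
  · refine ⟨⟨j, by omega⟩, ?_⟩
    simp only [face]
    split_ifs <;> first | omega | skip
    exact x.arr_congr (by simp)

end Nerve

/-! ### The groupoid complex and its subcomplexes -/

section Cochains

variable (𝒢 : LieGroupoid EM EG M G)

/-- The differential `δ = ∑ i, (-1) ^ i ∂_i^*`, on arbitrary functions on the nerve. -/
def coboundary (p : ℕ) : (𝒢.Nerve p → ℝ) →ₗ[ℝ] (𝒢.Nerve (p + 1) → ℝ) where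
  toFun f x := ∑ i : Fin (p + 2), (-1 : ℝ) ^ (i : ℕ) * f (x.face i)
  map_add' f g := by
    ext x
    simp [mul_add, Finset.sum_add_distrib]
  map_smul' c f := by
    ext x
    simp only [Pi.smul_apply, smul_eq_mul, RingHom.id_apply, Finset.mul_sum]
    exact Finset.sum_congr rfl fun i _ => by ring

theorem coboundary_coboundary (p : ℕ) (f : 𝒢.Nerve p → ℝ) :
    𝒢.coboundary (p + 1) (𝒢.coboundary p f) = 0 := by
  ext x
  simp only [coboundary, LinearMap.coe_mk, AddHom.coe_mk, Finset.mul_sum, Pi.zero_apply]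
  rw [Finset.sum_comm]
  simp only [← Finset.sum_product']
  let P := Fin (p + 2) × Fin (p + 3)
  let S : Finset P := {ij : P | (ij.2 : ℕ) ≤ (ij.1 : ℕ)}
  rw [Finset.univ_product_univ, ← Finset.sum_add_sum_compl S, ← eq_neg_iff_add_eq_zero,
    ← Finset.sum_neg_distrib]
  let φ : ∀ ij : P, ij ∈ S → P := fun ij hij =>
    (Fin.castLT ij.2 (lt_of_le_of_lt (Finset.mem_filter.mp hij).right (Fin.is_lt ij.1)), ij.1.succ)
  apply Finset.sum_bij φ
  · intro ij hij
    simp_rw [S, φ, Finset.compl_filter, Finset.mem_filter_univ, Fin.val_succ,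
      Fin.val_castLT] at hij ⊢
    lia
  · rintro ⟨i, j⟩ hij ⟨i', j'⟩ hij' h
    rw [Prod.mk_inj]
    exact ⟨by simpa [φ] using! congr_arg Prod.snd h,
      by simpa [φ, Fin.castSucc_castLT] using! congr_arg Fin.castSucc (congr_arg Prod.fst h)⟩
  · rintro ⟨i', j'⟩ hij'
    simp_rw [S, Finset.compl_filter, Finset.mem_filter_univ, not_le] at hij'
    refine ⟨(j'.pred <| ?_, Fin.castSucc i'), ?_, ?_⟩
    · rintro rfl
      simp only [Fin.val_zero, not_lt_zero] at hij'
    · simpa [S] using! Nat.le_sub_one_of_lt hij'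
    · simp only [φ, Fin.castLT_castSucc, Fin.succ_pred]
  · rintro ⟨i, j⟩ hij
    have hij' : (j : ℕ) ≤ i := by simpa [S] using hij
    have hf := Nerve.face_face (Fin.castLT j (lt_of_le_of_lt hij' i.is_lt)) i
      (by simpa [Fin.le_def] using hij') x
    simp only [Fin.castSucc_castLT] at hf
    simp only [φ, Fin.val_succ, Fin.val_castLT, hf]
    ring

/-- Smoothness of a function on the manifold `B_p G`, an embedded submanifold of a product of copies
of `M` and `G`: the function is smooth along every smooth map `φ` from an open subset `U` of a
Euclidean space to `B_p G`, that is, every `φ` whose components with values in `M` and `G` are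
smooth. For the inverses `φ` of the charts of `B_p G` this is smoothness in charts. -/
def IsSmooth {p : ℕ} (f : 𝒢.Nerve p → ℝ) : Prop :=
  ∀ (n : ℕ) (U : Set (EuclideanSpace ℝ (Fin n))) (φ : EuclideanSpace ℝ (Fin n) → 𝒢.Nerve p),
    IsOpen U →
    (∀ i, ContMDiffOn 𝓘(ℝ, EuclideanSpace ℝ (Fin n)) 𝓘(ℝ, EM) ∞ (fun u => (φ u).base i) U) →
    (∀ j, ContMDiffOn 𝓘(ℝ, EuclideanSpace ℝ (Fin n)) 𝓘(ℝ, EG) ∞ (fun u => (φ u).arr j) U) →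
    ContDiffOn ℝ ∞ (fun u => f (φ u)) U

/-- The space `C^p(G) = C^∞(B_p G)` of smooth `p`-cochains. -/
def cochains (p : ℕ) : Submodule ℝ (𝒢.Nerve p → ℝ) where
  carrier := {f | 𝒢.IsSmooth f}
  add_mem' hf hg n U φ hU h1 h2 := (hf n U φ hU h1 h2).add (hg n U φ hU h1 h2)
  zero_mem' _ _ _ _ _ _ := contDiffOn_const
  smul_mem' _ _ hf n U φ hU h1 h2 := contDiffOn_const.smul (hf n U φ hU h1 h2)

theorem coboundary_mem_cochains (p : ℕ) (f : 𝒢.Nerve p → ℝ) (hf : f ∈ 𝒢.cochains p) :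
    𝒢.coboundary p f ∈ 𝒢.cochains (p + 1) := by
  intro n U φ hU h1 h2
  simp only [coboundary, LinearMap.coe_mk, AddHom.coe_mk]
  refine ContDiffOn.sum fun i _ => contDiffOn_const.mul ?_
  refine hf n U (fun u => (φ u).face i) hU (fun k => h1 _) (fun k => ?_)
  simp only [Nerve.face]
  split_ifs
  · exact h2 _
  · exact 𝒢.contMDiffOn_mul.comp ((h2 k.castSucc).prodMk (h2 k.succ))
      fun u _ => (φ u).src_eq_tgt _ _ (by simp)
  · exact h2 _

variable {𝒢}

/-- The smooth `p`-cochains that are invariant under the `p + 1` actions of `K` on `B_p G`. -/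
def invariantCochains (𝒦 : 𝒢.WideSubgroupoid EK K) (p : ℕ) : Submodule ℝ (𝒢.Nerve p → ℝ) where
  carrier := {f | f ∈ 𝒢.cochains p ∧ ∀ (i : Fin (p + 1)) (x : 𝒢.Nerve p) (k : K)
    (hk : 𝒢.tgt (𝒦.incl k) = x.base i), f (x.act i (𝒦.incl k) hk) = f x}
  add_mem' hf hg := ⟨add_mem hf.1 hg.1, fun i x k hk => by simp [hf.2 i x k hk, hg.2 i x k hk]⟩
  zero_mem' := ⟨zero_mem _, fun _ _ _ _ => rfl⟩
  smul_mem' c _ hf := ⟨Submodule.smul_mem _ c hf.1, fun i x k hk => by simp [hf.2 i x k hk]⟩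

/-- The invariant `p`-cochains that are normalized, i.e. vanish at `(g_1, …, g_p)` as soon as some
`g_j` lies in `K`. -/
def normalizedInvariantCochains (𝒦 : 𝒢.WideSubgroupoid EK K) (p : ℕ) :
    Submodule ℝ (𝒢.Nerve p → ℝ) where
  carrier := {f | f ∈ invariantCochains 𝒦 p ∧ ∀ x : 𝒢.Nerve p,
    (∃ j, x.arr j ∈ Set.range 𝒦.incl) → f x = 0}
  add_mem' hf hg := ⟨add_mem hf.1 hg.1, fun x hx => by simp [hf.2 x hx, hg.2 x hx]⟩
  zero_mem' := ⟨zero_mem _, fun _ _ => rfl⟩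
  smul_mem' c _ hf := ⟨Submodule.smul_mem _ c hf.1, fun x hx => by simp [hf.2 x hx]⟩

theorem invariantCochains_le (𝒦 : 𝒢.WideSubgroupoid EK K) (p : ℕ) :
    invariantCochains 𝒦 p ≤ 𝒢.cochains p :=
  fun _ hf => hf.1

theorem normalizedInvariantCochains_le (𝒦 : 𝒢.WideSubgroupoid EK K) (p : ℕ) :
    normalizedInvariantCochains 𝒦 p ≤ 𝒢.cochains p :=
  fun _ hf => hf.1.1

theorem coboundary_mem_invariantCochains (𝒦 : 𝒢.WideSubgroupoid EK K) (p : ℕ)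
    (f : 𝒢.Nerve p → ℝ) (hf : f ∈ invariantCochains 𝒦 p) :
    𝒢.coboundary p f ∈ invariantCochains 𝒦 (p + 1) := by
  refine ⟨𝒢.coboundary_mem_cochains p f hf.1, fun i x k hk => ?_⟩
  simp only [coboundary, LinearMap.coe_mk, AddHom.coe_mk]
  refine Finset.sum_congr rfl fun j _ => ?_
  congr 1
  rcases Fin.eq_self_or_eq_succAbove j i with rfl | ⟨i', rfl⟩
  · rw [Nerve.face_act_self]
  · exact (congrArg f (Nerve.face_act_succAbove j i' x _ hk)).trans (hf.2 i' (x.face j) k hk)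

theorem coboundary_mem_normalizedInvariantCochains (𝒦 : 𝒢.WideSubgroupoid EK K) (p : ℕ)
    (f : 𝒢.Nerve p → ℝ) (hf : f ∈ normalizedInvariantCochains 𝒦 p) :
    𝒢.coboundary p f ∈ normalizedInvariantCochains 𝒦 (p + 1) := by
  refine ⟨coboundary_mem_invariantCochains 𝒦 p f hf.1, ?_⟩
  rintro x ⟨j, k, hk⟩
  have hb : 𝒢.tgt (𝒦.incl k) = (x.face j.succ).base j := by
    rw [hk]
    exact x.tgt_eq _ _ (by simp)
  simp only [coboundary, LinearMap.coe_mk, AddHom.coe_mk]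
  rw [Fintype.sum_eq_add j.castSucc j.succ (by simp [Fin.ext_iff])]
  · rw [Nerve.face_castSucc_eq_act j x _ hk.symm hb, hf.1.2]
    simp [pow_succ]
  · rintro i ⟨h1, h2⟩
    obtain ⟨l, hl⟩ := Nerve.exists_arr_face_eq i j x h1 h2
    rw [hf.2 _ ⟨l, k, by rw [hl, hk]⟩, mul_zero]

/-- The cochain complex with differential `δ` given by spaces `S p` of functions on `B_p G` that
are stable under `δ`. -/
noncomputable def complexOf (S : ∀ p, Submodule ℝ (𝒢.Nerve p → ℝ))
    (hS : ∀ p, ∀ f ∈ S p, 𝒢.coboundary p f ∈ S (p + 1)) : CochainComplex (ModuleCat ℝ) ℕ :=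
  CochainComplex.of (fun p => ModuleCat.of ℝ (S p))
    (fun p => ModuleCat.ofHom ((𝒢.coboundary p).restrict (hS p)))
    (fun p => ModuleCat.hom_ext (LinearMap.ext fun f =>
      Subtype.ext (𝒢.coboundary_coboundary p f.1)))

/-- The inclusion of a subcomplex. -/
noncomputable def inclusionOf (S T : ∀ p, Submodule ℝ (𝒢.Nerve p → ℝ))
    (hS : ∀ p, ∀ f ∈ S p, 𝒢.coboundary p f ∈ S (p + 1))
    (hT : ∀ p, ∀ f ∈ T p, 𝒢.coboundary p f ∈ T (p + 1)) (h : ∀ p, S p ≤ T p) :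
    complexOf S hS ⟶ complexOf T hT :=
  CochainComplex.ofHom (fun p => ModuleCat.ofHom (Submodule.inclusion (h p))) (fun p => by
    simp only [complexOf, CochainComplex.of_d]
    rfl)

variable (𝒢) in
/-- The groupoid complex `C(G)`, whose cohomology is the differentiable cohomology of `G`. -/
noncomputable def groupoidComplex : CochainComplex (ModuleCat ℝ) ℕ :=
  complexOf 𝒢.cochains 𝒢.coboundary_mem_cochains

/-- The `K`-invariant subcomplex `C(G)^K`. -/
noncomputable def invariantComplex (𝒦 : 𝒢.WideSubgroupoid EK K) : CochainComplex (ModuleCat ℝ) ℕ :=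
  complexOf (invariantCochains 𝒦) (coboundary_mem_invariantCochains 𝒦)

/-- The normalized `K`-invariant subcomplex. -/
noncomputable def normalizedInvariantComplex (𝒦 : 𝒢.WideSubgroupoid EK K) :
    CochainComplex (ModuleCat ℝ) ℕ :=
  complexOf (normalizedInvariantCochains 𝒦) (coboundary_mem_normalizedInvariantCochains 𝒦)

/-- The inclusion `C(G)^K ⟶ C(G)`. -/
noncomputable def invariantInclusion (𝒦 : 𝒢.WideSubgroupoid EK K) :
    invariantComplex 𝒦 ⟶ 𝒢.groupoidComplex :=
  inclusionOf _ _ _ _ (invariantCochains_le 𝒦)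

/-- The inclusion of the normalized `K`-invariant subcomplex in `C(G)`. -/
noncomputable def normalizedInvariantInclusion (𝒦 : 𝒢.WideSubgroupoid EK K) :
    normalizedInvariantComplex 𝒦 ⟶ 𝒢.groupoidComplex :=
  inclusionOf _ _ _ _ (normalizedInvariantCochains_le 𝒦)

end Cochains

/-! ### Haar systems and averaging -/

section Averaging

open MeasureTheory

/-- The fibre `t⁻¹(m)` of the target map. -/
abbrev TgtFiber (𝒢 : LieGroupoid EM EG M G) (m : M) : Type _ := {a : G // 𝒢.tgt a = m}

/-- Left translation `L_g : t⁻¹(s(g)) → t⁻¹(t(g))`, `a ↦ g a`. -/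
def leftTranslation (𝒢 : LieGroupoid EM EG M G) (g : G) (a : 𝒢.TgtFiber (𝒢.src g)) :
    𝒢.TgtFiber (𝒢.tgt g) :=
  ⟨𝒢.mul g a.1, 𝒢.tgt_mul g a.1 a.2.symm⟩

/-- A left invariant, properly supported, normalized Haar system on a Lie groupoid: a family of
measures on the fibres of `t` that integrates compactly supported smooth functions on `G` to
smooth functions on `M`, is invariant under left translations, consists of probability measures,
and whose total support, the closure in `G` of the union of the supports of its members, is mapped
properly to `M` by `t`. -/
structure HaarSystem (𝒢 : LieGroupoid EM EG M G) [MeasurableSpace G] where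
  measure : ∀ m : M, Measure (𝒢.TgtFiber m)
  contMDiff_integral : ∀ f : G → ℝ, ContMDiff 𝓘(ℝ, EG) 𝓘(ℝ, ℝ) ∞ f → HasCompactSupport f →
    ContMDiff 𝓘(ℝ, EM) 𝓘(ℝ, ℝ) ∞ (fun m => ∫ a, f a.1 ∂(measure m))
  map_leftTranslation : ∀ g : G,
    (measure (𝒢.src g)).map (𝒢.leftTranslation g) = measure (𝒢.tgt g)
  isProperMap_support : IsProperMap
    (fun a : closure (⋃ m, (Subtype.val : 𝒢.TgtFiber m → G) '' (measure m).support) => 𝒢.tgt a.1)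
  measure_univ : ∀ m, measure m Set.univ = 1

variable {𝒢 : LieGroupoid EM EG M G} {𝒦 : 𝒢.WideSubgroupoid EK K} [MeasurableSpace K]

/-- The point `x · a`, for the `i`-th action of an arrow `a` of `K`. -/
def actFiber {p : ℕ} (i : Fin (p + 1)) (x : 𝒢.Nerve p)
    (a : 𝒦.toLieGroupoid.TgtFiber (x.base i)) : 𝒢.Nerve p :=
  x.act i (𝒦.incl a.1) ((𝒦.tgt_incl a.1).trans a.2)

/-- The averaging operator `Av^(i)` for the `i`-th action of `K` on `B_p G`. -/
noncomputable def avg (μ : HaarSystem 𝒦.toLieGroupoid) {p : ℕ} (i : Fin (p + 1))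
    (f : 𝒢.Nerve p → ℝ) (x : 𝒢.Nerve p) : ℝ :=
  ∫ a, f (actFiber i x a) ∂(μ.measure (x.base i))

/-- The total averaging operator `Av = Av^(0) ∘ ⋯ ∘ Av^(p)`. -/
noncomputable def totalAvg (μ : HaarSystem 𝒦.toLieGroupoid) (p : ℕ) (f : 𝒢.Nerve p → ℝ) :
    𝒢.Nerve p → ℝ :=
  (List.finRange (p + 1)).foldr (fun i h => avg μ i h) f

end Averaging

end Groupoid

end LieGroupoid

/-!
The theorem rests on two analytic facts and two algebraic ones.

*Haar systems.* A smooth positive density on the fibres of the target map that is invariant under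
left translations is determined by its values at the identities, and these may be prescribed: choose
them in charts and patch them by a partition of unity (`nonempty_invariantDensity`). The change of
variables formula turns invariance of the density into invariance of the resulting measures
(`InvariantDensity.map_translate_fibreMeasure`). For a proper groupoid there is a nonnegative smooth
function `χ` on the base that is positive somewhere on every orbit, and such that the arrows
that end in a given compact set and start where `χ ≠ 0` lie in a compact set
(`IsProper.exists_cutoff`). Multiplying the measures by `χ ∘ s` and dividing by the total mass gives
the Haar system (`nonempty_haarSystem`); both factors are invariant, because left translations
preserve sources.

*Averages are smooth.* The definition of a Haar system only says that the integral of a fixed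
compactly supported smooth function depends smoothly on the fibre, whereas an average is the
integral of a function that varies with the point of the nerve. In a chart the Haar measures form a
family of functionals on functions with bounded derivatives that is weakly smooth in its parameter.
By the Banach-Steinhaus theorem, applied on `ℓ¹`, such a family is uniformly bounded on bounded
families of functions, locally in the parameter. Hence difference quotients may be taken under the
integral sign, and the family is jointly smooth in its own parameter and those of the integrand
(`WeaklySmooth.contDiffOn_slice`). A smooth partition of unity and the properness of the support
reduce the general integral to a finite sum of integrals in charts
(`HaarSystem.integrable_and_contDiffOn`). Left invariance makes an average over the `i`-th action
invariant under that action, and Fubini's theorem makes averages over different actions commute.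

*Averaging is a homotopy equivalence.* The `i`-th coface of a cochain does not depend on the `i`-th
base point, so averaging over that point fixes it, while the other averages pass through the coface.
With these relations the prism operator `∑ i, (-1) ^ i s_i Av⁽⁰⁾ ⋯ Av⁽ⁱ⁾` is a homotopy between the
identity and `Av` (`CosimplicialData.prism_δ`). As `Av` is a projection onto the invariant cochains,
the latter are a deformation retract.

*Normalization.* The invariant cochains form a cosimplicial vector space. An invariant cochain
vanishes whenever some `g_j` lies in `K` if and only if it vanishes when some `g_j` is an identity,
as the action of `g_j` itself moves it to an identity (`mem_normalizedInvariantCochains_iff`). So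
the normalized invariant cochains are the normalized cochains of a cosimplicial vector space, which
are a deformation retract: the maps `id - (δ t + t δ)` with `t = (-1) ^ k s_k` successively enforce
the vanishing of the codegeneracies (`CosimplicialData.normalizationHomotopy_δ`). The third
assertion follows by composing the two retractions.
-/

open Set Filter Topology

/-! ### Bounded families of smooth functions -/

section WeakFamilies

variable {S X F E : Type*} [NormedAddCommGroup X] [NormedSpace ℝ X]
  [NormedAddCommGroup F] [NormedSpace ℝ F] [NormedAddCommGroup E] [NormedSpace ℝ E]

/-- A bounded family of smooth functions: for each order, the derivatives of that order of all
members of the family are bounded by one constant. -/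
def BoundedFamily (g : S → X → ℝ) : Prop :=
  (∀ s, ContDiff ℝ ∞ (g s)) ∧ ∀ k : ℕ, ∃ C, ∀ s x, ‖iteratedFDeriv ℝ k (g s) x‖ ≤ C

namespace BoundedFamily

theorem comp {T : Type*} {g : S → X → ℝ} (hg : BoundedFamily g) (i : T → S) :
    BoundedFamily (fun t => g (i t)) :=
  ⟨fun _ => hg.1 _, fun k => (hg.2 k).imp fun _ h _ => h _⟩

/-- Restricting the members of a bounded family to slices gives a bounded family, uniformly in the
slice. -/
theorem slice {g : S → X × F → ℝ} (hg : BoundedFamily g) :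
    BoundedFamily (fun (q : S × X) (y : F) => g q.1 (q.2, y)) := by
  refine ⟨fun q => (hg.1 q.1).comp (contDiff_const.prodMk contDiff_id), fun k => ?_⟩
  obtain ⟨C, hC⟩ := hg.2 k
  refine ⟨C, fun q y => ?_⟩
  -- the slice is the composition of a translation and the linear map `inr`, of norm at most one
  have h1 : (fun y : F => g q.1 (q.2, y)) =
      (fun z : X × F => g q.1 (z + (q.2, 0))) ∘ ContinuousLinearMap.inr ℝ X F := by
    ext y; simp
  have h2 : ContDiff ℝ ∞ (fun z : X × F => g q.1 (z + (q.2, 0))) :=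
    (hg.1 q.1).comp (contDiff_id.add contDiff_const)
  change ‖iteratedFDeriv ℝ k (fun y : F => g q.1 (q.2, y)) y‖ ≤ C
  rw [h1, ContinuousLinearMap.iteratedFDeriv_comp_right _ h2 y (by exact_mod_cast le_top),
    iteratedFDeriv_comp_add_right]
  refine (ContinuousMultilinearMap.norm_compContinuousLinearMap_le _ _).trans ?_
  refine (mul_le_of_le_one_right (norm_nonneg _) ?_).trans (hC _ _)
  refine Finset.prod_le_one (fun _ _ => norm_nonneg _) fun _ _ => ?_
  exact ContinuousLinearMap.norm_inr_le_one ℝ X F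

theorem const_mul_add {g h : S → X → ℝ} (hg : BoundedFamily g) (hh : BoundedFamily h) (c d : ℝ) :
    BoundedFamily (fun s x => c * g s x + d * h s x) := by
  have sc : ∀ (c : ℝ) (g : S → X → ℝ), BoundedFamily g → ∀ s, ContDiff ℝ ∞ (c • g s) :=
    fun c g hg s => contDiff_const.mul (hg.1 s)
  refine ⟨fun s => (sc c g hg s).add (sc d h hh s), fun k => ?_⟩
  obtain ⟨C, hC⟩ := hg.2 k
  obtain ⟨D, hD⟩ := hh.2 k
  refine ⟨|c| * C + |d| * D, fun s x => ?_⟩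
  change ‖iteratedFDeriv ℝ k (c • g s + d • h s) x‖ ≤ _
  have of_inf : ∀ f : X → ℝ, ContDiff ℝ ∞ f → ContDiffAt ℝ k f x :=
    fun f hf => (hf.of_le (by exact_mod_cast le_top)).contDiffAt
  rw [iteratedFDeriv_add_apply (of_inf _ (sc c g hg s)) (of_inf _ (sc d h hh s)),
    iteratedFDeriv_const_smul_apply (of_inf _ (hg.1 s)),
    iteratedFDeriv_const_smul_apply (of_inf _ (hh.1 s))]
  refine (norm_add_le _ _).trans ?_
  rw [norm_smul, norm_smul, Real.norm_eq_abs, Real.norm_eq_abs]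
  gcongr
  exacts [hC s x, hD s x]

theorem of_hasCompactSupport {h : X → ℝ} (h1 : ContDiff ℝ ∞ h) (h2 : HasCompactSupport h) :
    BoundedFamily (fun _ : S => h) := by
  refine ⟨fun _ => h1, fun k => ?_⟩
  obtain ⟨C, hC⟩ := (h1.continuous_iteratedFDeriv (m := k)
    (by exact_mod_cast le_top)).bounded_above_of_compact_support (h2.iteratedFDeriv k)
  exact ⟨C, fun _ => hC⟩

/-- Differentiation in a fixed direction commutes with iterated derivatives. -/
theorem _root_.iteratedFDeriv_fderiv_apply {h : X → ℝ} (hh : ContDiff ℝ ∞ h) (w : X) (k : ℕ)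
    (x : X) :
    iteratedFDeriv ℝ k (fun x => fderiv ℝ h x w) x = fderiv ℝ (iteratedFDeriv ℝ k h) x w := by
  have hk : ∀ k : ℕ, ContDiff ℝ ∞ (iteratedFDeriv ℝ k h) := fun k =>
    hh.iteratedFDeriv_right (m := ∞) (by exact_mod_cast le_top)
  have ev : ∀ (k : ℕ) (x v : X) (m : Fin k → X), fderiv ℝ (iteratedFDeriv ℝ k h) x v m =
      fderiv ℝ (fun x => iteratedFDeriv ℝ k h x m) x v := fun k x v m => by
    rw [fderiv_continuousMultilinear_apply_const_apply ((hk k).differentiable (by simp) x)]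
  induction k generalizing x with
  | zero =>
    ext m
    rw [ev]
    simp
  | succ k ih =>
    ext m
    rw [ev, iteratedFDeriv_succ_apply_left]
    have hφ : ContDiff ℝ ∞ (fun x => iteratedFDeriv ℝ k h x (Fin.tail m)) := by
      exact (ContinuousMultilinearMap.apply ℝ (fun _ : Fin k => X) ℝ (Fin.tail m)).contDiff.comp
        (hk k)
    have e1 : iteratedFDeriv ℝ k (fun x => fderiv ℝ h x w) =
        fun x => fderiv ℝ (iteratedFDeriv ℝ k h) x w := funext fun x => ih x
    have hψ : ContDiff ℝ ∞ (fderiv ℝ (fun x => iteratedFDeriv ℝ k h x (Fin.tail m))) :=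
      hφ.fderiv_right (by simp)
    have hd : DifferentiableAt ℝ (fun x => fderiv ℝ (iteratedFDeriv ℝ k h) x w) x := by
      have : ContDiff ℝ ∞ (fderiv ℝ (iteratedFDeriv ℝ k h)) := (hk k).fderiv_right (by simp)
      exact (this.differentiable (by simp) x).clm_apply (differentiableAt_const _)
    rw [e1]
    rw [← fderiv_continuousMultilinear_apply_const_apply hd]
    simp only [ev, iteratedFDeriv_succ_apply_left]
    rw [fderiv_clm_apply (hψ.differentiable (by simp) x) (differentiableAt_const _),
      fderiv_clm_apply (hψ.differentiable (by simp) x) (differentiableAt_const _)]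
    simp only [fderiv_fun_const, Pi.zero_apply, ContinuousLinearMap.comp_zero, zero_add,
      ContinuousLinearMap.flip_apply]
    exact hφ.contDiffAt.isSymmSndFDerivAt
      (by simpa using WithTop.coe_le_coe.2 (le_top : (2 : ℕ∞) ≤ ⊤)) _ _

/-- The difference quotients of a compactly supported smooth function form a bounded family, by the
mean value inequality for the iterated derivatives. For `w = 0` the quotient is zero by
convention. -/
theorem difference {h : X → ℝ} (h1 : ContDiff ℝ ∞ h) (h2 : HasCompactSupport h) :
    BoundedFamily (fun (w : X) x => ‖w‖⁻¹ * (h (x + w) - h x)) := by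
  have hT : ∀ w, ContDiff ℝ ∞ (fun x => h (x + w)) := fun w =>
    h1.comp (contDiff_id.add contDiff_const)
  refine ⟨fun w => contDiff_const.mul ((hT w).sub h1), fun k => ?_⟩
  have hk : ContDiff ℝ ∞ (iteratedFDeriv ℝ k h) :=
    h1.iteratedFDeriv_right (m := ∞) (by exact_mod_cast le_top)
  obtain ⟨C, hC⟩ := (hk.continuous_fderiv (by simp)).bounded_above_of_compact_support
    ((h2.iteratedFDeriv k).fderiv ℝ)
  have hC0 : 0 ≤ C := (norm_nonneg _).trans (hC 0)
  refine ⟨C, fun w x => ?_⟩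
  have e : iteratedFDeriv ℝ k (fun x => ‖w‖⁻¹ * (h (x + w) - h x)) x =
      ‖w‖⁻¹ • (iteratedFDeriv ℝ k h (x + w) - iteratedFDeriv ℝ k h x) := by
    have : (fun x => ‖w‖⁻¹ * (h (x + w) - h x)) = ‖w‖⁻¹ • ((fun x => h (x + w)) - h) := by
      ext x; simp
    rw [this, iteratedFDeriv_const_smul_apply, iteratedFDeriv_sub_apply,
      iteratedFDeriv_comp_add_right]
    · exact ((hT w).of_le (by exact_mod_cast le_top)).contDiffAt
    · exact (h1.of_le (by exact_mod_cast le_top)).contDiffAt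
    · exact ((((hT w).sub h1)).of_le (by exact_mod_cast le_top)).contDiffAt
  rw [e, norm_smul, norm_inv, norm_norm]
  have := Convex.norm_image_sub_le_of_norm_fderiv_le (𝕜 := ℝ) (s := univ) (x := x) (y := x + w)
    (fun y _ => hk.differentiable (by simp) y) (fun y _ => hC y) convex_univ (mem_univ _)
    (mem_univ _)
  rw [add_sub_cancel_left] at this
  rcases eq_or_ne w 0 with rfl | hw
  · simpa using hC0
  · rwa [inv_mul_le_iff₀ (norm_pos_iff.2 hw), mul_comm]

/-- The first order Taylor remainders of a compactly supported smooth function, divided by the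
square of the norm of the increment, form a bounded family. -/
theorem remainder {h : X → ℝ} (h1 : ContDiff ℝ ∞ h) (h2 : HasCompactSupport h) :
    BoundedFamily (fun (w : X) x => (‖w‖ ^ 2)⁻¹ * (h (x + w) - h x - fderiv ℝ h x w)) := by
  have hT : ∀ w, ContDiff ℝ ∞ (fun x => h (x + w)) := fun w =>
    h1.comp (contDiff_id.add contDiff_const)
  have hD : ∀ w, ContDiff ℝ ∞ (fun x => fderiv ℝ h x w) := fun w =>
    (h1.fderiv_right (m := ∞) (by simp)).clm_apply contDiff_const
  refine ⟨fun w => contDiff_const.mul (((hT w).sub h1).sub (hD w)), fun k => ?_⟩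
  have hk : ContDiff ℝ ∞ (iteratedFDeriv ℝ k h) :=
    h1.iteratedFDeriv_right (m := ∞) (by exact_mod_cast le_top)
  have hk' : ContDiff ℝ ∞ (fderiv ℝ (iteratedFDeriv ℝ k h)) := hk.fderiv_right (by simp)
  obtain ⟨C, hC⟩ := (hk'.continuous_fderiv (by simp)).bounded_above_of_compact_support
    (((h2.iteratedFDeriv k).fderiv ℝ).fderiv ℝ)
  have hC0 : 0 ≤ C := (norm_nonneg _).trans (hC 0)
  refine ⟨C, fun w x => ?_⟩
  have e : iteratedFDeriv ℝ k (fun x => (‖w‖ ^ 2)⁻¹ * (h (x + w) - h x - fderiv ℝ h x w)) x =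
      (‖w‖ ^ 2)⁻¹ • (iteratedFDeriv ℝ k h (x + w) - iteratedFDeriv ℝ k h x
        - fderiv ℝ (iteratedFDeriv ℝ k h) x w) := by
    have : (fun x => (‖w‖ ^ 2)⁻¹ * (h (x + w) - h x - fderiv ℝ h x w)) =
        (‖w‖ ^ 2)⁻¹ • ((fun x => h (x + w)) - h - fun x => fderiv ℝ h x w) := by
      ext x; simp
    rw [this, iteratedFDeriv_const_smul_apply, iteratedFDeriv_sub_apply, iteratedFDeriv_sub_apply,
      iteratedFDeriv_comp_add_right, iteratedFDeriv_fderiv_apply h1]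
    · exact ((hT w).of_le (by exact_mod_cast le_top)).contDiffAt
    · exact (h1.of_le (by exact_mod_cast le_top)).contDiffAt
    · exact (((hT w).sub h1).of_le (by exact_mod_cast le_top)).contDiffAt
    · exact ((hD w).of_le (by exact_mod_cast le_top)).contDiffAt
    · exact ((((hT w).sub h1).sub (hD w)).of_le (by exact_mod_cast le_top)).contDiffAt
  rw [e, norm_smul, norm_inv, norm_pow, norm_norm]
  have hL : ∀ y, ‖fderiv ℝ (iteratedFDeriv ℝ k h) y - fderiv ℝ (iteratedFDeriv ℝ k h) x‖ ≤
      C * ‖y - x‖ := fun y =>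
    Convex.norm_image_sub_le_of_norm_fderiv_le (𝕜 := ℝ) (s := univ)
      (fun y _ => hk'.differentiable (by simp) y) (fun y _ => hC y) convex_univ (mem_univ _)
      (mem_univ _)
  -- the derivative varies by at most `C * ‖w‖` on the segment from `x` to `x + w`
  have := (convex_segment x (x + w)).norm_image_sub_le_of_norm_hasFDerivWithin_le'
    (f := iteratedFDeriv ℝ k h) (f' := fderiv ℝ (iteratedFDeriv ℝ k h))
    (φ := fderiv ℝ (iteratedFDeriv ℝ k h) x) (C := C * ‖w‖) (x := x) (y := x + w)
    (fun y _ => (hk.differentiable (by simp) y).hasFDerivAt.hasFDerivWithinAt)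
    (fun y hy => (hL y).trans (by
      gcongr
      obtain ⟨t, ⟨h0, h1⟩, rfl⟩ := (segment_eq_image' ℝ x (x + w) ▸ hy)
      simp only [add_sub_cancel_left, norm_smul, Real.norm_of_nonneg h0]
      exact mul_le_of_le_one_left (norm_nonneg _) h1))
    (left_mem_segment _ _ _) (right_mem_segment _ _ _)
  rw [add_sub_cancel_left] at this
  rcases eq_or_ne w 0 with rfl | hw
  · simpa using hC0
  · rw [inv_mul_le_iff₀ (by positivity)]
    exact this.trans (by rw [sq]; linarith)

/-- The `ℓ¹`-combinations of a bounded family form a bounded family. -/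
theorem tsum {g : ℕ → X → ℝ} (hg : BoundedFamily g) (ε : lp (fun _ : ℕ => ℝ) 1) :
    ContDiff ℝ ∞ (fun x => ∑' n, ε n * g n x) ∧
    ∀ k : ℕ, ∃ C, ∀ x, ‖iteratedFDeriv ℝ k (fun x => ∑' n, ε n * g n x) x‖ ≤ C := by
  have hs : Summable fun n => ‖ε n‖ := by
    simpa using (lp.memℓp ε).summable (by simp)
  choose C hC using hg.2
  have hsm : ∀ n, ContDiff ℝ ∞ (fun x => ε n * g n x) := fun n => contDiff_const.mul (hg.1 n)
  have hv : ∀ k : ℕ, (k : ℕ∞) ≤ (⊤ : ℕ∞) → Summable (fun n => ‖ε n‖ * C k) :=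
    fun k _ => hs.mul_right _
  have hb : ∀ (k n : ℕ) (x : X), (k : ℕ∞) ≤ (⊤ : ℕ∞) →
      ‖iteratedFDeriv ℝ k (fun x => ε n * g n x) x‖ ≤ ‖ε n‖ * C k := by
    intro k n x _
    have : (fun x => ε n * g n x) = ε n • g n := rfl
    rw [this, iteratedFDeriv_const_smul_apply
      ((hg.1 n).of_le (by exact_mod_cast le_top)).contDiffAt, norm_smul]
    gcongr
    exact hC k n x
  refine ⟨contDiff_tsum hsm hv hb, fun k => ⟨∑' n, ‖ε n‖ * C k, fun x => ?_⟩⟩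
  rw [iteratedFDeriv_tsum_apply hsm hv hb le_top]
  exact tsum_of_norm_bounded (hv k le_top).hasSum fun n => hb k n x le_top

end BoundedFamily
end WeakFamilies

/-! ### Weakly smooth families of functionals -/

section WeakFamilies

variable {S X F E : Type*} [NormedAddCommGroup X] [NormedSpace ℝ X]
  [NormedAddCommGroup F] [NormedSpace ℝ F] [NormedAddCommGroup E] [NormedSpace ℝ E]

/-- A weakly smooth family `Λ b`, `b ∈ V`, of functionals on the smooth functions with bounded
derivatives: `b ↦ Λ b g` is smooth for each such `g`, and each `Λ b` is continuous in the sense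
that it induces a bounded functional of the coefficients of the `ℓ¹`-combinations of a bounded
sequence. -/
def WeaklySmooth (V : Set E) (Λ : E → (F → ℝ) → ℝ) : Prop :=
  (∀ g : F → ℝ, BoundedFamily (fun _ : Unit => g) → ContDiffOn ℝ ∞ (fun b => Λ b g) V) ∧
  ∀ b ∈ V, ∀ g : ℕ → F → ℝ, BoundedFamily g →
    ∃ T : lp (fun _ : ℕ => ℝ) 1 →L[ℝ] ℝ, ∀ ε, T ε = Λ b (fun y => ∑' n, ε n * g n y)

namespace WeaklySmooth

omit [NormedAddCommGroup F] [NormedSpace ℝ F] in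
theorem tsum_single (g : ℕ → F → ℝ) (n : ℕ) (c : ℝ) :
    (fun y => ∑' k, (lp.single (E := fun _ : ℕ => ℝ) 1 n c) k * g k y) = fun y => c * g n y := by
  ext y
  rw [tsum_eq_single n fun k hk => by simp [Pi.single_eq_of_ne hk]]
  simp

variable {V : Set E} {Λ : E → (F → ℝ) → ℝ}

/-- The functionals of a weakly smooth family are linear. -/
theorem map_add_smul (hΛ : WeaklySmooth V Λ) {b : E} (hb : b ∈ V) {g h : F → ℝ}
    (hg : BoundedFamily (fun _ : Unit => g)) (hh : BoundedFamily (fun _ : Unit => h)) (c d : ℝ) :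
    Λ b (fun y => c * g y + d * h y) = c * Λ b g + d * Λ b h := by
  -- apply the functional on `ℓ¹` that belongs to the sequence `g, h, h, …`
  have hG : BoundedFamily (fun n : ℕ => if n = 0 then g else h) := by
    refine ⟨fun n => ?_, fun k => ?_⟩
    · dsimp only
      split_ifs
      exacts [hg.1 (), hh.1 ()]
    · obtain ⟨C, hC⟩ := hg.2 k
      obtain ⟨D, hD⟩ := hh.2 k
      refine ⟨max C D, fun n x => ?_⟩
      dsimp only
      split_ifs
      exacts [(hC () x).trans (le_max_left _ _), (hD () x).trans (le_max_right _ _)]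
  obtain ⟨T, hT⟩ := hΛ.2 b hb _ hG
  have e0 : ∀ c : ℝ, T (lp.single 1 0 c) = Λ b (fun y => c * g y) := fun c => by
    rw [hT, tsum_single]; simp
  have e1 : ∀ c : ℝ, T (lp.single 1 1 c) = Λ b (fun y => c * h y) := fun c => by
    rw [hT, tsum_single]; simp
  have e2 : T (lp.single 1 0 c + lp.single 1 1 d) = Λ b (fun y => c * g y + d * h y) := by
    rw [hT]
    congr 1
    ext y
    rw [tsum_eq_sum (s := {0, 1})]
    · simp
    · intro k hk
      simp only [Finset.mem_insert, Finset.mem_singleton, not_or] at hk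
      simp [Pi.single_eq_of_ne hk.1, Pi.single_eq_of_ne hk.2]
  have l0 : (lp.single (E := fun _ : ℕ => ℝ) 1 0 c) = c • lp.single 1 0 (1 : ℝ) := by
    rw [← lp.single_smul]; simp
  have l1 : (lp.single (E := fun _ : ℕ => ℝ) 1 1 d) = d • lp.single 1 1 (1 : ℝ) := by
    rw [← lp.single_smul]; simp
  rw [← e2, map_add, l0, l1, map_smul, map_smul, e0, e1]
  simp

open MeasureTheory in
/-- Integration against finite measures satisfies the continuity condition in the definition of a
weakly smooth family. -/
theorem of_integral {A : Type*} [MeasurableSpace A] (μ : E → Measure A) (ρ : A → ℝ) (v : A → F)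
    (h1 : ∀ g : F → ℝ, BoundedFamily (fun _ : Unit => g) →
      ContDiffOn ℝ ∞ (fun b => ∫ a, ρ a * g (v a) ∂(μ b)) V)
    (h2 : ∀ b ∈ V, ∀ g : F → ℝ, BoundedFamily (fun _ : Unit => g) →
      AEStronglyMeasurable (fun a => ρ a * g (v a)) (μ b))
    (h3 : ∀ b ∈ V, Integrable ρ (μ b)) :
    WeaklySmooth V (fun b g => ∫ a, ρ a * g (v a) ∂(μ b)) := by
  refine ⟨h1, fun b hb g hg => ?_⟩
  obtain ⟨C, hC⟩ := hg.2 0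
  simp only [norm_iteratedFDeriv_zero] at hC
  have hs : ∀ ε : lp (fun _ : ℕ => ℝ) 1, Summable fun n => ‖ε n‖ := fun ε => by
    simpa using (lp.memℓp ε).summable (by simp)
  have hb1 : ∀ (ε : lp (fun _ : ℕ => ℝ) 1) n y, ‖ε n * g n y‖ ≤ ‖ε n‖ * C := fun ε n y => by
    rw [norm_mul]; gcongr; exact hC n y
  have hsum : ∀ (ε : lp (fun _ : ℕ => ℝ) 1) y, Summable fun n => ε n * g n y := fun ε y =>
    Summable.of_norm_bounded ((hs ε).mul_right C) fun n => hb1 ε n y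
  have hnorm : ∀ ε : lp (fun _ : ℕ => ℝ) 1, ‖ε‖ = ∑' n, ‖ε n‖ := fun ε => by
    simp [lp.norm_eq_tsum_rpow (p := 1) (by simp) ε]
  have hbd : ∀ (ε : lp (fun _ : ℕ => ℝ) 1) y, ‖∑' n, ε n * g n y‖ ≤ ‖ε‖ * C := fun ε y => by
    rw [hnorm, ← tsum_mul_right]
    exact tsum_of_norm_bounded ((hs ε).mul_right C).hasSum fun n => hb1 ε n y
  have hint : ∀ ε : lp (fun _ : ℕ => ℝ) 1,
      Integrable (fun a => ρ a * ∑' n, ε n * g n (v a)) (μ b) := fun ε => by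
    have hε := hg.tsum ε
    refine ((h3 b hb).norm.mul_const (‖ε‖ * C)).mono'
      (h2 b hb _ ⟨fun _ => hε.1, fun k => (hε.2 k).imp fun _ h _ => h⟩)
      (Eventually.of_forall fun a => ?_)
    rw [norm_mul]
    gcongr
    exact hbd ε _
  let T : lp (fun _ : ℕ => ℝ) 1 →ₗ[ℝ] ℝ :=
    { toFun := fun ε => ∫ a, ρ a * ∑' n, ε n * g n (v a) ∂(μ b)
      map_add' := fun ε ε' => by
        rw [← integral_add (hint _) (hint _)]
        congr 1
        ext a
        rw [← mul_add, ← (hsum ε _).tsum_add (hsum ε' _)]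
        simp [add_mul]
      map_smul' := fun c ε => by
        rw [RingHom.id_apply, smul_eq_mul, ← integral_const_mul]
        congr 1
        ext a
        simp only [lp.coeFn_smul, Pi.smul_apply, smul_eq_mul, mul_assoc, tsum_mul_left]
        ring }
  refine ⟨T.mkContinuous (∫ a, ‖ρ a‖ * C ∂(μ b)) fun ε => ?_, fun ε => rfl⟩
  rw [← integral_mul_const]
  refine norm_integral_le_of_norm_le (((h3 b hb).norm.mul_const C).mul_const _)
    (Eventually.of_forall fun a => ?_)
  rw [norm_mul, mul_assoc, mul_comm C]
  gcongr
  exact hbd ε _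

/-- Uniform boundedness: a weakly smooth family is bounded on bounded families of functions,
uniformly over compact sets of parameters. -/
theorem exists_bound (hΛ : WeaklySmooth V Λ) {C : Set E} (hC : IsCompact C) (hCV : C ⊆ V)
    {g : S → F → ℝ} (hg : BoundedFamily g) : ∃ B, ∀ b ∈ C, ∀ s, |Λ b (g s)| ≤ B := by
  by_contra! hcon
  -- a sequence on which the family is unbounded contradicts the uniform boundedness principle for
  -- the functionals on `ℓ¹` that belong to this sequence
  choose b hb s hs using fun n : ℕ => hcon n
  have hg' := hg.comp s
  choose T hT using fun b : C => hΛ.2 b.1 (hCV b.2) _ hg'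
  obtain ⟨B, hB⟩ := banach_steinhaus (g := T) fun ε => by
    have hε := hg'.tsum ε
    obtain ⟨B, hB⟩ := hC.exists_bound_of_continuousOn
      ((hΛ.1 _ ⟨fun _ => hε.1, fun k => (hε.2 k).imp fun _ h _ => h⟩).continuousOn.mono hCV)
    exact ⟨B, fun b => by rw [hT]; exact hB b.1 b.2⟩
  obtain ⟨n, hn⟩ := exists_nat_gt B
  have h1 := hs n
  have h2 : T ⟨b n, hb n⟩ (lp.single 1 n 1) = Λ (b n) (g (s n)) := by
    rw [hT, tsum_single]; simp
  have h3 := (T ⟨b n, hb n⟩).le_of_opNorm_le (hB _) (lp.single 1 n (1 : ℝ))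
  rw [h2, lp.norm_single one_pos, norm_one, mul_one, Real.norm_eq_abs] at h3
  linarith

theorem exists_bound_point (hΛ : WeaklySmooth V Λ) {b : E} (hb : b ∈ V)
    {g : S → F → ℝ} (hg : BoundedFamily g) : ∃ B, ∀ s, |Λ b (g s)| ≤ B := by
  obtain ⟨B, hB⟩ := hΛ.exists_bound (isCompact_singleton (x := b)) (by simpa using hb) hg
  exact ⟨B, hB b rfl⟩

theorem hasFDerivAt (hΛ : WeaklySmooth V Λ) (hV : IsOpen V) {b : E} (hb : b ∈ V) {g : F → ℝ}
    (hg : BoundedFamily (fun _ : Unit => g)) :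
    HasFDerivAt (fun b => Λ b g) (fderiv ℝ (fun b => Λ b g) b) b :=
  (((hΛ.1 g hg).contDiffAt (hV.mem_nhds hb)).differentiableAt (by simp)).hasFDerivAt

/-- The directional derivatives of a weakly smooth family form a weakly smooth family: a pointwise
limit of bounded functionals on `ℓ¹` is bounded. -/
theorem fderiv (hΛ : WeaklySmooth V Λ) (hV : IsOpen V) (v : E) :
    WeaklySmooth V (fun b g => fderiv ℝ (fun b => Λ b g) b v) := by
  refine ⟨fun g hg => ?_, fun b hb g hg => ?_⟩
  · exact ((hΛ.1 g hg).fderiv_of_isOpen hV (m := ∞) (by simp)).clm_apply contDiffOn_const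
  · have hc : Tendsto (fun n : ℕ => b + ((n : ℝ) + 1)⁻¹ • v) atTop (𝓝 b) := by
      have : Tendsto (fun n : ℕ => b + ((n : ℝ) + 1)⁻¹ • v) atTop (𝓝 (b + (0 : ℝ) • v)) :=
        tendsto_const_nhds.add (Tendsto.smul_const (by
          simpa using tendsto_one_div_add_atTop_nhds_zero_nat (𝕜 := ℝ)) v)
      simpa using this
    -- the functional is the limit of the difference quotients at `b + v / (n + 1)`
    obtain ⟨N, hN⟩ := eventually_atTop.1 (hc.eventually (hV.mem_nhds hb))
    obtain ⟨T0, hT0⟩ := hΛ.2 b hb g hg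
    choose T hT using fun n : ℕ => hΛ.2 _ (hN (n + N) (by omega)) g hg
    have hlim : ∀ ε, Tendsto (fun n : ℕ => (((n + N : ℕ) : ℝ) + 1) • (T n - T0) ε) atTop
        (𝓝 (_root_.fderiv ℝ (fun b => Λ b (fun y => ∑' n, ε n * g n y)) b v)) := by
      intro ε
      have hε := hg.tsum ε
      have hd := hΛ.hasFDerivAt hV hb ⟨fun _ => hε.1, fun k => (hε.2 k).imp fun _ h _ => h⟩
      have := hd.lim v (c := fun n : ℕ => ((n : ℝ) + 1)) (l := atTop) (by
        refine tendsto_norm_atTop_atTop.comp ?_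
        exact tendsto_atTop_add_const_right _ _ tendsto_natCast_atTop_atTop)
      refine (this.comp (tendsto_add_atTop_nat N)).congr fun n => ?_
      simp [hT, hT0]
    refine ⟨continuousLinearMapOfTendsto (l := atTop)
      (fun n : ℕ => (((n + N : ℕ) : ℝ) + 1) • (T n - T0))
      (f := fun ε => _root_.fderiv ℝ (fun b => Λ b (fun y => ∑' n, ε n * g n y)) b v)
      (tendsto_pi_nhds.2 fun ε => by simpa using hlim ε), fun ε => rfl⟩

variable {P : Type*} [NormedAddCommGroup P] [NormedSpace ℝ P]

/-- The slices of a compactly supported smooth function. -/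
theorem boundedFamily_slice {H : P × F → ℝ} (h1 : ContDiff ℝ ∞ H) (h2 : HasCompactSupport H) :
    BoundedFamily (fun (u : P) (y : F) => H (u, y)) :=
  (BoundedFamily.of_hasCompactSupport (S := Unit) h1 h2).slice.comp fun u => ((), u)

/-- Joint continuity: by uniform boundedness on difference quotients, `Λ b (H (u, ·))` is locally
Lipschitz in `u`, uniformly in `b`. -/
theorem continuousOn_slice (hΛ : WeaklySmooth V Λ) (hV : IsOpen V) [FiniteDimensional ℝ E]
    {H : P × F → ℝ} (h1 : ContDiff ℝ ∞ H) (h2 : HasCompactSupport H) :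
    ContinuousOn (fun q : P × E => Λ q.2 (fun y => H (q.1, y))) (univ ×ˢ V) := by
  rintro ⟨u, b⟩ ⟨-, hb⟩
  refine ContinuousAt.continuousWithinAt ?_
  have : ProperSpace E := FiniteDimensional.proper_real E
  obtain ⟨C, hC, hCV, hCc⟩ := local_compact_nhds (hV.mem_nhds hb)
  obtain ⟨B, hB⟩ := hΛ.exists_bound hCc hCV
    ((BoundedFamily.difference h1 h2).slice.comp fun w : P × P => ((w.1, (0 : F)), w.2))
  have hbdd := boundedFamily_slice h1 h2
  have hlip : ∀ᶠ q : P × E in 𝓝 (u, b),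
      |Λ q.2 (fun y => H (q.1, y)) - Λ q.2 (fun y => H (u, y))| ≤ B * ‖q.1 - u‖ := by
    have : ∀ᶠ q : P × E in 𝓝 (u, b), q.2 ∈ C := continuous_snd.continuousAt.eventually hC
    filter_upwards [this] with q hq
    rcases eq_or_ne q.1 u with h | h
    · simp [h]
    · have h3 := hB q.2 hq (q.1 - u, u)
      have h0 : 0 < ‖q.1 - u‖ := norm_pos_iff.2 (sub_ne_zero.2 h)
      have e : (fun y => ‖((q.1 - u, (0 : F)) : P × F)‖⁻¹ *
          (H ((u, y) + (q.1 - u, 0)) - H (u, y))) =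
          fun y => ‖q.1 - u‖⁻¹ * H (q.1, y) + (-‖q.1 - u‖⁻¹) * H (u, y) := by
        ext y
        simp only [Prod.mk_add_mk, add_sub_cancel, add_zero, Prod.norm_mk, norm_zero,
          norm_nonneg, sup_of_le_left]
        ring
      simp only [e] at h3
      rw [hΛ.map_add_smul (hCV hq) (hbdd.comp fun _ => q.1) (hbdd.comp fun _ => u)] at h3
      rw [show ‖q.1 - u‖⁻¹ * Λ q.2 (fun y => H (q.1, y)) +
        -‖q.1 - u‖⁻¹ * Λ q.2 (fun y => H (u, y)) = ‖q.1 - u‖⁻¹ *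
        (Λ q.2 (fun y => H (q.1, y)) - Λ q.2 (fun y => H (u, y))) by ring, abs_mul,
        abs_of_pos (inv_pos.2 h0), inv_mul_le_iff₀ h0] at h3
      linarith
  have hcont : ContinuousAt (fun q : P × E => Λ q.2 (fun y => H (u, y))) (u, b) :=
    ContinuousAt.comp (f := Prod.snd) (g := fun b => Λ b (fun y => H (u, y)))
      ((hΛ.1 _ (hbdd.comp fun _ => u)).continuousOn.continuousAt (hV.mem_nhds hb))
      continuousAt_snd
  have hz : Tendsto (fun q : P × E => Λ q.2 (fun y => H (q.1, y)) - Λ q.2 (fun y => H (u, y)))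
      (𝓝 (u, b)) (𝓝 0) := by
    refine squeeze_zero_norm' (a := fun q : P × E => B * ‖q.1 - u‖) hlip ?_
    have : Continuous fun q : P × E => B * ‖q.1 - u‖ := by fun_prop
    simpa using this.tendsto (u, b)
  have := hz.add hcont.tendsto
  simpa [ContinuousAt] using this

/-- The partial derivative in the direction of the parameter of the function: differentiation under
`Λ b`. -/
theorem hasFDerivAt_slice (hΛ : WeaklySmooth V Λ) [FiniteDimensional ℝ P] {b : E} (hb : b ∈ V)
    {H : P × F → ℝ} (h1 : ContDiff ℝ ∞ H) (h2 : HasCompactSupport H) (u : P) :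
    ∃ L : P →L[ℝ] ℝ, (∀ w, L w = Λ b (fun y => _root_.fderiv ℝ H (u, y) (w, 0))) ∧
      HasFDerivAt (fun u => Λ b (fun y => H (u, y))) L u := by
  have hD : ∀ w : P × F, ContDiff ℝ ∞ (fun x => _root_.fderiv ℝ H x w) := fun w =>
    (h1.fderiv_right (m := ∞) (by simp)).clm_apply contDiff_const
  have hDb : ∀ w : P, BoundedFamily (fun _ : Unit => fun y => _root_.fderiv ℝ H (u, y) (w, 0)) :=
    fun w => (boundedFamily_slice (hD (w, 0)) (h2.fderiv_apply ℝ _)).comp fun _ => u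
  let L₀ : P →ₗ[ℝ] ℝ :=
    { toFun := fun w => Λ b (fun y => _root_.fderiv ℝ H (u, y) (w, 0))
      map_add' := fun w w' => by
        have := hΛ.map_add_smul hb (hDb w) (hDb w') 1 1
        simp only [one_mul, ← map_add] at this
        simpa using this
      map_smul' := fun c w => by
        have := hΛ.map_add_smul hb (hDb w) (hDb w) c 0
        simp only [← smul_eq_mul, ← map_smul] at this
        simpa using this }
  refine ⟨LinearMap.toContinuousLinearMap L₀, fun w => rfl, ?_⟩
  obtain ⟨B, hB⟩ := hΛ.exists_bound_point hb
    ((BoundedFamily.remainder h1 h2).slice.comp fun w : P => ((w, (0 : F)), u))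
  have hbdd := boundedFamily_slice h1 h2
  rw [hasFDerivAt_iff_isLittleO_nhds_zero]
  have hO : (fun w : P => Λ b (fun y => H (u + w, y)) - Λ b (fun y => H (u, y)) - L₀ w) =O[𝓝 0]
      fun w => ‖w‖ ^ 2 := by
    refine Asymptotics.IsBigO.of_bound B (Eventually.of_forall fun w => ?_)
    rcases eq_or_ne w 0 with rfl | hw
    · simp
    have h0 : 0 < ‖w‖ ^ 2 := by positivity
    have h3 := hB w
    have e : (fun y => (‖((w, (0 : F)) : P × F)‖ ^ 2)⁻¹ *
          (H ((u, y) + (w, 0)) - H (u, y) - _root_.fderiv ℝ H (u, y) (w, 0))) =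
          fun y => (‖w‖ ^ 2)⁻¹ * (1 * H (u + w, y) + (-1) * H (u, y)) +
            (-(‖w‖ ^ 2)⁻¹) * _root_.fderiv ℝ H (u, y) (w, 0) := by
      ext y
      simp only [Prod.mk_add_mk, add_zero, Prod.norm_mk, norm_zero,
          norm_nonneg, sup_of_le_left]
      ring
    have hsub : BoundedFamily (fun _ : Unit => fun y => 1 * H (u + w, y) + (-1) * H (u, y)) :=
      (hbdd.comp fun _ => u + w).const_mul_add (hbdd.comp fun _ => u) 1 (-1)
    simp only [e] at h3
    rw [hΛ.map_add_smul hb hsub (hDb w), hΛ.map_add_smul hb (hbdd.comp fun _ => u + w)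
      (hbdd.comp fun _ => u), show ∀ a a' a'' : ℝ,
        (‖w‖ ^ 2)⁻¹ * (1 * a + -1 * a') + -(‖w‖ ^ 2)⁻¹ * a'' = (‖w‖ ^ 2)⁻¹ * (a - a' - a'') by
          intros; ring, abs_mul, abs_of_pos (inv_pos.2 h0),
      inv_mul_le_iff₀ h0] at h3
    rw [Real.norm_eq_abs, Real.norm_of_nonneg h0.le, mul_comm B]
    exact h3
  exact hO.trans_isLittleO ((Asymptotics.isLittleO_norm_pow_id one_lt_two))

/-- Joint smoothness of finite order. The partial derivatives are of the same form, for a derivative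
of `H` and for the derivative of the family `Λ`, so that the order can be raised by induction. -/
theorem contDiffOn_slice_nat [FiniteDimensional ℝ E] [FiniteDimensional ℝ P] (hV : IsOpen V)
    (n : ℕ) (hΛ : WeaklySmooth V Λ)
    {H : P × F → ℝ} (h1 : ContDiff ℝ ∞ H) (h2 : HasCompactSupport H) :
    ContDiffOn ℝ n (fun q : P × E => Λ q.2 (fun y => H (q.1, y))) (univ ×ˢ V) := by
  induction n generalizing Λ H with
  | zero => exact contDiffOn_zero.2 (hΛ.continuousOn_slice hV h1 h2)
  | succ n ih =>
    have hD : ∀ w : P × F, ContDiff ℝ ∞ (fun x => _root_.fderiv ℝ H x w) := fun w =>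
      (h1.fderiv_right (m := ∞) (by simp)).clm_apply contDiff_const
    have hDc : ∀ w : P × F, HasCompactSupport (fun x => _root_.fderiv ℝ H x w) := fun w =>
      h2.fderiv_apply ℝ _
    have hbdd := boundedFamily_slice h1 h2
    have hO : IsOpen (univ ×ˢ V : Set (P × E)) := isOpen_univ.prod hV
    choose! L hL hL' using fun (b : E) (hb : b ∈ V) (u : P) => hΛ.hasFDerivAt_slice hb h1 h2 u
    let L' : P × E → E →L[ℝ] ℝ := fun q => _root_.fderiv ℝ (fun b => Λ b (fun y => H (q.1, y))) q.2
    have c1 : ContDiffOn ℝ n (fun q : P × E => L q.2 q.1) (univ ×ˢ V) := by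
      refine contDiffOn_clm_apply.2 fun w => ?_
      exact (ih hΛ (hD (w, 0)) (hDc (w, 0))).congr fun q hq => hL _ hq.2 _ _
    have c2 : ContDiffOn ℝ n L' (univ ×ˢ V) :=
      contDiffOn_clm_apply.2 fun v => ih (hΛ.fderiv hV v) h1 h2
    have key : ∀ q ∈ (univ ×ˢ V : Set (P × E)), HasFDerivAt
        (fun q : P × E => Λ q.2 (fun y => H (q.1, y))) ((L q.2 q.1).coprod (L' q)) q := by
      intro q hq
      refine (hasStrictFDerivAt_uncurry_coprod (𝕜 := ℝ) (u := q)
        (f := fun u b => Λ b (fun y => H (u, y)))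
        (f₁ := fun u b => L b u) (f₂ := fun u b => L' (u, b)) ?_ ?_ ?_ ?_).hasFDerivAt
      · filter_upwards [hO.mem_nhds hq] with r hr
        exact hL' _ hr.2 _
      · filter_upwards [hO.mem_nhds hq] with r hr
        exact hΛ.hasFDerivAt hV hr.2 (hbdd.comp fun _ => r.1)
      · exact c1.continuousOn.continuousAt (hO.mem_nhds hq)
      · exact c2.continuousOn.continuousAt (hO.mem_nhds hq)
    have h3 : ContDiffOn ℝ (n + 1) (fun q : P × E => Λ q.2 (fun y => H (q.1, y))) (univ ×ˢ V) := by
      rw [contDiffOn_succ_iff_fderiv_of_isOpen hO]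
      refine ⟨fun q hq => (key q hq).differentiableAt.differentiableWithinAt, by simp, ?_⟩
      refine ContDiffOn.congr (f := fun q : P × E => (L q.2 q.1).coprod (L' q)) ?_
        fun q hq => (key q hq).fderiv
      refine contDiffOn_clm_apply.2 fun w => ?_
      simp only [ContinuousLinearMap.coprod_apply]
      exact (c1.clm_apply contDiffOn_const).add (c2.clm_apply contDiffOn_const)
    exact_mod_cast h3

/-- A weakly smooth family of functionals is smooth jointly with the parameters of the functions
to which it is applied. -/
theorem contDiffOn_slice [FiniteDimensional ℝ E] [FiniteDimensional ℝ P] (hV : IsOpen V)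
    (hΛ : WeaklySmooth V Λ) {H : P × F → ℝ} (h1 : ContDiff ℝ ∞ H) (h2 : HasCompactSupport H) :
    ContDiffOn ℝ ∞ (fun q : P × E => Λ q.2 (fun y => H (q.1, y))) (univ ×ˢ V) :=
  contDiffOn_infty.2 fun n => hΛ.contDiffOn_slice_nat hV n h1 h2

end WeaklySmooth
end WeakFamilies

/-! ### Charts adapted to the target map -/

namespace LieGroupoid

variable {EM EG M G : Type*}
  [NormedAddCommGroup EM] [NormedSpace ℝ EM] [TopologicalSpace M] [ChartedSpace EM M]
  [NormedAddCommGroup EG] [NormedSpace ℝ EG] [TopologicalSpace G] [ChartedSpace EG G]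
  {F : Type*} [NormedAddCommGroup F] [NormedSpace ℝ F]

/-- A chart of `G` adapted to the target map: its image is a product of the image of a chart of
`M` and an open set `slice` of `F`, and it turns the target map into the first projection. The
second component is thus a chart of each fibre of the target map over the domain of `base`. -/
structure TgtChart (𝒢 : LieGroupoid EM EG M G) (F : Type*) [NormedAddCommGroup F]
    [NormedSpace ℝ F] where
  chart : OpenPartialHomeomorph G (EM × F)
  base : OpenPartialHomeomorph M EM
  slice : Set F
  isOpen_slice : IsOpen slice
  target_eq : chart.target = base.target ×ˢ slice
  tgt_mem : ∀ a ∈ chart.source, 𝒢.tgt a ∈ base.source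
  base_tgt : ∀ a ∈ chart.source, base (𝒢.tgt a) = (chart a).1
  contMDiffOn_chart : ContMDiffOn 𝓘(ℝ, EG) 𝓘(ℝ, EM × F) ∞ chart chart.source
  contMDiffOn_chart_symm : ContMDiffOn 𝓘(ℝ, EM × F) 𝓘(ℝ, EG) ∞ chart.symm chart.target
  contMDiffOn_base : ContMDiffOn 𝓘(ℝ, EM) 𝓘(ℝ, EM) ∞ base base.source
  contMDiffOn_base_symm : ContMDiffOn 𝓘(ℝ, EM) 𝓘(ℝ, EM) ∞ base.symm base.target

namespace TgtChart

variable {𝒢 : LieGroupoid EM EG M G} (c : 𝒢.TgtChart F)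

/-- The arrow with given target and given coordinate in the fibre. -/
def point (m : M) (y : F) : G := c.chart.symm (c.base m, y)

/-- The coordinate of an arrow in its fibre. -/
def coord (a : G) : F := (c.chart a).2

theorem mem_target {m : M} (hm : m ∈ c.base.source) {y : F} (hy : y ∈ c.slice) :
    (c.base m, y) ∈ c.chart.target := by
  rw [c.target_eq]
  exact ⟨c.base.map_source hm, hy⟩

theorem point_mem {m : M} (hm : m ∈ c.base.source) {y : F} (hy : y ∈ c.slice) :
    c.point m y ∈ c.chart.source :=
  c.chart.map_target (c.mem_target hm hy)

theorem tgt_point {m : M} (hm : m ∈ c.base.source) {y : F} (hy : y ∈ c.slice) :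
    𝒢.tgt (c.point m y) = m := by
  have h := c.point_mem hm hy
  apply c.base.injOn (c.tgt_mem _ h) hm
  rw [c.base_tgt _ h, point, c.chart.right_inv (c.mem_target hm hy)]

theorem coord_point {m : M} (hm : m ∈ c.base.source) {y : F} (hy : y ∈ c.slice) :
    c.coord (c.point m y) = y := by
  rw [coord, point, c.chart.right_inv (c.mem_target hm hy)]

theorem coord_mem {a : G} (ha : a ∈ c.chart.source) : c.coord a ∈ c.slice := by
  have := c.chart.map_source ha
  rw [c.target_eq] at this
  exact this.2

theorem point_coord {a : G} (ha : a ∈ c.chart.source) : c.point (𝒢.tgt a) (c.coord a) = a := by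
  rw [point, c.base_tgt a ha]
  exact c.chart.left_inv ha

theorem contMDiffOn_coord : ContMDiffOn 𝓘(ℝ, EG) 𝓘(ℝ, F) ∞ c.coord c.chart.source :=
  contDiff_snd.contMDiff.comp_contMDiffOn c.contMDiffOn_chart

/-- The arrow with given target and fibre coordinate depends smoothly on both of them. -/
theorem contMDiffOn_point {P : Type*} [NormedAddCommGroup P] [NormedSpace ℝ P] {U : Set P}
    {b : P → M} {y : P → F} (hb : ContMDiffOn 𝓘(ℝ, P) 𝓘(ℝ, EM) ∞ b U) (hy : ContDiffOn ℝ ∞ y U)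
    (hbU : MapsTo b U c.base.source) (hyU : MapsTo y U c.slice) :
    ContMDiffOn 𝓘(ℝ, P) 𝓘(ℝ, EG) ∞ (fun u => c.point (b u) (y u)) U := by
  have h1 : ContMDiffOn 𝓘(ℝ, P) 𝓘(ℝ, EM) ∞ (fun u => c.base (b u)) U :=
    c.contMDiffOn_base.comp hb hbU
  have h2 : ContMDiffOn 𝓘(ℝ, P) 𝓘(ℝ, EM × F) ∞ (fun u => (c.base (b u), y u)) U :=
    (h1.contDiffOn.prodMk hy).contMDiffOn
  exact c.contMDiffOn_chart_symm.comp h2 fun u hu => c.mem_target (hbU hu) (hyU hu)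

/-- Every arrow lies in the domain of a chart adapted to the target map, if the target map is a
submersion with complement `F`. -/
theorem exists_mem_source [IsManifold 𝓘(ℝ, EM) ∞ M] [IsManifold 𝓘(ℝ, EG) ∞ G]
    (𝒢 : LieGroupoid EM EG M G) {a : G}
    (h : Manifold.IsSubmersionAtOfComplement F 𝓘(ℝ, EG) 𝓘(ℝ, EM) ∞ 𝒢.tgt a) :
    ∃ c : 𝒢.TgtChart F, a ∈ c.chart.source := by
  let e := h.equiv.toHomeomorph.toOpenPartialHomeomorph
  let φ := h.domChart.trans e
  let ψ := h.codChart
  have hφs : φ.source = h.domChart.source := by simp [φ, e]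
  have ha : a ∈ φ.source := hφs ▸ h.mem_domChart_source
  have hφ1 : ∀ x ∈ φ.source, ψ (𝒢.tgt x) = (φ x).1 := by
    intro x hx
    rw [hφs] at hx
    have h1 : h.domChart x ∈ (h.domChart.extend 𝓘(ℝ, EG)).target := by
      simpa using h.domChart.map_source hx
    have := h.writtenInCharts h1
    simpa [h.domChart.left_inv hx, ψ, φ, e] using this
  have hψ : ∀ x ∈ φ.source, 𝒢.tgt x ∈ ψ.source := by
    intro x hx
    rw [hφs] at hx
    exact h.source_subset_preimage_source hx
  -- shrink the normal form of the submersion to a product of balls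
  obtain ⟨r, hr, hball⟩ := Metric.isOpen_iff.1 φ.open_target _ (φ.map_source ha)
  rw [← ball_prod_same] at hball
  set x₀ := (φ a).1
  set y₀ := (φ a).2
  have hx : Metric.ball x₀ r ⊆ ψ.target := fun x hx => by
    have h1 : (x, y₀) ∈ φ.target := hball ⟨hx, Metric.mem_ball_self hr⟩
    have h2 := φ.map_target h1
    have h3 := hφ1 _ h2
    rw [φ.right_inv h1] at h3
    have h4 := ψ.map_source (hψ _ h2)
    rwa [h3] at h4
  have hbox : IsOpen (Metric.ball x₀ r ×ˢ Metric.ball y₀ r) :=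
    Metric.isOpen_ball.prod Metric.isOpen_ball
  have hφc : ContMDiffOn 𝓘(ℝ, EG) 𝓘(ℝ, EM × F) ∞ φ φ.source := by
    have h1 := contMDiffOn_of_mem_maximalAtlas h.domChart_mem_maximalAtlas
    have h2 : ContMDiff 𝓘(ℝ, EG) 𝓘(ℝ, EM × F) ∞ h.equiv := h.equiv.contDiff.contMDiff
    rw [hφs]
    exact h2.comp_contMDiffOn h1
  have hφc' : ContMDiffOn 𝓘(ℝ, EM × F) 𝓘(ℝ, EG) ∞ φ.symm φ.target := by
    have h1 := contMDiffOn_symm_of_mem_maximalAtlas h.domChart_mem_maximalAtlas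
    have h2 : ContMDiff 𝓘(ℝ, EM × F) 𝓘(ℝ, EG) ∞ h.equiv.symm := h.equiv.symm.contDiff.contMDiff
    exact h1.comp h2.contMDiffOn fun x hx => by simpa [φ, e] using hx
  have hψc := contMDiffOn_of_mem_maximalAtlas h.codChart_mem_maximalAtlas
  have hψc' := contMDiffOn_symm_of_mem_maximalAtlas h.codChart_mem_maximalAtlas
  have ht1 : (φ.symm.restrOpen _ hbox).source = Metric.ball x₀ r ×ˢ Metric.ball y₀ r := by
    simpa using hball
  have ht2 : (ψ.symm.restrOpen _ (Metric.isOpen_ball (x := x₀) (ε := r))).source =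
      Metric.ball x₀ r := by
    simpa using hx
  have hs1 : ∀ x, x ∈ (φ.symm.restrOpen _ hbox).symm.source ↔
      x ∈ φ.source ∧ φ x ∈ Metric.ball x₀ r ×ˢ Metric.ball y₀ r := fun x => by
    simp
  have hs2 : ∀ x, x ∈ (ψ.symm.restrOpen _ (Metric.isOpen_ball (x := x₀) (ε := r))).symm.source ↔
      x ∈ ψ.source ∧ ψ x ∈ Metric.ball x₀ r := fun x => by
    simp
  refine ⟨⟨(φ.symm.restrOpen _ hbox).symm,
    (ψ.symm.restrOpen _ (Metric.isOpen_ball (x := x₀) (ε := r))).symm,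
    Metric.ball y₀ r, Metric.isOpen_ball, ?_, ?_, ?_, ?_, ?_, ?_, ?_⟩, ?_⟩
  · rw [OpenPartialHomeomorph.symm_target, OpenPartialHomeomorph.symm_target, ht1, ht2]
  · intro x hx
    obtain ⟨h1, h2⟩ := (hs1 x).1 hx
    exact (hs2 _).2 ⟨hψ x h1, by rw [hφ1 x h1]; exact h2.1⟩
  · intro x hx
    exact hφ1 x ((hs1 x).1 hx).1
  · exact hφc.mono fun x hx => ((hs1 x).1 hx).1
  · refine hφc'.mono ?_
    rw [OpenPartialHomeomorph.symm_target, ht1]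
    exact hball
  · exact hψc.mono fun x hx => ((hs2 x).1 hx).1
  · refine hψc'.mono ?_
    rw [OpenPartialHomeomorph.symm_target, ht2]
    exact hx
  · exact (hs1 a).2 ⟨ha, Metric.mem_ball_self hr, Metric.mem_ball_self hr⟩

end TgtChart

/-- The charts adapted to the target map cover `G`; a single dimension serves for all fibres. -/
theorem exists_tgtChart [IsManifold 𝓘(ℝ, EM) ∞ M] [IsManifold 𝓘(ℝ, EG) ∞ G]
    [FiniteDimensional ℝ EG] (𝒢 : LieGroupoid EM EG M G) :
    ∃ d : ℕ, ∀ a : G, ∃ c : 𝒢.TgtChart (EuclideanSpace ℝ (Fin d)), a ∈ c.chart.source := by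
  obtain ⟨F, _, _, hF⟩ := 𝒢.isSubmersion_tgt
  refine ⟨Module.finrank ℝ F, fun a => ?_⟩
  have : FiniteDimensional ℝ F := by
    have : FiniteDimensional ℝ (EM × F) := (hF a).equiv.toLinearEquiv.finiteDimensional
    exact FiniteDimensional.of_surjective (LinearMap.snd ℝ EM F) LinearMap.snd_surjective
  exact TgtChart.exists_mem_source 𝒢 ((hF a).trans_F
    (ContinuousLinearEquiv.ofFinrankEq (by simp)))

end LieGroupoid

/-! ### Integration against a Haar system -/

namespace LieGroupoid

variable {EM EG M G : Type*}
  [NormedAddCommGroup EM] [NormedSpace ℝ EM] [TopologicalSpace M] [ChartedSpace EM M]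
  [NormedAddCommGroup EG] [NormedSpace ℝ EG] [TopologicalSpace G] [ChartedSpace EG G]
  {F P : Type*} [NormedAddCommGroup F] [NormedSpace ℝ F] [NormedAddCommGroup P] [NormedSpace ℝ P]
  {𝒢 : LieGroupoid EM EG M G}

theorem continuous_tgt (𝒢 : LieGroupoid EM EG M G) : Continuous 𝒢.tgt :=
  𝒢.isSubmersion_tgt.contMDiff.continuous

theorem continuous_src (𝒢 : LieGroupoid EM EG M G) : Continuous 𝒢.src :=
  𝒢.isSubmersion_src.contMDiff.continuous

open MeasureTheory

theorem measurableEmbedding_val [T1Space M] [MeasurableSpace G] [OpensMeasurableSpace G] (m : M) :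
    MeasurableEmbedding (Subtype.val : 𝒢.TgtFiber m → G) :=
  MeasurableEmbedding.subtype_coe
    (isClosed_singleton.preimage 𝒢.continuous_tgt : IsClosed (𝒢.tgt ⁻¹' {m})).measurableSet

namespace HaarSystem

variable [MeasurableSpace G] (μ : HaarSystem 𝒢)

/-- The member of a Haar system over `m`, as a measure on `G` concentrated on the fibre. -/
noncomputable def onArrows (m : M) : Measure G := (μ.measure m).map Subtype.val

/-- The total support of a Haar system. -/
def totalSupport : Set G := closure (⋃ m, (Subtype.val : 𝒢.TgtFiber m → G) '' (μ.measure m).support)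

instance (m : M) : IsProbabilityMeasure (μ.measure m) := ⟨μ.measure_univ m⟩

instance (m : M) : IsProbabilityMeasure (μ.onArrows m) :=
  Measure.isProbabilityMeasure_map measurable_subtype_coe.aemeasurable

section

variable [T1Space M] [OpensMeasurableSpace G]

theorem integral_onArrows (m : M) (h : G → ℝ) :
    ∫ a, h a ∂(μ.onArrows m) = ∫ a, h a.1 ∂(μ.measure m) :=
  (measurableEmbedding_val m).integral_map h

theorem ae_onArrows_iff {m : M} {p : G → Prop} :
    (∀ᵐ a ∂(μ.onArrows m), p a) ↔ ∀ᵐ a ∂(μ.measure m), p a.1 :=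
  (measurableEmbedding_val m).ae_map_iff

theorem integrable_onArrows_iff {m : M} {h : G → ℝ} :
    Integrable h (μ.onArrows m) ↔ Integrable (fun a => h a.1) (μ.measure m) :=
  (measurableEmbedding_val m).integrable_map_iff

theorem ae_tgt_eq (m : M) : ∀ᵐ a ∂(μ.onArrows m), 𝒢.tgt a = m :=
  μ.ae_onArrows_iff.2 (Eventually.of_forall fun a => a.2)

theorem ae_mem_totalSupport [SecondCountableTopology G] (m : M) :
    ∀ᵐ a ∂(μ.onArrows m), a ∈ μ.totalSupport := by
  rw [ae_onArrows_iff]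
  filter_upwards [(μ.measure m).support_mem_ae] with a ha
  exact subset_closure (mem_iUnion.2 ⟨m, mem_image_of_mem _ ha⟩)

end

/-- The points of the total support over a compact set form a compact set. -/
theorem isCompact_totalSupport_inter {C : Set M} (hC : IsCompact C) :
    IsCompact (μ.totalSupport ∩ 𝒢.tgt ⁻¹' C) := by
  have := (μ.isProperMap_support.isCompact_preimage hC).image continuous_subtype_val
  convert this using 1
  ext a
  simp [totalSupport, and_comm]

/-- An open set that contains the points of the total support over `m` contains the points of the
total support over all points near `m`. -/
theorem eventually_totalSupport_subset {m : M} {O : Set G} (hO : IsOpen O)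
    (h : μ.totalSupport ∩ 𝒢.tgt ⁻¹' {m} ⊆ O) :
    ∀ᶠ m' in 𝓝 m, μ.totalSupport ∩ 𝒢.tgt ⁻¹' {m'} ⊆ O := by
  have hcl := μ.isProperMap_support.isClosedMap _
    (hO.isClosed_compl.preimage continuous_subtype_val)
  have : m ∉ (fun a : μ.totalSupport => 𝒢.tgt a.1) '' (Subtype.val ⁻¹' Oᶜ) := by
    rintro ⟨a, ha, rfl⟩
    exact ha (h ⟨a.2, rfl⟩)
  filter_upwards [hcl.isOpen_compl.mem_nhds this] with m' hm' a ha
  by_contra haO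
  exact hm' ⟨⟨a, ha.1⟩, haO, ha.2⟩

end HaarSystem

/-- Smoothness of a function `h u a` that matters only for the pairs `(u, a)` with `t(a) = b(u)`:
it is smooth along the maps from open sets of `P × F` to the fibre product that lie over the
identity of `P`. -/
def SmoothOnFibres (𝒢 : LieGroupoid EM EG M G) (F : Type*) [NormedAddCommGroup F] [NormedSpace ℝ F]
    (U : Set P) (b : P → M) (h : P → G → ℝ) : Prop :=
  ∀ (Ω : Set (P × F)) (β : P × F → G), IsOpen Ω → (∀ w ∈ Ω, w.1 ∈ U) →
    ContMDiffOn 𝓘(ℝ, P × F) 𝓘(ℝ, EG) ∞ β Ω → (∀ w ∈ Ω, 𝒢.tgt (β w) = b w.1) →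
    ContDiffOn ℝ ∞ (fun w => h w.1 (β w)) Ω

/-- A function defined on the fibres over a chart, localized at a parameter and in the fibre
coordinate, is the restriction of a compactly supported smooth function of the coordinates. -/
theorem SmoothOnFibres.exists_localization [FiniteDimensional ℝ F] [FiniteDimensional ℝ P]
    {U : Set P} (hU : IsOpen U) {b : P → M}
    (hb : ContMDiffOn 𝓘(ℝ, P) 𝓘(ℝ, EM) ∞ b U) {h : P → G → ℝ} (hh : SmoothOnFibres 𝒢 F U b h)
    (c : 𝒢.TgtChart F) {y₀ : F} {r : ℝ} (hr : 0 < r)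
    (hball : Metric.closedBall y₀ (2 * r) ⊆ c.slice)
    {u₀ : P} (hu₀ : u₀ ∈ U) (hbu₀ : b u₀ ∈ c.base.source) :
    ∃ H : P × F → ℝ, ContDiff ℝ ∞ H ∧ HasCompactSupport H ∧ ∀ᶠ u in 𝓝 u₀, ∀ a ∈ c.chart.source,
      c.coord a ∈ Metric.closedBall y₀ r → 𝒢.tgt a = b u → H (u, c.coord a) = h u a := by
  have hU' : IsOpen (U ∩ b ⁻¹' c.base.source) := hb.continuousOn.isOpen_inter_preimage hU
    c.base.open_source
  obtain ⟨ε, hε, hεU⟩ := Metric.isOpen_iff.1 hU' u₀ ⟨hu₀, hbu₀⟩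
  let χ : ContDiffBump u₀ := ⟨ε / 4, ε / 2, by positivity, by linarith⟩
  let η : ContDiffBump y₀ := ⟨r, 2 * r, hr, by linarith⟩
  have hχ : tsupport χ ⊆ U ∩ b ⁻¹' c.base.source := by
    rw [χ.tsupport_eq]
    exact (Metric.closedBall_subset_ball (by change ε / 2 < ε; linarith)).trans hεU
  have hη : tsupport η ⊆ c.slice := by
    rw [η.tsupport_eq]
    exact hball
  let β : P × F → G := fun w => c.point (b w.1) w.2
  have hΩ : IsOpen ((U ∩ b ⁻¹' c.base.source) ×ˢ c.slice) := hU'.prod c.isOpen_slice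
  have hβ : ContMDiffOn 𝓘(ℝ, P × F) 𝓘(ℝ, EG) ∞ β ((U ∩ b ⁻¹' c.base.source) ×ˢ c.slice) :=
    c.contMDiffOn_point (hb.comp contDiff_fst.contMDiff.contMDiffOn fun w hw => hw.1.1)
      contDiff_snd.contDiffOn (fun w hw => hw.1.2) fun w hw => hw.2
  have hs := hh _ β hΩ (fun w hw => hw.1.1) hβ fun w hw => c.tgt_point hw.1.2 hw.2
  let H : P × F → ℝ := fun w => χ w.1 * η w.2 * h w.1 (β w)
  have hsupp : tsupport H ⊆ tsupport χ ×ˢ tsupport η := by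
    refine closure_minimal (fun w hw => ?_) ((isClosed_tsupport _).prod (isClosed_tsupport _))
    have hw' : χ w.1 * η w.2 ≠ 0 := left_ne_zero_of_mul hw
    exact ⟨subset_tsupport _ (left_ne_zero_of_mul hw'),
      subset_tsupport _ (right_ne_zero_of_mul hw')⟩
  refine ⟨H, ?_, ?_, ?_⟩
  · rw [← contMDiff_iff_contDiff]
    refine contMDiff_of_tsupport fun w hw => ContDiffAt.contMDiffAt ?_
    have hw' : w ∈ (U ∩ b ⁻¹' c.base.source) ×ˢ c.slice :=
      ⟨hχ (hsupp hw).1, hη (hsupp hw).2⟩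
    refine ContDiffAt.mul ?_ (hs.contDiffAt (hΩ.mem_nhds hw'))
    exact ((χ.contDiff.comp contDiff_fst).mul (η.contDiff.comp contDiff_snd)).contDiffAt
  · exact (χ.hasCompactSupport.isCompact.prod η.hasCompactSupport.isCompact).of_isClosed_subset
      (isClosed_tsupport _) hsupp
  · filter_upwards [Metric.closedBall_mem_nhds u₀ χ.rIn_pos, hU'.mem_nhds ⟨hu₀, hbu₀⟩]
      with u hu hu' a ha hca hta
    change χ u * η (c.coord a) * h u (c.point (b u) (c.coord a)) = h u a
    rw [χ.one_of_mem_closedBall hu, η.one_of_mem_closedBall hca, ← hta, c.point_coord ha]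
    simp

namespace HaarSystem

variable [MeasurableSpace G] [BorelSpace G] [SecondCountableTopology G] [T2Space G] [T2Space M]
  (μ : HaarSystem 𝒢)

omit [SecondCountableTopology G] [T2Space G] in
theorem contMDiff_integral_onArrows {f : G → ℝ} (hf : ContMDiff 𝓘(ℝ, EG) 𝓘(ℝ, ℝ) ∞ f)
    (hc : HasCompactSupport f) :
    ContMDiff 𝓘(ℝ, EM) 𝓘(ℝ, ℝ) ∞ (fun m => ∫ a, f a ∂(μ.onArrows m)) := by
  simp only [integral_onArrows]
  exact μ.contMDiff_integral f hf hc

omit [SecondCountableTopology G] [T2Space G] in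
/-- In a chart, the Haar measures cut off by a bump function are a weakly smooth family. -/
theorem weaklySmooth (c : 𝒢.TgtChart F) {ρ : G → ℝ} (hρ : ContMDiff 𝓘(ℝ, EG) 𝓘(ℝ, ℝ) ∞ ρ)
    (hρc : HasCompactSupport ρ) (hρs : tsupport ρ ⊆ c.chart.source) :
    WeaklySmooth c.base.target
      (fun x (g : F → ℝ) => ∫ a, ρ a * g (c.coord a) ∂(μ.onArrows (c.base.symm x))) := by
  have hsm : ∀ g : F → ℝ, ContDiff ℝ ∞ g →
      ContMDiff 𝓘(ℝ, EG) 𝓘(ℝ, ℝ) ∞ (fun a => ρ a * g (c.coord a)) := fun g hg => by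
    refine contMDiff_of_tsupport fun a ha => ?_
    have ha' : a ∈ c.chart.source := hρs (tsupport_mul_subset_left ha)
    exact (hρ a).mul ((hg.contMDiff.comp_contMDiffOn c.contMDiffOn_coord).contMDiffAt
      (c.chart.open_source.mem_nhds ha'))
  refine WeaklySmooth.of_integral _ _ _ (fun g hg => ?_) (fun x _ g hg => ?_) fun x _ => ?_
  · exact ((μ.contMDiff_integral_onArrows (hsm g (hg.1 ())) hρc.mul_right).comp_contMDiffOn
      c.contMDiffOn_base_symm).contDiffOn
  · exact (hsm g (hg.1 ())).continuous.aestronglyMeasurable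
  · exact hρ.continuous.integrable_of_hasCompactSupport hρc

variable [FiniteDimensional ℝ EM] [FiniteDimensional ℝ F] [FiniteDimensional ℝ P]

omit [SecondCountableTopology G] [T2Space G] in
/-- Smoothness of the integral of a function that depends on parameters and is cut off by a bump
function supported in a chart. -/
theorem integrable_and_contDiffAt_of_chart {U : Set P} (hU : IsOpen U) {b : P → M}
    (hb : ContMDiffOn 𝓘(ℝ, P) 𝓘(ℝ, EM) ∞ b U) {h : P → G → ℝ} (hh : SmoothOnFibres 𝒢 F U b h)
    (c : 𝒢.TgtChart F) {y₀ : F} {r : ℝ} (hr : 0 < r)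
    (hball : Metric.closedBall y₀ (2 * r) ⊆ c.slice)
    {ρ : G → ℝ} (hρ : ContMDiff 𝓘(ℝ, EG) 𝓘(ℝ, ℝ) ∞ ρ) (hρc : HasCompactSupport ρ)
    (hρs : tsupport ρ ⊆ c.chart.source ∩ c.coord ⁻¹' Metric.closedBall y₀ r) {u₀ : P}
    (hu₀ : u₀ ∈ U) :
    Integrable (fun a => ρ a * h u₀ a) (μ.onArrows (b u₀)) ∧
      ContDiffAt ℝ ∞ (fun u => ∫ a, ρ a * h u a ∂(μ.onArrows (b u))) u₀ := by
  have hbc : ContinuousAt b u₀ := hb.continuousOn.continuousAt (hU.mem_nhds hu₀)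
  by_cases hm : b u₀ ∈ 𝒢.tgt '' tsupport ρ
  · have hbu₀ : b u₀ ∈ c.base.source := by
      obtain ⟨a, ha, hab⟩ := hm
      exact hab ▸ c.tgt_mem a (hρs ha).1
    obtain ⟨H, H1, H2, H3⟩ := hh.exists_localization hU hb c hr hball hu₀ hbu₀
    have hΛ := μ.weaklySmooth c hρ hρc (hρs.trans inter_subset_left)
    have hsl := WeaklySmooth.boundedFamily_slice H1 H2
    have key : ∀ᶠ u in 𝓝 u₀, (fun a => ρ a * h u a) =ᵐ[μ.onArrows (b u)]
        fun a => ρ a * H (u, c.coord a) := by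
      filter_upwards [H3] with u hu
      filter_upwards [μ.ae_tgt_eq (b u)] with a ha
      by_cases hρa : ρ a = 0
      · simp [hρa]
      · have := hρs (subset_tsupport _ hρa)
        rw [hu a this.1 this.2 ha]
    constructor
    · refine Integrable.congr ?_ key.self_of_nhds.symm
      have hcont : Continuous (fun a => ρ a * H (u₀, c.coord a)) := by
        refine continuous_of_tsupport fun a ha => ?_
        have ha' : a ∈ c.chart.source := (hρs (tsupport_mul_subset_left ha)).1
        refine hρ.continuous.continuousAt.mul (ContinuousAt.comp (g := fun y => H (u₀, y)) ?_
          (c.contMDiffOn_coord.continuousOn.continuousAt (c.chart.open_source.mem_nhds ha')))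
        exact (H1.continuous.comp (by fun_prop)).continuousAt
      exact hcont.integrable_of_hasCompactSupport hρc.mul_right
    · have hJ := hΛ.contDiffOn_slice c.base.open_target H1 H2
      have hbs : ∀ᶠ u in 𝓝 u₀, b u ∈ c.base.source := hbc (c.base.open_source.mem_nhds hbu₀)
      have hb' : ContDiffAt ℝ ∞ (fun u => (u, c.base (b u))) u₀ := by
        refine contDiffAt_id.prodMk ?_
        have h1 : ContMDiffAt 𝓘(ℝ, P) 𝓘(ℝ, EM) ∞ b u₀ := hb.contMDiffAt (hU.mem_nhds hu₀)
        exact ((c.contMDiffOn_base.contMDiffAt (c.base.open_source.mem_nhds hbu₀)).comp u₀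
          h1).contDiffAt
      have hJ' := ContDiffAt.comp u₀ (hJ.contDiffAt ((isOpen_univ.prod c.base.open_target).mem_nhds
        ⟨mem_univ u₀, c.base.map_source hbu₀⟩)) hb'
      refine hJ'.congr_of_eventuallyEq ?_
      filter_upwards [key, hbs] with u hu hu'
      rw [integral_congr_ae hu]
      simp [c.base.left_inv hu']
  · have hcl : IsClosed (𝒢.tgt '' tsupport ρ) := (hρc.isCompact.image 𝒢.continuous_tgt).isClosed
    have key : ∀ᶠ u in 𝓝 u₀, (fun a => ρ a * h u a) =ᵐ[μ.onArrows (b u)] fun _ => 0 := by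
      filter_upwards [hbc (hcl.isOpen_compl.mem_nhds hm)] with u hu
      filter_upwards [μ.ae_tgt_eq (b u)] with a ha
      have : ρ a = 0 := by
        by_contra hρa
        exact hu ⟨a, subset_tsupport _ hρa, ha⟩
      simp [this]
    refine ⟨(integrable_zero _ _ _).congr key.self_of_nhds.symm, ?_⟩
    refine (contDiffAt_const (c := (0 : ℝ))).congr_of_eventuallyEq ?_
    filter_upwards [key] with u hu
    rw [integral_congr_ae hu, integral_zero]

/-- Integration over the fibres of a properly supported Haar system of a smooth function that
depends on parameters: the integrals exist and are smooth in the parameters. -/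
theorem integrable_and_contDiffOn [FiniteDimensional ℝ EG] [IsManifold 𝓘(ℝ, EG) ∞ G]
    (hF : ∀ a : G, ∃ c : 𝒢.TgtChart F, a ∈ c.chart.source)
    {U : Set P} (hU : IsOpen U) {b : P → M}
    (hb : ContMDiffOn 𝓘(ℝ, P) 𝓘(ℝ, EM) ∞ b U) {h : P → G → ℝ} (hh : SmoothOnFibres 𝒢 F U b h) :
    (∀ u ∈ U, Integrable (h u) (μ.onArrows (b u))) ∧
      ContDiffOn ℝ ∞ (fun u => ∫ a, h u a ∂(μ.onArrows (b u))) U := by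
  suffices H : ∀ u₀ ∈ U, Integrable (h u₀) (μ.onArrows (b u₀)) ∧
      ContDiffAt ℝ ∞ (fun u => ∫ a, h u a ∂(μ.onArrows (b u))) u₀ from
    ⟨fun u hu => (H u hu).1, fun u hu => (H u hu).2.contDiffWithinAt⟩
  intro u₀ hu₀
  classical
  have hbc : ContinuousAt b u₀ := hb.continuousOn.continuousAt (hU.mem_nhds hu₀)
  have : LocallyCompactSpace G := Manifold.locallyCompact_of_finiteDimensional 𝓘(ℝ, EG)
  have : ProperSpace F := FiniteDimensional.proper_real F
  choose c hc using hF
  have hr : ∀ a, ∃ r > 0, Metric.closedBall ((c a).coord a) (2 * r) ⊆ (c a).slice := fun a => by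
    obtain ⟨ε, hε, h⟩ := Metric.isOpen_iff.1 (c a).isOpen_slice _ ((c a).coord_mem (hc a))
    exact ⟨ε / 3, by positivity, (Metric.closedBall_subset_ball (by linarith)).trans h⟩
  choose r hr hball using hr
  have hO : ∀ a : G, ∃ O : Set G, IsOpen O ∧ a ∈ O ∧ IsCompact (closure O) ∧
      O ⊆ (c a).chart.source ∩
        (c a).coord ⁻¹' Metric.closedBall ((c a).coord a) (r a) := fun a => by
    have h1 : (c a).chart.source ∩ (c a).coord ⁻¹' Metric.ball ((c a).coord a) (r a) ∈ 𝓝 a :=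
      ((c a).contMDiffOn_coord.continuousOn.isOpen_inter_preimage (c a).chart.open_source
        Metric.isOpen_ball).mem_nhds ⟨hc a, Metric.mem_ball_self (hr a)⟩
    obtain ⟨C, hC, hCs, hCc⟩ := local_compact_nhds h1
    exact ⟨interior C, isOpen_interior, mem_interior_iff_mem_nhds.2 hC,
      hCc.of_isClosed_subset isClosed_closure (closure_minimal interior_subset hCc.isClosed),
      interior_subset.trans (hCs.trans (inter_subset_inter_right _
        (preimage_mono Metric.ball_subset_closedBall)))⟩
  choose O hO hOa hOc hOs using hO
  obtain ⟨ρ, hρ⟩ := SmoothPartitionOfUnity.exists_isSubordinate 𝓘(ℝ, EG) isClosed_univ O hO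
    fun a _ => mem_iUnion.2 ⟨a, hOa a⟩
  have hpiece := fun a => μ.integrable_and_contDiffAt_of_chart hU hb hh (c a) (hr a) (hball a)
    (ρ a).contMDiff ((hOc a).of_isClosed_subset (isClosed_tsupport _)
      ((hρ a).trans subset_closure)) ((hρ a).trans (hOs a)) hu₀
  have hZ : IsCompact (μ.totalSupport ∩ 𝒢.tgt ⁻¹' {b u₀}) :=
    μ.isCompact_totalSupport_inter isCompact_singleton
  -- only finitely many members of the partition of unity matter near the fibre over `b u₀`
  obtain ⟨I, W, hW, hZW, hI⟩ : ∃ (I : Finset G) (W : Set G), IsOpen W ∧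
      μ.totalSupport ∩ 𝒢.tgt ⁻¹' {b u₀} ⊆ W ∧ ∀ a ∈ W, ∀ i, ρ i a ≠ 0 → i ∈ I := by
    choose N hN hNf using ρ.locallyFinite
    obtain ⟨t, -, ht⟩ := hZ.elim_nhds_subcover (fun a => interior (N a))
      fun a _ => interior_mem_nhds.2 (hN a)
    refine ⟨t.biUnion fun a => (hNf a).toFinset, ⋃ a ∈ t, interior (N a),
      isOpen_biUnion fun _ _ => isOpen_interior, ht, fun a ha i hi => ?_⟩
    obtain ⟨x, hx, hax⟩ := mem_iUnion₂.1 ha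
    exact Finset.mem_biUnion.2 ⟨x, hx, (hNf x).mem_toFinset.2 ⟨a, hi, interior_subset hax⟩⟩
  have key : ∀ᶠ u in 𝓝 u₀, h u =ᵐ[μ.onArrows (b u)] fun a => ∑ i ∈ I, ρ i a * h u a := by
    filter_upwards [hbc (μ.eventually_totalSupport_subset hW hZW)] with u hu
    filter_upwards [μ.ae_tgt_eq (b u), μ.ae_mem_totalSupport (b u)] with a ha haS
    have haW : a ∈ W := hu ⟨haS, ha⟩
    have h1 : ∑ i ∈ I, ρ i a = 1 := by
      rw [← ρ.sum_eq_one (mem_univ a), finsum_eq_sum_of_support_subset]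
      exact fun i hi => hI a haW i hi
    rw [← Finset.sum_mul, h1, _root_.one_mul]
  have hev : ∀ᶠ u in 𝓝 u₀, ∀ i ∈ I, Integrable (fun a => ρ i a * h u a) (μ.onArrows (b u)) := by
    filter_upwards [hU.mem_nhds hu₀] with u hu i _
    exact (μ.integrable_and_contDiffAt_of_chart hU hb hh (c i) (hr i) (hball i)
      (ρ i).contMDiff ((hOc i).of_isClosed_subset (isClosed_tsupport _)
        ((hρ i).trans subset_closure)) ((hρ i).trans (hOs i)) hu).1
  refine ⟨(integrable_finsetSum I fun i _ => (hpiece i).1).congr key.self_of_nhds.symm, ?_⟩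
  refine (ContDiffAt.sum (s := I) fun i _ => (hpiece i).2).congr_of_eventuallyEq ?_
  filter_upwards [key, hev] with u hu hu'
  rw [integral_congr_ae hu, integral_finsetSum I hu']

end HaarSystem

end LieGroupoid

/-! ### Cosimplicial vector spaces -/

section Cosimplicial

/-- Cofaces `d i`, `i ≤ p + 1`, and codegeneracies `s j`, `j ≤ p`, on a sequence of vector spaces,
subject to the cosimplicial identities that involve a codegeneracy. The indices are natural numbers;
the operators outside of the stated ranges are irrelevant. -/
structure CosimplicialData (V : ℕ → Type*) [∀ p, AddCommGroup (V p)] [∀ p, Module ℝ (V p)] where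
  d : ∀ p, ℕ → V p →ₗ[ℝ] V (p + 1)
  s : ∀ p, ℕ → V (p + 1) →ₗ[ℝ] V p
  s_d_self : ∀ p i f, i ≤ p → s p i (d p i f) = f
  s_d_succ : ∀ p i f, i ≤ p → s p i (d p (i + 1) f) = f
  s_d_of_le : ∀ p i j f, j ≤ i → i ≤ p → s (p + 1) (i + 1) (d (p + 1) j f) = d p j (s p i f)
  s_d_of_lt : ∀ p i j f, i < j → j ≤ p + 1 → s (p + 1) i (d (p + 1) (j + 1) f) = d p j (s p i f)
  s_s : ∀ p i j f, i ≤ j → j ≤ p → s p i (s (p + 1) (j + 1) f) = s p j (s (p + 1) i f)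

namespace CosimplicialData

variable {V : ℕ → Type*} [∀ p, AddCommGroup (V p)] [∀ p, Module ℝ (V p)]
  (X : CosimplicialData V)

/-- The alternating sum of the cofaces. -/
def δ (p : ℕ) : V p →ₗ[ℝ] V (p + 1) := ∑ i ∈ Finset.range (p + 2), (-1 : ℝ) ^ i • X.d p i

theorem δ_apply (p : ℕ) (f : V p) :
    X.δ p f = ∑ i ∈ Finset.range (p + 2), (-1 : ℝ) ^ i • X.d p i f := by
  simp [δ, LinearMap.sum_apply]

theorem sum_range_split {W : Type*} [AddCommGroup W] (g : ℕ → W) {i n : ℕ} (h : i ≤ n) :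
    ∑ j ∈ Finset.range (n + 2), g j = ∑ j ∈ Finset.range i, g j + (g i + g (i + 1)) +
      ∑ j ∈ Finset.range (n - i), g (i + 2 + j) := by
  have : n + 2 = i + 2 + (n - i) := by omega
  rw [this, Finset.sum_range_add, Finset.sum_range_succ, Finset.sum_range_succ]
  abel

/-! ### The prism homotopy -/

section Prism

variable (A : ∀ p, ℕ → V p →ₗ[ℝ] V p)

/-- The composition `A 0 ∘ ⋯ ∘ A (k - 1)`. -/
def partialProd (p : ℕ) : ℕ → V p →ₗ[ℝ] V p
  | 0 => LinearMap.id
  | k + 1 => partialProd p k ∘ₗ A p k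

/-- The prism operator `∑ i, (-1) ^ i s_i A_0 ⋯ A_i`. -/
def prism (p : ℕ) : V (p + 1) →ₗ[ℝ] V p :=
  ∑ i ∈ Finset.range (p + 1), (-1 : ℝ) ^ i • (X.s p i ∘ₗ partialProd A (p + 1) (i + 1))

theorem prism_apply (p : ℕ) (f : V (p + 1)) : X.prism A p f =
    ∑ i ∈ Finset.range (p + 1), (-1 : ℝ) ^ i • X.s p i (partialProd A (p + 1) (i + 1) f) := by
  simp [prism, LinearMap.sum_apply]

/-- The relations between cofaces and the averages `A p k` over the `k`-th base point: the `i`-th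
coface of an element does not depend on the `i`-th base point, and the other base points are
renumbered. -/
structure IsAveraging : Prop where
  self : ∀ p i f, i ≤ p + 1 → A (p + 1) i (X.d p i f) = X.d p i f
  of_lt : ∀ p k j f, k < j → j ≤ p + 1 → A (p + 1) k (X.d p j f) = X.d p j (A p k f)
  of_le : ∀ p k j f, j ≤ k → k ≤ p → A (p + 1) (k + 1) (X.d p j f) = X.d p j (A p k f)

variable {X A} (hA : X.IsAveraging A)
include hA

theorem partialProd_d_of_le (p k j : ℕ) (f : V p) (hkj : k ≤ j) (hj : j ≤ p + 1) :
    partialProd A (p + 1) k (X.d p j f) = X.d p j (partialProd A p k f) := by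
  induction k generalizing f with
  | zero => rfl
  | succ k ih =>
    simp only [partialProd, LinearMap.comp_apply]
    rw [hA.of_lt p k j f (by omega) hj, ih _ (by omega)]

theorem partialProd_d_of_lt (p k j : ℕ) (f : V p) (hjk : j ≤ k) (hk : k ≤ p + 1) :
    partialProd A (p + 1) (k + 1) (X.d p j f) = X.d p j (partialProd A p k f) := by
  induction k, hjk using Nat.le_induction generalizing f with
  | base =>
    rw [partialProd, LinearMap.comp_apply, hA.self p j f hk,
      partialProd_d_of_le hA p j j f le_rfl hk]
  | succ k hjk ih =>
    rw [partialProd, LinearMap.comp_apply, hA.of_le p k j f hjk (by omega), ih _ (by omega)]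
    rfl

theorem prism_δ_zero (f : V 0) : X.prism A 0 (X.δ 0 f) = f - partialProd A 0 1 f := by
  rw [prism_apply, δ_apply]
  simp only [zero_add, Finset.sum_range_succ, Finset.range_zero, Finset.sum_empty, map_add,
    pow_zero, one_smul, pow_one, neg_smul, map_neg]
  rw [partialProd_d_of_lt hA 0 0 0 f le_rfl (by omega), X.s_d_self 0 0 _ le_rfl,
    partialProd_d_of_le hA 0 1 1 f le_rfl (by omega), X.s_d_succ 0 0 _ le_rfl]
  simp [partialProd, sub_eq_add_neg]

/-- The prism operator is a homotopy between the identity and the total average. -/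
theorem prism_δ (p : ℕ) (f : V (p + 1)) :
    X.prism A (p + 1) (X.δ (p + 1) f) + X.δ p (X.prism A p f) =
      f - partialProd A (p + 1) (p + 2) f := by
  set x : ℕ → ℕ → V (p + 1) := fun a b =>
    (-1 : ℝ) ^ (a + b) • X.d p a (X.s p b (partialProd A (p + 1) (b + 1) f)) with hx
  set y : ℕ → ℕ → V (p + 1) := fun i j =>
    (-1 : ℝ) ^ (i + j) • X.s (p + 1) i (partialProd A (p + 2) (i + 1) (X.d (p + 1) j f)) with hy
  -- the terms of `prism δ` below and above the diagonal cancel against those of `δ prism`, and the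
  -- diagonal terms telescope
  have e1 : X.prism A (p + 1) (X.δ (p + 1) f) =
      ∑ i ∈ Finset.range (p + 2), ∑ j ∈ Finset.range (p + 3), y i j := by
    rw [prism_apply, δ_apply]
    simp only [map_sum, map_smul, Finset.smul_sum, smul_smul, hy, pow_add]
  have e2 : X.δ p (X.prism A p f) =
      ∑ b ∈ Finset.range (p + 1), ∑ a ∈ Finset.range (p + 2), x a b := by
    rw [prism_apply, δ_apply, Finset.sum_comm]
    simp only [map_sum, map_smul, Finset.smul_sum, smul_smul, hx, pow_add]
  have y1 : ∀ i j, j ≤ i → i ≤ p → y (i + 1) j = - x j i := fun i j hj hi => by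
    simp only [hx, hy]
    rw [partialProd_d_of_lt hA _ (i + 1) j f (by omega) (by omega), X.s_d_of_le p i j _ hj hi,
      ← neg_smul]
    congr 1
    ring
  have y2 : ∀ i j, i < j → j ≤ p + 1 → y i (j + 1) = - x j i := fun i j hj hi => by
    simp only [hx, hy]
    rw [partialProd_d_of_le hA _ (i + 1) (j + 1) f (by omega) (by omega),
      X.s_d_of_lt p i j _ hj hi, ← neg_smul]
    congr 1
    ring
  have y3 : ∀ i, i ≤ p + 1 → y i i + y i (i + 1) =
      partialProd A (p + 1) i f - partialProd A (p + 1) (i + 1) f := fun i hi => by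
    simp only [hy]
    rw [partialProd_d_of_lt hA _ i i f le_rfl (by omega), X.s_d_self _ i _ hi,
      partialProd_d_of_le hA _ (i + 1) (i + 1) f le_rfl (by omega), X.s_d_succ _ i _ hi,
      Even.neg_one_pow ⟨i, rfl⟩, Odd.neg_one_pow ⟨i, by ring⟩]
    simp [sub_eq_add_neg]
  have e3 : ∀ i ∈ Finset.range (p + 2), ∑ j ∈ Finset.range (p + 3), y i j =
      ∑ j ∈ Finset.range i, y i j + ∑ j ∈ Finset.range (p + 1 - i), y i (i + 2 + j) +
      (partialProd A (p + 1) i f - partialProd A (p + 1) (i + 1) f) := fun i hi => by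
    have hi' : i ≤ p + 1 := by simpa [Nat.lt_succ_iff] using hi
    rw [sum_range_split _ hi', y3 i hi']
    abel
  have e4 : ∑ i ∈ Finset.range (p + 2), ∑ j ∈ Finset.range i, y i j =
      - ∑ b ∈ Finset.range (p + 1), ∑ a ∈ Finset.range (b + 1), x a b := by
    rw [Finset.sum_range_succ', Finset.range_zero, Finset.sum_empty, add_zero,
      ← Finset.sum_neg_distrib]
    refine Finset.sum_congr rfl fun b hb => ?_
    rw [← Finset.sum_neg_distrib]
    refine Finset.sum_congr rfl fun a ha => ?_
    rw [Finset.mem_range] at ha hb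
    exact y1 b a (by omega) (by omega)
  have e5 : ∑ i ∈ Finset.range (p + 2), ∑ j ∈ Finset.range (p + 1 - i), y i (i + 2 + j) =
      - ∑ b ∈ Finset.range (p + 1), ∑ a ∈ Finset.range (p + 1 - b), x (b + 1 + a) b := by
    rw [Finset.sum_range_succ, Nat.sub_self, Finset.range_zero, Finset.sum_empty, add_zero,
      ← Finset.sum_neg_distrib]
    refine Finset.sum_congr rfl fun b hb => ?_
    rw [← Finset.sum_neg_distrib]
    refine Finset.sum_congr rfl fun a ha => ?_
    rw [Finset.mem_range] at ha hb
    rw [show b + 2 + a = b + 1 + a + 1 by ring]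
    exact y2 b (b + 1 + a) (by omega) (by omega)
  have e6 : ∑ b ∈ Finset.range (p + 1), ∑ a ∈ Finset.range (p + 2), x a b =
      ∑ b ∈ Finset.range (p + 1), ∑ a ∈ Finset.range (b + 1), x a b +
      ∑ b ∈ Finset.range (p + 1), ∑ a ∈ Finset.range (p + 1 - b), x (b + 1 + a) b := by
    rw [← Finset.sum_add_distrib]
    refine Finset.sum_congr rfl fun b hb => ?_
    rw [Finset.mem_range] at hb
    rw [← Finset.sum_range_add (fun a => x a b), show b + 1 + (p + 1 - b) = p + 2 by omega]
  rw [e1, e2, Finset.sum_congr rfl e3, Finset.sum_add_distrib, Finset.sum_add_distrib, e4, e5, e6,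
    Finset.sum_range_sub']
  simp only [partialProd, LinearMap.id_apply]
  abel

end Prism

/-! ### Normalization of cosimplicial vector spaces -/

/-- The operator `(-1) ^ k s_k`, extended by zero to the degrees in which there is no `s_k`. -/
def signedCodegen (p k : ℕ) : V (p + 1) →ₗ[ℝ] V p := if k ≤ p then (-1 : ℝ) ^ k • X.s p k else 0

/-- The endomorphism `id - (δ t + t δ)` for `t = signedCodegen k`. -/
def kill : ∀ p : ℕ, ℕ → V p →ₗ[ℝ] V p
  | 0, k => LinearMap.id - X.signedCodegen 0 k ∘ₗ X.δ 0
  | p + 1, k =>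
    LinearMap.id - X.signedCodegen (p + 1) k ∘ₗ X.δ (p + 1) - X.δ p ∘ₗ X.signedCodegen p k

/-- The successive composition `kill (k - 1) ∘ ⋯ ∘ kill 0`. Its values are annihilated by the first
`k` codegeneracies. -/
def killProd (p : ℕ) : ℕ → V p →ₗ[ℝ] V p
  | 0 => LinearMap.id
  | k + 1 => X.kill p k ∘ₗ killProd p k

/-- The homotopy between the identity and the projection onto the normalized elements, obtained by
telescoping the homotopies of the factors of the projection. -/
def normalizationHomotopy (p : ℕ) : V (p + 1) →ₗ[ℝ] V p :=
  ∑ l ∈ Finset.range (p + 1), X.signedCodegen p l ∘ₗ X.killProd (p + 1) l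

/-- The elements that are annihilated by the codegeneracies `s_j`, `j < k`. -/
def IsNormalizedUpTo (k : ℕ) : ∀ p, V p → Prop
  | 0, _ => True
  | p + 1, f => ∀ j < k, j ≤ p → X.s p j f = 0

/-- The projection onto the normalized elements. The last factor `kill p` acts trivially in degree
`p`; it is included to match the range of summation in `normalizationHomotopy`. -/
def normalization (p : ℕ) : V p →ₗ[ℝ] V p := X.killProd p (p + 1)

variable {X}

theorem signedCodegen_of_le {p k : ℕ} (h : k ≤ p) (f : V (p + 1)) :
    X.signedCodegen p k f = (-1 : ℝ) ^ k • X.s p k f := by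
  simp [signedCodegen, h]

theorem signedCodegen_of_lt {p k : ℕ} (h : p < k) (f : V (p + 1)) :
    X.signedCodegen p k f = 0 := by
  simp [signedCodegen, Nat.not_le.2 h]

theorem neg_one_pow_smul_self {W : Type*} [AddCommGroup W] [Module ℝ W] (k : ℕ) (w : W) :
    (-1 : ℝ) ^ k • (-1 : ℝ) ^ k • w = w := by
  rw [smul_smul, ← pow_add, Even.neg_one_pow ⟨k, rfl⟩, one_smul]

/-- On elements that are annihilated by the lower codegeneracies, the cofaces up to the `(k+1)`-st
do not contribute to `s_k δ`: the lower ones give lower codegeneracies, and the two that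
are split by `s_k` cancel. -/
theorem codegen_δ (p k : ℕ) (hk : k ≤ p + 1) (f : V (p + 1)) (hf : X.IsNormalizedUpTo k (p + 1) f) :
    X.s (p + 1) k (X.δ (p + 1) f) =
      - ∑ j ∈ Finset.range (p + 1 - k), (-1 : ℝ) ^ (k + 1 + j) • X.d p (k + 1 + j) (X.s p k f) := by
  rw [δ_apply, map_sum, sum_range_split _ hk]
  simp only [map_smul]
  have h1 : ∑ j ∈ Finset.range k, (-1 : ℝ) ^ j • X.s (p + 1) k (X.d (p + 1) j f) = 0 := by
    refine Finset.sum_eq_zero fun j hj => ?_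
    rw [Finset.mem_range] at hj
    obtain ⟨k, rfl⟩ : ∃ k', k = k' + 1 := ⟨k - 1, by omega⟩
    rw [X.s_d_of_le p k j f (by omega) (by omega), hf k (by omega) (by omega)]
    simp
  rw [h1, X.s_d_self _ k f hk, X.s_d_succ _ k f hk, pow_succ, ← Finset.sum_neg_distrib]
  simp only [mul_neg, _root_.mul_one, neg_smul, add_neg_cancel, zero_add]
  refine Finset.sum_congr rfl fun j hj => ?_
  rw [Finset.mem_range] at hj
  rw [show k + 2 + j = k + 1 + j + 1 by ring, X.s_d_of_lt p k (k + 1 + j) f (by omega) (by omega),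
    ← neg_smul]
  congr 1
  ring

theorem kill_of_isNormalizedUpTo (p k : ℕ) (hk : k ≤ p) (f : V (p + 1))
    (hf : X.IsNormalizedUpTo k (p + 1) f) : X.kill (p + 1) k f =
      f - (-1 : ℝ) ^ k • ∑ j ∈ Finset.range (k + 1), (-1 : ℝ) ^ j • X.d p j (X.s p k f) := by
  simp only [kill, LinearMap.sub_apply, LinearMap.id_apply, LinearMap.comp_apply]
  rw [signedCodegen_of_le (by omega), signedCodegen_of_le hk, codegen_δ p k (by omega) f hf,
    map_smul, δ_apply, show p + 2 = k + 1 + (p + 1 - k) by omega, Finset.sum_range_add]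
  simp only [smul_neg, smul_add]
  abel

theorem kill_self (p : ℕ) (f : V p) (hf : X.IsNormalizedUpTo p p f) : X.kill p p f = f := by
  cases p with
  | zero =>
    simp only [kill, LinearMap.sub_apply, LinearMap.id_apply, LinearMap.comp_apply]
    rw [signedCodegen_of_le le_rfl, δ_apply, Finset.sum_range_succ, Finset.sum_range_one, map_add,
      map_smul, map_smul, X.s_d_self 0 0 f le_rfl, X.s_d_succ 0 0 f le_rfl]
    simp
  | succ p =>
    simp only [kill, LinearMap.sub_apply, LinearMap.id_apply, LinearMap.comp_apply]
    rw [signedCodegen_of_le le_rfl, signedCodegen_of_lt (Nat.lt_succ_self p),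
      codegen_δ p (p + 1) le_rfl f hf]
    simp

theorem isNormalizedUpTo_kill (p k : ℕ) (hk : k ≤ p) (f : V (p + 1))
    (hf : X.IsNormalizedUpTo k (p + 1) f) :
    X.IsNormalizedUpTo (k + 1) (p + 1) (X.kill (p + 1) k f) := by
  intro j hj hjp
  rw [kill_of_isNormalizedUpTo p k hk f hf]
  simp only [map_sub, map_smul, map_sum]
  -- the codegeneracies of `s_k f` below `k` vanish
  rcases Nat.lt_or_ge j k with hjk | hjk
  · rw [hf j hjk hjp, zero_sub, neg_eq_zero]
    obtain ⟨q, rfl⟩ : ∃ q, p = q + 1 := ⟨p - 1, by omega⟩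
    obtain ⟨k, rfl⟩ : ∃ k', k = k' + 1 := ⟨k - 1, by omega⟩
    have hs : ∀ i, i ≤ k → X.s q i (X.s (q + 1) (k + 1) f) = 0 := fun i hi => by
      rw [X.s_s q i k f hi (by omega), hf i (by omega) (by omega), map_zero]
    rw [sum_range_split _ (show j ≤ k by omega)]
    rw [X.s_d_self _ j _ hjp, X.s_d_succ _ j _ hjp, Finset.sum_eq_zero, Finset.sum_eq_zero,
      pow_succ (-1 : ℝ) j, mul_neg, _root_.mul_one, neg_smul, add_neg_cancel]
    · simp
    · intro i hi
      rw [Finset.mem_range] at hi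
      rw [show j + 2 + i = j + 1 + i + 1 by ring,
        X.s_d_of_lt q j (j + 1 + i) _ (by omega) (by omega), hs j (by omega)]
      simp
    · intro i hi
      rw [Finset.mem_range] at hi
      obtain ⟨j, rfl⟩ : ∃ j', j = j' + 1 := ⟨j - 1, by omega⟩
      rw [X.s_d_of_le q j i _ (by omega) (by omega), hs j (by omega)]
      simp
  · obtain rfl : j = k := by omega
    rw [Finset.sum_range_succ, X.s_d_self _ j _ hk, Finset.sum_eq_zero, zero_add,
      neg_one_pow_smul_self, sub_self]
    intro i hi
    rw [Finset.mem_range] at hi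
    obtain ⟨q, rfl⟩ : ∃ q, p = q + 1 := ⟨p - 1, by omega⟩
    obtain ⟨j, rfl⟩ : ∃ j', j = j' + 1 := ⟨j - 1, by omega⟩
    rw [X.s_d_of_le q j i _ (by omega) (by omega), X.s_s q j j f le_rfl (by omega),
      hf j (by omega) (by omega)]
    simp

theorem isNormalizedUpTo_killProd (p k : ℕ) (hk : k ≤ p) (f : V p) :
    X.IsNormalizedUpTo k p (X.killProd p k f) := by
  cases p with
  | zero => trivial
  | succ p =>
    induction k with
    | zero => exact fun j hj => absurd hj (Nat.not_lt_zero j)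
    | succ k ih => exact isNormalizedUpTo_kill p k (by omega) _ (ih (by omega))

/-- Normalized elements are fixed, so that `normalization` is a projection. -/
theorem killProd_eq_self (p k : ℕ) (hk : k ≤ p + 1) (f : V p) (hf : X.IsNormalizedUpTo p p f) :
    X.killProd p k f = f := by
  induction k with
  | zero => rfl
  | succ k ih =>
    rw [killProd, LinearMap.comp_apply, ih (by omega)]
    rcases Nat.lt_or_ge k p with h | h
    · obtain ⟨q, rfl⟩ : ∃ q, p = q + 1 := ⟨p - 1, by omega⟩
      rw [kill_of_isNormalizedUpTo q k (by omega) f fun j hj => hf j (by omega), hf k h (by omega)]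
      simp
    · obtain rfl : k = p := by omega
      exact kill_self k f hf

theorem isNormalizedUpTo_normalization (p : ℕ) (f : V p) :
    X.IsNormalizedUpTo p p (X.normalization p f) := by
  have := isNormalizedUpTo_killProd (X := X) p p le_rfl f
  rw [normalization, killProd, LinearMap.comp_apply, kill_self p _ this]
  exact this

theorem normalization_eq_self (p : ℕ) (f : V p) (hf : X.IsNormalizedUpTo p p f) :
    X.normalization p f = f :=
  killProd_eq_self p _ le_rfl f hf

variable (hδ : ∀ p f, X.δ (p + 1) (X.δ p f) = 0)
include hδ

theorem killProd_δ (p k : ℕ) (f : V p) :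
    X.killProd (p + 1) k (X.δ p f) = X.δ p (X.killProd p k f) := by
  induction k with
  | zero => rfl
  | succ k ih =>
    simp only [killProd, LinearMap.comp_apply]
    rw [ih]
    cases p with
    | zero => simp [kill, hδ]
    | succ p => simp [kill, hδ]

omit hδ in
theorem normalizationHomotopy_zero (f : V 0) :
    X.normalizationHomotopy 0 (X.δ 0 f) = f - X.normalization 0 f := by
  simp [normalizationHomotopy, normalization, killProd, kill]

theorem sum_signedCodegen_killProd (p n : ℕ) (f : V (p + 1)) :
    (∑ l ∈ Finset.range n, X.signedCodegen (p + 1) l (X.killProd (p + 2) l (X.δ (p + 1) f))) +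
      X.δ p (∑ l ∈ Finset.range n, X.signedCodegen p l (X.killProd (p + 1) l f)) =
      f - X.killProd (p + 1) n f := by
  induction n with
  | zero => simp [killProd]
  | succ n ih =>
    rw [Finset.sum_range_succ, Finset.sum_range_succ, map_add, killProd_δ hδ]
    have e : X.killProd (p + 1) (n + 1) f = X.killProd (p + 1) n f -
        X.signedCodegen (p + 1) n (X.δ (p + 1) (X.killProd (p + 1) n f)) -
        X.δ p (X.signedCodegen p n (X.killProd (p + 1) n f)) := rfl
    rw [e, sub_sub, ← sub_add, ← ih]
    abel

theorem normalizationHomotopy_δ (p : ℕ) (f : V (p + 1)) :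
    X.normalizationHomotopy (p + 1) (X.δ (p + 1) f) + X.δ p (X.normalizationHomotopy p f) =
      f - X.normalization (p + 1) f := by
  rw [normalization, ← sum_signedCodegen_killProd hδ p (p + 2) f]
  simp only [normalizationHomotopy, LinearMap.sum_apply, LinearMap.comp_apply]
  rw [Finset.sum_range_succ (fun l => X.signedCodegen p l _) (p + 1),
    signedCodegen_of_lt (Nat.lt_succ_self p), add_zero]

end CosimplicialData

end Cosimplicial

/-! ### Degeneracies and actions on the nerve -/

namespace LieGroupoid

variable {EM EG M G : Type*}
  [NormedAddCommGroup EM] [NormedSpace ℝ EM] [TopologicalSpace M] [ChartedSpace EM M]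
  [NormedAddCommGroup EG] [NormedSpace ℝ EG] [TopologicalSpace G] [ChartedSpace EG G]
  {𝒢 : LieGroupoid EM EG M G}

theorem mul_inv_cancel_right (𝒢 : LieGroupoid EM EG M G) (g h : G) (h1 : 𝒢.src g = 𝒢.tgt h) :
    𝒢.mul (𝒢.mul g h) (𝒢.inv h) = g := by
  rw [𝒢.mul_assoc _ _ _ h1 (𝒢.tgt_inv h).symm, 𝒢.mul_inv, ← h1, 𝒢.mul_one]

theorem inv_mul_cancel_left (𝒢 : LieGroupoid EM EG M G) (g h : G) (h1 : 𝒢.src g = 𝒢.tgt h) :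
    𝒢.mul (𝒢.inv g) (𝒢.mul g h) = h := by
  rw [← 𝒢.mul_assoc _ _ _ (𝒢.src_inv g) h1, 𝒢.inv_mul, h1, 𝒢.one_mul]

theorem inv_eq_of_mul_eq_one (𝒢 : LieGroupoid EM EG M G) (g h : G) (h1 : 𝒢.src g = 𝒢.tgt h)
    (h2 : 𝒢.mul g h = 𝒢.one (𝒢.tgt g)) : 𝒢.inv g = h := by
  have h3 := 𝒢.inv_mul_cancel_left g h h1
  rwa [h2, ← 𝒢.src_inv g, 𝒢.mul_one] at h3

theorem inv_mul_rev (𝒢 : LieGroupoid EM EG M G) (g h : G) (h1 : 𝒢.src g = 𝒢.tgt h) :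
    𝒢.inv (𝒢.mul g h) = 𝒢.mul (𝒢.inv h) (𝒢.inv g) := by
  have c1 : 𝒢.src (𝒢.inv h) = 𝒢.tgt (𝒢.inv g) := by rw [𝒢.src_inv, 𝒢.tgt_inv, h1]
  refine 𝒢.inv_eq_of_mul_eq_one _ _ ?_ ?_
  · rw [𝒢.src_mul _ _ h1, 𝒢.tgt_mul _ _ c1, 𝒢.tgt_inv]
  · rw [← 𝒢.mul_assoc _ _ _ (by rw [𝒢.src_mul _ _ h1, 𝒢.tgt_inv]) c1,
      𝒢.mul_inv_cancel_right _ _ h1, 𝒢.mul_inv, 𝒢.tgt_mul _ _ h1]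

theorem inv_inv (𝒢 : LieGroupoid EM EG M G) (g : G) : 𝒢.inv (𝒢.inv g) = g :=
  𝒢.inv_eq_of_mul_eq_one _ _ (𝒢.src_inv g) (by rw [𝒢.inv_mul, 𝒢.tgt_inv])

namespace Nerve

/-- The degeneracy map `B_p G → B_{p+1} G`, which repeats the `j`-th base point: it inserts an
identity arrow at that point. -/
def degen {p : ℕ} (j : Fin (p + 1)) (x : 𝒢.Nerve p) : 𝒢.Nerve (p + 1) where
  base k := x.base ⟨if (k : ℕ) ≤ j then k else k - 1, by split_ifs <;> omega⟩
  arr k :=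
    if h1 : (k : ℕ) < j then x.arr ⟨k, by omega⟩
    else if h2 : (k : ℕ) = j then 𝒢.one (x.base j)
    else x.arr ⟨k - 1, by omega⟩
  tgt_arr k := by
    simp only [Fin.val_castSucc]
    split_ifs with h1 h2 h3 h4
    · exact x.tgt_eq _ _ rfl
    · omega
    · rw [𝒢.tgt_one]; exact x.base_congr h3.symm
    · omega
    · omega
    · exact x.tgt_eq _ _ rfl
  src_arr k := by
    simp only [Fin.val_succ]
    split_ifs with h1 h2 h3 h4
    · exact x.src_eq _ _ rfl
    · omega
    · omega
    · rw [𝒢.src_one]; exact x.base_congr (by simp; omega)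
    · omega
    · exact x.src_eq _ _ (by simp; omega)

theorem degen_base {p : ℕ} (j : Fin (p + 1)) (x : 𝒢.Nerve p) (k : Fin (p + 2)) (l : Fin (p + 1))
    (h : (l : ℕ) = if (k : ℕ) ≤ j then (k : ℕ) else k - 1) : (degen j x).base k = x.base l :=
  x.base_congr h.symm

theorem degen_arr_of_lt {p : ℕ} (j : Fin (p + 1)) (x : 𝒢.Nerve p) (k : Fin (p + 1)) (l : Fin p)
    (h : (k : ℕ) < j) (hl : (k : ℕ) = l) : (degen j x).arr k = x.arr l := by
  simp only [degen, h, dite_true]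
  exact x.arr_congr hl

theorem degen_arr_of_eq {p : ℕ} (j : Fin (p + 1)) (x : 𝒢.Nerve p) (k : Fin (p + 1))
    (h : (k : ℕ) = j) : (degen j x).arr k = 𝒢.one (x.base j) := by
  simp only [degen, h, lt_irrefl, dite_false, dite_true]

theorem degen_arr_of_gt {p : ℕ} (j : Fin (p + 1)) (x : 𝒢.Nerve p) (k : Fin (p + 1)) (l : Fin p)
    (h : (j : ℕ) < k) (hl : (k : ℕ) = l + 1) : (degen j x).arr k = x.arr l := by
  simp only [degen, not_lt.2 h.le, h.ne', dite_false]
  exact x.arr_congr (by simp; omega)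

theorem one_mul_arr {p : ℕ} (x : 𝒢.Nerve p) (k : Fin p) (i : Fin (p + 1)) (h : (k : ℕ) = i) :
    𝒢.mul (𝒢.one (x.base i)) (x.arr k) = x.arr k := by
  rw [← x.tgt_eq k i h, 𝒢.one_mul]

theorem arr_mul_one {p : ℕ} (x : 𝒢.Nerve p) (k : Fin p) (i : Fin (p + 1)) (h : (k : ℕ) + 1 = i) :
    𝒢.mul (x.arr k) (𝒢.one (x.base i)) = x.arr k := by
  rw [← x.src_eq k i h, 𝒢.mul_one]

theorem face_castSucc_degen {p : ℕ} (j : Fin (p + 1)) (x : 𝒢.Nerve p) :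
    face j.castSucc (degen j x) = x := by
  ext k
  · exact degen_base _ _ _ _ (by rw [val_succAbove, Fin.val_castSucc]; grind)
  · simp only [face, Fin.val_castSucc]
    split_ifs with h1 h2
    · exact degen_arr_of_lt _ _ _ _ (by simp; omega) (by simp)
    · rw [degen_arr_of_lt _ _ k.castSucc k (by simp; omega) (by simp),
        degen_arr_of_eq _ _ _ (by simpa using h2), arr_mul_one x _ _ h2]
    · exact degen_arr_of_gt _ _ _ _ (by simp; omega) (by simp)

theorem face_succ_degen {p : ℕ} (j : Fin (p + 1)) (x : 𝒢.Nerve p) :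
    face j.succ (degen j x) = x := by
  ext k
  · exact degen_base _ _ _ _ (by rw [val_succAbove, Fin.val_succ]; grind)
  · simp only [face, Fin.val_succ]
    split_ifs with h1 h2
    · exact degen_arr_of_lt _ _ _ _ (by simp; omega) (by simp)
    · rw [degen_arr_of_gt _ _ k.succ k (by simp; omega) (by simp),
        degen_arr_of_eq _ _ _ (by simp; omega), one_mul_arr x _ _ (by omega)]
    · exact degen_arr_of_gt _ _ _ _ (by simp; omega) (by simp)

theorem face_degen_of_le {p : ℕ} (i : Fin (p + 1)) (j : Fin (p + 2)) (h : (j : ℕ) ≤ i)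
    (x : 𝒢.Nerve (p + 1)) : face j.castSucc (degen i.succ x) = degen i (face j x) := by
  ext k
  · simp only [face, degen]
    apply base_congr
    simp only [val_succAbove, Fin.val_castSucc, Fin.val_succ]
    grind
  · simp only [face, degen, val_succAbove, Fin.val_castSucc, Fin.val_succ]
    split_ifs <;> first | rfl | omega | (apply arr_congr; simp; omega) | skip
    rw [x.base_congr]
    simp only [val_succAbove, Fin.val_succ]
    grind

theorem face_degen_of_lt {p : ℕ} (i : Fin (p + 1)) (j : Fin (p + 2)) (h : (i : ℕ) < j)
    (x : 𝒢.Nerve (p + 1)) : face j.succ (degen i.castSucc x) = degen i (face j x) := by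
  ext k
  · simp only [face, degen]
    apply base_congr
    simp only [val_succAbove, Fin.val_castSucc, Fin.val_succ]
    grind
  · simp only [face, degen, val_succAbove, Fin.val_castSucc, Fin.val_succ]
    split_ifs <;> first | rfl | omega | (apply arr_congr; simp; omega) | skip
    · rw [x.base_congr]
      simp only [val_succAbove, Fin.val_castSucc]
      grind
    · rw [x.arr_congr (j := ⟨k + 1 - 1, by omega⟩)]
      · rfl
      · simp; omega

theorem degen_degen {p : ℕ} (i j : Fin (p + 1)) (h : (i : ℕ) ≤ j) (x : 𝒢.Nerve p) :
    degen j.succ (degen i x) = degen i.castSucc (degen j x) := by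
  ext k
  · simp only [degen]
    apply base_congr
    simp only [Fin.val_castSucc, Fin.val_succ]
    grind
  · simp only [degen, Fin.val_castSucc, Fin.val_succ]
    split_ifs <;> first | rfl | omega | skip
    rw [dif_neg (by omega), dif_neg (by omega), dif_neg (by omega), dif_pos (by omega)]
    rfl

theorem degen_act_of_lt {p : ℕ} (i j : Fin (p + 1)) (h : (i : ℕ) < j) (x : 𝒢.Nerve p) (a : G)
    (ha : 𝒢.tgt a = x.base i) (ha' : 𝒢.tgt a = (degen j x).base i.castSucc) :
    degen j (act i x a ha) = act i.castSucc (degen j x) a ha' := by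
  ext k
  · simp only [degen, act, Fin.ext_iff, Fin.val_castSucc]
    split_ifs <;> first | rfl | omega | exact (if_neg (by omega)).symm
  · simp only [degen, act, Fin.ext_iff, Fin.val_castSucc]
    split_ifs <;> first | rfl | omega

theorem degen_act_of_gt {p : ℕ} (i j : Fin (p + 1)) (h : (j : ℕ) < i) (x : 𝒢.Nerve p) (a : G)
    (ha : 𝒢.tgt a = x.base i) (ha' : 𝒢.tgt a = (degen j x).base i.succ) :
    degen j (act i x a ha) = act i.succ (degen j x) a ha' := by
  ext k
  · simp only [degen, act, Fin.ext_iff, Fin.val_succ]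
    split_ifs <;> first | rfl | omega | exact (if_neg (by omega)).symm
  · simp only [degen, act, Fin.ext_iff, Fin.val_succ]
    split_ifs <;> first | rfl | omega

/-- Moving a repeated base point amounts to moving both of its copies. -/
theorem degen_act_self {p : ℕ} (j : Fin (p + 1)) (x : 𝒢.Nerve p) (a : G)
    (ha : 𝒢.tgt a = x.base j) (ha' : 𝒢.tgt a = (degen j x).base j.succ)
    (ha'' : 𝒢.tgt a = (act j.succ (degen j x) a ha').base j.castSucc) :
    degen j (act j x a ha) = act j.castSucc (act j.succ (degen j x) a ha') a ha'' := by
  ext k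
  · simp only [degen, act, Fin.ext_iff, Fin.val_succ, Fin.val_castSucc]
    split_ifs <;> first | rfl | omega |
      exact ((if_neg (by omega)).trans (if_neg (by omega))).symm | exact (if_neg (by omega)).symm
  · simp only [degen, act, Fin.ext_iff, Fin.val_succ, Fin.val_castSucc]
    split_ifs <;> first | rfl | omega | skip
    rw [← ha, 𝒢.one_mul, 𝒢.inv_mul]

/-- Moving the source of the `j`-th arrow to its target makes this arrow an identity. -/
theorem act_arr_eq_degen {p : ℕ} (j : Fin (p + 1)) (x : 𝒢.Nerve (p + 1))
    (ha : 𝒢.tgt (x.arr j) = x.base j.castSucc) :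
    act j.castSucc x (x.arr j) ha = degen j (face j.castSucc x) := by
  ext k
  · simp only [degen, act, face, Fin.ext_iff, Fin.val_castSucc]
    split_ifs <;> first | omega | skip
    · rw [x.src_arr]
      apply x.base_congr
      simp only [val_succAbove, Fin.val_castSucc, Fin.val_succ]
      grind
    all_goals
      apply x.base_congr
      simp only [val_succAbove, Fin.val_castSucc]
      grind
  · simp only [degen, act, face, Fin.ext_iff, Fin.val_castSucc]
    split_ifs <;> first | rfl | omega | (apply arr_congr; simp; omega) | skip
    · rw [x.arr_congr (j := j) (k := Fin.succ ⟨k, by omega⟩) (by simp; omega)]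
      rfl
    · rw [x.arr_congr (j := k) (k := j) (by omega), 𝒢.inv_mul, x.src_arr]
      congr 1
      apply x.base_congr
      simp only [val_succAbove, Fin.val_castSucc, Fin.val_succ]
      grind

theorem act_act {p : ℕ} (i : Fin (p + 1)) (x : 𝒢.Nerve p) (a b : G)
    (ha : 𝒢.tgt a = x.base i) (hb : 𝒢.tgt b = (act i x a ha).base i)
    (hab : 𝒢.tgt (𝒢.mul a b) = x.base i) :
    act i (act i x a ha) b hb = act i x (𝒢.mul a b) hab := by
  have h0 : 𝒢.src a = 𝒢.tgt b := by rw [hb]; simp [act]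
  ext k
  · simp only [act, 𝒢.src_mul _ _ h0]
    split_ifs <;> rfl
  · simp only [act]
    split_ifs with h1 h2
    · exact 𝒢.mul_assoc _ _ _ (by rw [ha]; exact x.src_eq _ _ h1) h0
    · rw [𝒢.inv_mul_rev _ _ h0]
      exact (𝒢.mul_assoc _ _ _ (by rw [𝒢.src_inv, 𝒢.tgt_inv, h0])
        (by rw [𝒢.src_inv, ha]; exact (x.tgt_eq _ _ h2).symm)).symm
    · rfl

theorem act_comm {p : ℕ} (i j : Fin (p + 1)) (hij : i ≠ j) (x : 𝒢.Nerve p) (a b : G)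
    (ha : 𝒢.tgt a = x.base i) (hb : 𝒢.tgt b = x.base j) (ha' : 𝒢.tgt a = (act j x b hb).base i)
    (hb' : 𝒢.tgt b = (act i x a ha).base j) :
    act j (act i x a ha) b hb' = act i (act j x b hb) a ha' := by
  have hij' : (i : ℕ) ≠ j := fun h => hij (Fin.ext h)
  ext k
  · simp only [act, Fin.ext_iff]
    split_ifs <;> first | rfl | omega
  · simp only [act]
    split_ifs with h1 h2 h3 h4 h5 <;> first | rfl | omega | skip
    · exact 𝒢.mul_assoc _ _ _ (by rw [𝒢.src_inv, ha, x.tgt_eq k i h3])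
        (by rw [hb, x.src_eq k j h1])
    · exact (𝒢.mul_assoc _ _ _ (by rw [𝒢.src_inv, hb, x.tgt_eq k j h4])
        (by rw [ha, x.src_eq k i h5])).symm

end Nerve

end LieGroupoid

/-! ### Averaging operators -/

namespace LieGroupoid

open MeasureTheory

section Smooth

variable {EM EG M G : Type*}
  [NormedAddCommGroup EM] [NormedSpace ℝ EM] [TopologicalSpace M] [ChartedSpace EM M]
  [NormedAddCommGroup EG] [NormedSpace ℝ EG] [TopologicalSpace G] [ChartedSpace EG G]
  {𝒢 : LieGroupoid EM EG M G}

/-- A smooth function on the nerve is smooth along smooth maps from open subsets of arbitrary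
finite-dimensional spaces. -/
theorem IsSmooth.contDiffOn {p : ℕ} {f : 𝒢.Nerve p → ℝ} (hf : 𝒢.IsSmooth f)
    {W : Type*} [NormedAddCommGroup W] [NormedSpace ℝ W] [FiniteDimensional ℝ W] {U : Set W}
    {φ : W → 𝒢.Nerve p} (hU : IsOpen U)
    (h1 : ∀ i, ContMDiffOn 𝓘(ℝ, W) 𝓘(ℝ, EM) ∞ (fun u => (φ u).base i) U)
    (h2 : ∀ j, ContMDiffOn 𝓘(ℝ, W) 𝓘(ℝ, EG) ∞ (fun u => (φ u).arr j) U) :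
    ContDiffOn ℝ ∞ (fun u => f (φ u)) U := by
  let e : W ≃L[ℝ] EuclideanSpace ℝ (Fin (Module.finrank ℝ W)) := toEuclidean
  have he : ContMDiffOn 𝓘(ℝ, EuclideanSpace ℝ (Fin (Module.finrank ℝ W))) 𝓘(ℝ, W) ∞ e.symm
      (e.symm ⁻¹' U) := e.symm.contDiff.contMDiff.contMDiffOn
  have := hf _ (e.symm ⁻¹' U) (fun v => φ (e.symm v)) (hU.preimage e.symm.continuous)
    (fun i => (h1 i).comp he subset_rfl) (fun j => (h2 j).comp he subset_rfl)
  simpa [Function.comp_def] using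
    this.comp e.contDiff.contDiffOn (s := U) fun u hu => by simpa using hu

namespace HaarSystem

variable [MeasurableSpace G] [BorelSpace G] [T1Space M] (μ : HaarSystem 𝒢)

omit [BorelSpace G] [T1Space M] in
/-- Left translations are measurable for a normalized Haar system: the pushforward along a map that
is not measurable is zero by convention, whereas the pushforward here has mass one. -/
theorem aemeasurable_leftTranslation (g : G) :
    AEMeasurable (𝒢.leftTranslation g) (μ.measure (𝒢.src g)) := by
  by_contra h
  have h1 := μ.map_leftTranslation g
  rw [Measure.map_of_not_aemeasurable h] at h1
  have h2 := μ.measure_univ (𝒢.tgt g)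
  simp [← h1] at h2

/-- Left invariance of a Haar system, in terms of integrals. -/
theorem integral_mul_left (g : G) {h : G → ℝ} (hh : Integrable h (μ.onArrows (𝒢.tgt g))) :
    ∫ a, h (𝒢.mul g a) ∂(μ.onArrows (𝒢.src g)) = ∫ a, h a ∂(μ.onArrows (𝒢.tgt g)) := by
  rw [integrable_onArrows_iff, ← μ.map_leftTranslation g] at hh
  rw [integral_onArrows, integral_onArrows, ← μ.map_leftTranslation g,
    integral_map (μ.aemeasurable_leftTranslation g) hh.aestronglyMeasurable]
  rfl

end HaarSystem

end Smooth

variable {EM EG EK M G K : Type*}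
  [NormedAddCommGroup EM] [NormedSpace ℝ EM] [TopologicalSpace M] [ChartedSpace EM M]
  [NormedAddCommGroup EG] [NormedSpace ℝ EG] [TopologicalSpace G] [ChartedSpace EG G]
  [NormedAddCommGroup EK] [NormedSpace ℝ EK] [TopologicalSpace K] [ChartedSpace EK K]
  {𝒢 : LieGroupoid EM EG M G} {𝒦 : 𝒢.WideSubgroupoid EK K}

theorem WideSubgroupoid.contMDiff_incl [IsManifold 𝓘(ℝ, EG) ∞ G] [IsManifold 𝓘(ℝ, EK) ∞ K]
    (𝒦 : 𝒢.WideSubgroupoid EK K) : ContMDiff 𝓘(ℝ, EK) 𝓘(ℝ, EG) ∞ 𝒦.incl :=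
  𝒦.isImmersion_incl.contMDiff

/-- The point `x · k` for the `i`-th action of an arrow `k` of `K`; by convention it is `x` if the
target of `k` is not the `i`-th base point. -/
noncomputable def actK (𝒦 : 𝒢.WideSubgroupoid EK K) {p : ℕ} (i : Fin (p + 1)) (x : 𝒢.Nerve p)
    (k : K) : 𝒢.Nerve p :=
  open Classical in if h : 𝒢.tgt (𝒦.incl k) = x.base i then x.act i (𝒦.incl k) h else x

theorem actK_eq {p : ℕ} {i : Fin (p + 1)} {x : 𝒢.Nerve p} {k : K}
    (h : 𝒢.tgt (𝒦.incl k) = x.base i) : actK 𝒦 i x k = x.act i (𝒦.incl k) h :=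
  dif_pos h

theorem actK_eq_act {p : ℕ} {i : Fin (p + 1)} {x : 𝒢.Nerve p} {k : K}
    (h : 𝒦.tgt k = x.base i) : actK 𝒦 i x k = x.act i (𝒦.incl k) ((𝒦.tgt_incl k).trans h) :=
  dif_pos _

theorem actK_base_of_ne {p : ℕ} {i j : Fin (p + 1)} (hij : j ≠ i) (x : 𝒢.Nerve p) (k : K) :
    (actK 𝒦 i x k).base j = x.base j := by
  unfold actK
  split_ifs
  · simp [Nerve.act, hij]
  · rfl

theorem actK_base_self {p : ℕ} {i : Fin (p + 1)} {x : 𝒢.Nerve p} {k : K}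
    (h : 𝒦.tgt k = x.base i) : (actK 𝒦 i x k).base i = 𝒦.src k := by
  rw [actK_eq_act h]
  simp [Nerve.act, 𝒦.src_incl]

theorem actK_comm {p : ℕ} {i j : Fin (p + 1)} (hij : i ≠ j) {x : 𝒢.Nerve p} {a b : K}
    (ha : 𝒦.tgt a = x.base i) (hb : 𝒦.tgt b = x.base j) :
    actK 𝒦 j (actK 𝒦 i x a) b = actK 𝒦 i (actK 𝒦 j x b) a := by
  have ha' : 𝒦.tgt a = (actK 𝒦 j x b).base i := ha.trans (actK_base_of_ne hij x b).symm
  have hb' : 𝒦.tgt b = (actK 𝒦 i x a).base j := hb.trans (actK_base_of_ne hij.symm x a).symm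
  rw [actK_eq_act hb', actK_eq_act ha']
  simp only [actK_eq_act ha, actK_eq_act hb]
  exact Nerve.act_comm _ _ hij _ _ _ _ _ _ _

theorem actK_actK {p : ℕ} {i : Fin (p + 1)} {x : 𝒢.Nerve p} {a b : K}
    (ha : 𝒦.tgt a = x.base i) (hb : 𝒦.src a = 𝒦.tgt b) :
    actK 𝒦 i (actK 𝒦 i x a) b = actK 𝒦 i x (𝒦.mul a b) := by
  rw [actK_eq_act (hb.symm.trans (actK_base_self ha).symm),
    actK_eq_act ((𝒦.tgt_mul _ _ hb).trans ha)]
  simp only [actK_eq_act ha, 𝒦.incl_mul _ _ hb]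
  exact Nerve.act_act _ _ _ _ _ _ _

theorem contMDiffOn_actK_base {W : Type*} [NormedAddCommGroup W] [NormedSpace ℝ W] {U : Set W}
    {p : ℕ} {i : Fin (p + 1)} {φ : W → 𝒢.Nerve p} {κ : W → K}
    (h : ∀ u ∈ U, 𝒦.tgt (κ u) = (φ u).base i)
    (h1 : ∀ i, ContMDiffOn 𝓘(ℝ, W) 𝓘(ℝ, EM) ∞ (fun u => (φ u).base i) U)
    (hκ : ContMDiffOn 𝓘(ℝ, W) 𝓘(ℝ, EK) ∞ κ U) (j : Fin (p + 1)) :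
    ContMDiffOn 𝓘(ℝ, W) 𝓘(ℝ, EM) ∞ (fun u => (actK 𝒦 i (φ u) (κ u)).base j) U := by
  by_cases hij : j = i
  · subst hij
    exact (𝒦.isSubmersion_src.contMDiff.comp_contMDiffOn hκ).congr
      fun u hu => actK_base_self (h u hu)
  · exact (h1 j).congr fun u _ => actK_base_of_ne hij _ _

theorem contMDiffOn_actK_arr [IsManifold 𝓘(ℝ, EG) ∞ G] [IsManifold 𝓘(ℝ, EK) ∞ K]
    {W : Type*} [NormedAddCommGroup W] [NormedSpace ℝ W] {U : Set W}
    {p : ℕ} {i : Fin (p + 1)} {φ : W → 𝒢.Nerve p} {κ : W → K}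
    (h : ∀ u ∈ U, 𝒦.tgt (κ u) = (φ u).base i)
    (h2 : ∀ j, ContMDiffOn 𝓘(ℝ, W) 𝓘(ℝ, EG) ∞ (fun u => (φ u).arr j) U)
    (hκ : ContMDiffOn 𝓘(ℝ, W) 𝓘(ℝ, EK) ∞ κ U) (j : Fin p) :
    ContMDiffOn 𝓘(ℝ, W) 𝓘(ℝ, EG) ∞ (fun u => (actK 𝒦 i (φ u) (κ u)).arr j) U := by
  have hi := 𝒦.contMDiff_incl.comp_contMDiffOn hκ
  have hmul : ∀ {α β : W → G}, ContMDiffOn 𝓘(ℝ, W) 𝓘(ℝ, EG) ∞ α U →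
      ContMDiffOn 𝓘(ℝ, W) 𝓘(ℝ, EG) ∞ β U → (∀ u ∈ U, 𝒢.src (α u) = 𝒢.tgt (β u)) →
      ContMDiffOn 𝓘(ℝ, W) 𝓘(ℝ, EG) ∞ (fun u => 𝒢.mul (α u) (β u)) U := fun hα hβ hαβ =>
    𝒢.contMDiffOn_mul.comp (hα.prodMk hβ) fun u hu => hαβ u hu
  by_cases hj1 : (j : ℕ) + 1 = i
  · refine (hmul (h2 j) hi fun u hu => ?_).congr fun u hu => ?_
    · rw [Function.comp_apply, 𝒦.tgt_incl, h u hu, (φ u).src_eq j i hj1]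
    · rw [actK_eq_act (h u hu)]
      simp [Nerve.act, hj1]
  by_cases hj2 : (j : ℕ) = i
  · refine (hmul (𝒢.contMDiff_inv.comp_contMDiffOn hi) (h2 j) fun u hu => ?_).congr fun u hu => ?_
    · simp only [Function.comp_apply]
      rw [𝒢.src_inv, 𝒦.tgt_incl, h u hu, (φ u).tgt_eq j i hj2]
    · rw [actK_eq_act (h u hu)]
      simp [Nerve.act, hj2]
  · refine (h2 j).congr fun u hu => ?_
    rw [actK_eq_act (h u hu)]
    simp [Nerve.act, hj1, hj2]

/-- The function `f` is invariant under the `i`-th action of `K`. -/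
def IsInvariantAt (𝒦 : 𝒢.WideSubgroupoid EK K) {p : ℕ} (i : Fin (p + 1)) (f : 𝒢.Nerve p → ℝ) :
    Prop :=
  ∀ (x : 𝒢.Nerve p) (k : K), 𝒦.tgt k = x.base i → f (actK 𝒦 i x k) = f x

theorem mem_invariantCochains_iff {p : ℕ} {f : 𝒢.Nerve p → ℝ} :
    f ∈ invariantCochains 𝒦 p ↔ f ∈ 𝒢.cochains p ∧ ∀ i, IsInvariantAt 𝒦 i f := by
  refine and_congr_right fun _ => forall_congr' fun i => forall_congr' fun x =>
    forall_congr' fun k => ⟨fun h hk => ?_, fun h hk => ?_⟩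
  · rw [actK_eq_act hk]
    exact h _
  · rw [← h ((𝒦.tgt_incl k).symm.trans hk), actK_eq hk]

theorem isInvariantAt_face_self {p : ℕ} (i : Fin (p + 2)) (f : 𝒢.Nerve p → ℝ) :
    IsInvariantAt 𝒦 i (fun x => f (Nerve.face i x)) := fun x k hk => by
  simp only [actK_eq_act hk, Nerve.face_act_self]

/-- The integrand of a double average over two different actions is continuous on the product of
the two fibres. -/
theorem continuousOn_actK_actK [IsManifold 𝓘(ℝ, EM) ∞ M] [IsManifold 𝓘(ℝ, EG) ∞ G]
    [IsManifold 𝓘(ℝ, EK) ∞ K] [FiniteDimensional ℝ EK] {p : ℕ} {i j : Fin (p + 1)} (hij : i ≠ j)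
    {f : 𝒢.Nerve p → ℝ} (hf : f ∈ 𝒢.cochains p) (x : 𝒢.Nerve p) :
    ContinuousOn (fun q : K × K => f (actK 𝒦 j (actK 𝒦 i x q.1) q.2))
      {q | 𝒦.tgt q.1 = x.base i ∧ 𝒦.tgt q.2 = x.base j} := by
  obtain ⟨d, hd⟩ := exists_tgtChart 𝒦.toLieGroupoid
  rintro ⟨a₀, b₀⟩ ⟨ha₀, hb₀⟩
  obtain ⟨c, hc⟩ := hd a₀
  obtain ⟨c', hc'⟩ := hd b₀
  have hm : x.base i ∈ c.base.source := ha₀ ▸ c.tgt_mem _ hc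
  have hm' : x.base j ∈ c'.base.source := hb₀ ▸ c'.tgt_mem _ hc'
  have hS : IsOpen (c.slice ×ˢ c'.slice) := c.isOpen_slice.prod c'.isOpen_slice
  have hp := c.contMDiffOn_point (U := c.slice ×ˢ c'.slice) (b := fun _ => x.base i)
    (y := Prod.fst) contMDiffOn_const contDiff_fst.contDiffOn (fun _ _ => hm) (fun w hw => hw.1)
  have hp' := c'.contMDiffOn_point (U := c.slice ×ˢ c'.slice) (b := fun _ => x.base j)
    (y := Prod.snd) contMDiffOn_const contDiff_snd.contDiffOn (fun _ _ => hm') (fun w hw => hw.2)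
  have ht : ∀ w ∈ c.slice ×ˢ c'.slice, 𝒦.tgt (c.point (x.base i) w.1) = x.base i :=
    fun w hw => c.tgt_point hm hw.1
  have ht' : ∀ w ∈ c.slice ×ˢ c'.slice, 𝒦.tgt (c'.point (x.base j) w.2) =
      (actK 𝒦 i x (c.point (x.base i) w.1)).base j := fun w hw => by
    rw [actK_base_of_ne hij.symm, c'.tgt_point hm' hw.2]
  have h := IsSmooth.contDiffOn hf hS
    (φ := fun w => actK 𝒦 j (actK 𝒦 i x (c.point (x.base i) w.1)) (c'.point (x.base j) w.2))
    (contMDiffOn_actK_base ht'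
      (contMDiffOn_actK_base ht (fun _ => contMDiffOn_const) hp) hp')
    (contMDiffOn_actK_arr ht'
      (contMDiffOn_actK_arr ht (fun _ => contMDiffOn_const) hp) hp')
  have hcc : ContinuousAt (fun q : K × K => (c.coord q.1, c'.coord q.2)) (a₀, b₀) :=
    ContinuousAt.prodMk
      (ContinuousAt.comp (f := Prod.fst) (x := (a₀, b₀))
        (c.contMDiffOn_coord.continuousOn.continuousAt (c.chart.open_source.mem_nhds hc))
        continuousAt_fst)
      (ContinuousAt.comp (f := Prod.snd) (x := (a₀, b₀))
        (c'.contMDiffOn_coord.continuousOn.continuousAt (c'.chart.open_source.mem_nhds hc'))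
        continuousAt_snd)
  have h2 := ContinuousAt.comp (f := fun q : K × K => (c.coord q.1, c'.coord q.2)) (x := (a₀, b₀))
    (h.continuousOn.continuousAt (hS.mem_nhds ⟨c.coord_mem hc, c'.coord_mem hc'⟩)) hcc
  refine h2.continuousWithinAt.congr_of_eventuallyEq ?_ ?_
  · filter_upwards [mem_nhdsWithin_of_mem_nhds
      ((c.chart.open_source.prod c'.chart.open_source).mem_nhds ⟨hc, hc'⟩),
      self_mem_nhdsWithin] with q hq hq'
    simp only [Function.comp_apply]
    rw [← hq'.1, ← hq'.2, c.point_coord hq.1, c'.point_coord hq.2]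
  · simp only [Function.comp_apply]
    rw [← ha₀, ← hb₀, c.point_coord hc, c'.point_coord hc']

section Avg

variable [MeasurableSpace K] [BorelSpace K] [T1Space M] (μ : HaarSystem 𝒦.toLieGroupoid)

theorem avg_eq_integral_actK {p : ℕ} (i : Fin (p + 1)) (f : 𝒢.Nerve p → ℝ) (x : 𝒢.Nerve p) :
    avg μ i f x = ∫ k, f (actK 𝒦 i x k) ∂(μ.onArrows (x.base i)) := by
  rw [HaarSystem.integral_onArrows, avg]
  refine integral_congr_ae (Eventually.of_forall fun a => ?_)
  simp only [actK_eq_act a.2, actFiber]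

theorem integrable_actFiber_iff {p : ℕ} (i : Fin (p + 1)) (f : 𝒢.Nerve p → ℝ) (x : 𝒢.Nerve p) :
    Integrable (fun a => f (actFiber (𝒦 := 𝒦) i x a)) (μ.measure (x.base i)) ↔
      Integrable (fun k => f (actK 𝒦 i x k)) (μ.onArrows (x.base i)) := by
  rw [HaarSystem.integrable_onArrows_iff]
  refine integrable_congr (Eventually.of_forall fun a => ?_)
  simp only [actK_eq_act a.2, actFiber]

theorem avg_of_isInvariantAt {p : ℕ} {i : Fin (p + 1)} {f : 𝒢.Nerve p → ℝ}
    (hf : IsInvariantAt 𝒦 i f) : avg μ i f = f := by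
  ext x
  rw [avg_eq_integral_actK]
  trans ∫ _, f x ∂(μ.onArrows (x.base i))
  · refine integral_congr_ae ?_
    filter_upwards [μ.ae_tgt_eq (x.base i)] with k hk
    exact hf x k hk
  · simp

omit [BorelSpace K] [T1Space M] in
theorem avg_comp_face {p : ℕ} (j : Fin (p + 2)) (i : Fin (p + 1)) (f : 𝒢.Nerve p → ℝ) :
    avg μ (j.succAbove i) (fun x => f (Nerve.face j x)) =
      fun x => avg μ i f (Nerve.face j x) := by
  ext x
  refine integral_congr_ae (Eventually.of_forall fun a => ?_)
  exact congrArg f (Nerve.face_act_succAbove j i x _ _)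

theorem IsInvariantAt.avg_of_ne {p : ℕ} {i j : Fin (p + 1)} (hij : i ≠ j) {f : 𝒢.Nerve p → ℝ}
    (hf : IsInvariantAt 𝒦 j f) : IsInvariantAt 𝒦 j (avg μ i f) := fun x k hk => by
  rw [avg_eq_integral_actK, avg_eq_integral_actK, actK_base_of_ne hij]
  refine integral_congr_ae ?_
  filter_upwards [μ.ae_tgt_eq (x.base i)] with a ha
  rw [← actK_comm hij ha hk]
  exact hf _ _ (hk.trans (actK_base_of_ne hij.symm _ _).symm)

theorem avg_avg_eq {p : ℕ} {i j : Fin (p + 1)} (hij : i ≠ j) (f : 𝒢.Nerve p → ℝ)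
    (x : 𝒢.Nerve p) : avg μ i (avg μ j f) x =
      ∫ a, ∫ b, f (actK 𝒦 j (actK 𝒦 i x a) b) ∂(μ.onArrows (x.base j))
        ∂(μ.onArrows (x.base i)) := by
  rw [avg_eq_integral_actK]
  simp only [avg_eq_integral_actK, actK_base_of_ne hij.symm]

variable [FiniteDimensional ℝ EM] [FiniteDimensional ℝ EK] [IsManifold 𝓘(ℝ, EM) ∞ M]
  [IsManifold 𝓘(ℝ, EG) ∞ G] [IsManifold 𝓘(ℝ, EK) ∞ K] [T2Space M] [T2Space K]
  [SecondCountableTopology K]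

/-- Averaging a smooth function along a smooth family of points of the nerve. -/
theorem integrable_and_contDiffOn_avg {p : ℕ} (i : Fin (p + 1)) {f : 𝒢.Nerve p → ℝ}
    (hf : f ∈ 𝒢.cochains p) {W : Type*} [NormedAddCommGroup W] [NormedSpace ℝ W]
    [FiniteDimensional ℝ W] {U : Set W} {φ : W → 𝒢.Nerve p} (hU : IsOpen U)
    (h1 : ∀ i, ContMDiffOn 𝓘(ℝ, W) 𝓘(ℝ, EM) ∞ (fun u => (φ u).base i) U)
    (h2 : ∀ j, ContMDiffOn 𝓘(ℝ, W) 𝓘(ℝ, EG) ∞ (fun u => (φ u).arr j) U) :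
    (∀ u ∈ U, Integrable (fun k => f (actK 𝒦 i (φ u) k)) (μ.onArrows ((φ u).base i))) ∧
      ContDiffOn ℝ ∞ (fun u => avg μ i f (φ u)) U := by
  obtain ⟨d, hd⟩ := exists_tgtChart 𝒦.toLieGroupoid
  have := μ.integrable_and_contDiffOn hd hU (h1 i) (h := fun u k => f (actK 𝒦 i (φ u) k)) ?_
  · simpa only [avg_eq_integral_actK] using this
  intro Ω β hΩ hΩU hβ hβt
  have hfst : ContMDiffOn 𝓘(ℝ, W × EuclideanSpace ℝ (Fin d)) 𝓘(ℝ, W) ∞ Prod.fst Ω :=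
    contDiff_fst.contMDiff.contMDiffOn
  exact hf.contDiffOn hΩ (φ := fun w => actK 𝒦 i (φ w.1) (β w))
    (contMDiffOn_actK_base (φ := fun w => φ w.1) hβt
      (fun j => (h1 j).comp (f := Prod.fst) hfst fun w hw => hΩU w hw) hβ)
    (contMDiffOn_actK_arr (φ := fun w => φ w.1) hβt
      (fun j => (h2 j).comp (f := Prod.fst) hfst fun w hw => hΩU w hw) hβ)

theorem avg_mem_cochains {p : ℕ} (i : Fin (p + 1)) {f : 𝒢.Nerve p → ℝ} (hf : f ∈ 𝒢.cochains p) :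
    avg μ i f ∈ 𝒢.cochains p :=
  fun _ _ _ hU h1 h2 => (integrable_and_contDiffOn_avg μ i hf hU h1 h2).2

theorem integrable_actK {p : ℕ} (i : Fin (p + 1)) {f : 𝒢.Nerve p → ℝ} (hf : f ∈ 𝒢.cochains p)
    (x : 𝒢.Nerve p) : Integrable (fun k => f (actK 𝒦 i x k)) (μ.onArrows (x.base i)) :=
  (integrable_and_contDiffOn_avg μ i hf (W := ℝ) (φ := fun _ => x) isOpen_univ
    (fun _ => contMDiffOn_const) (fun _ => contMDiffOn_const)).1 0 (mem_univ _)

/-- By left invariance of the Haar system, an average over an action is invariant under it. -/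
theorem isInvariantAt_avg_self {p : ℕ} (i : Fin (p + 1)) {f : 𝒢.Nerve p → ℝ}
    (hf : f ∈ 𝒢.cochains p) : IsInvariantAt 𝒦 i (avg μ i f) := fun x k hk => by
  rw [avg_eq_integral_actK, avg_eq_integral_actK, actK_base_self hk]
  have h := integrable_actK μ i hf x
  rw [← hk] at h ⊢
  rw [← μ.integral_mul_left k h]
  refine integral_congr_ae ?_
  filter_upwards [μ.ae_tgt_eq (𝒦.src k)] with a ha
  rw [actK_actK hk ha.symm]

theorem IsInvariantAt.avg {p : ℕ} {i j : Fin (p + 1)} {f : 𝒢.Nerve p → ℝ}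
    (hf : f ∈ 𝒢.cochains p) (h : IsInvariantAt 𝒦 j f) : IsInvariantAt 𝒦 j (avg μ i f) := by
  by_cases hij : i = j
  · subst hij
    exact isInvariantAt_avg_self μ i hf
  · exact h.avg_of_ne μ hij

omit [FiniteDimensional ℝ EM] [T2Space M] in
/-- The integrand of a double average is integrable, as it is continuous on the product of the
supports, which is compact. -/
theorem integrable_actK_actK {p : ℕ} {i j : Fin (p + 1)} (hij : i ≠ j) {f : 𝒢.Nerve p → ℝ}
    (hf : f ∈ 𝒢.cochains p) (x : 𝒢.Nerve p) :
    Integrable (fun q : K × K => f (actK 𝒦 j (actK 𝒦 i x q.1) q.2))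
      ((μ.onArrows (x.base i)).prod (μ.onArrows (x.base j))) := by
  have hZ := fun m => μ.isCompact_totalSupport_inter (isCompact_singleton (x := m))
  have hae : ∀ᵐ q ∂((μ.onArrows (x.base i)).prod (μ.onArrows (x.base j))),
      q ∈ (μ.totalSupport ∩ 𝒦.tgt ⁻¹' {x.base i}) ×ˢ (μ.totalSupport ∩ 𝒦.tgt ⁻¹' {x.base j}) := by
    have h1 := Measure.quasiMeasurePreserving_fst (μ := μ.onArrows (x.base i))
      (ν := μ.onArrows (x.base j))
    have h2 := Measure.quasiMeasurePreserving_snd (μ := μ.onArrows (x.base i))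
      (ν := μ.onArrows (x.base j))
    filter_upwards [h1.ae (μ.ae_mem_totalSupport _), h1.ae (μ.ae_tgt_eq _),
      h2.ae (μ.ae_mem_totalSupport _), h2.ae (μ.ae_tgt_eq _)] with q q1 q2 q3 q4
    exact ⟨⟨q1, q2⟩, ⟨q3, q4⟩⟩
  have h := (continuousOn_actK_actK (𝒦 := 𝒦) hij hf x).mono (s := _)
    (fun q (hq : q ∈ (μ.totalSupport ∩ 𝒦.tgt ⁻¹' {x.base i}) ×ˢ
      (μ.totalSupport ∩ 𝒦.tgt ⁻¹' {x.base j})) => ⟨hq.1.2, hq.2.2⟩)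
  have h2 := h.integrableOn_compact
    (μ := (μ.onArrows (x.base i)).prod (μ.onArrows (x.base j))) ((hZ _).prod (hZ _))
  rwa [IntegrableOn, Measure.restrict_eq_self_of_ae_mem hae] at h2

omit [FiniteDimensional ℝ EM] [T2Space M] in
theorem avg_comm {p : ℕ} (i j : Fin (p + 1)) {f : 𝒢.Nerve p → ℝ} (hf : f ∈ 𝒢.cochains p) :
    avg μ i (avg μ j f) = avg μ j (avg μ i f) := by
  by_cases hij : i = j
  · rw [hij]
  ext x
  rw [avg_avg_eq μ hij, avg_avg_eq μ (Ne.symm hij),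
    integral_integral_swap (integrable_actK_actK μ hij hf x)]
  refine integral_congr_ae ?_
  filter_upwards [μ.ae_tgt_eq (x.base j)] with b hb
  refine integral_congr_ae ?_
  filter_upwards [μ.ae_tgt_eq (x.base i)] with a ha
  rw [actK_comm hij ha hb]

/-- The averaging operator on smooth cochains. -/
noncomputable def avgLinear {p : ℕ} (i : Fin (p + 1)) : 𝒢.cochains p →ₗ[ℝ] 𝒢.cochains p where
  toFun f := ⟨avg μ i f, avg_mem_cochains μ i f.2⟩
  map_add' f g := by
    ext x
    simp only [avg_eq_integral_actK, Submodule.coe_add, Pi.add_apply]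
    exact integral_add (integrable_actK μ i f.2 x) (integrable_actK μ i g.2 x)
  map_smul' c f := by
    ext x
    simp only [avg_eq_integral_actK, Submodule.coe_smul, Pi.smul_apply, smul_eq_mul,
      integral_const_mul, RingHom.id_apply]

end Avg

end LieGroupoid

namespace LieGroupoid

open MeasureTheory CategoryTheory

variable {EM EG EK M G K : Type*}
  [NormedAddCommGroup EM] [NormedSpace ℝ EM] [TopologicalSpace M] [ChartedSpace EM M]
  [NormedAddCommGroup EG] [NormedSpace ℝ EG] [TopologicalSpace G] [ChartedSpace EG G]
  [NormedAddCommGroup EK] [NormedSpace ℝ EK] [TopologicalSpace K] [ChartedSpace EK K]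
  {𝒢 : LieGroupoid EM EG M G} {𝒦 : 𝒢.WideSubgroupoid EK K}

/-! ### Cosimplicial spaces of functions on the nerve -/

/-- Spaces of functions on the nerve that are stable under pullback along the face and degeneracy
maps form a cosimplicial vector space. -/
noncomputable def cosimplicialOf (S : ∀ p, Submodule ℝ (𝒢.Nerve p → ℝ))
    (hd : ∀ p (i : Fin (p + 2)), ∀ f ∈ S p, (fun x => f (Nerve.face i x)) ∈ S (p + 1))
    (hs : ∀ p (j : Fin (p + 1)), ∀ f ∈ S (p + 1), (fun x => f (Nerve.degen j x)) ∈ S p) :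
    CosimplicialData (fun p => S p) where
  d p i := if h : i < p + 2 then
    (LinearMap.funLeft ℝ ℝ (Nerve.face (𝒢 := 𝒢) (⟨i, h⟩ : Fin (p + 2)))).restrict (hd p ⟨i, h⟩)
    else 0
  s p j := if h : j < p + 1 then
    (LinearMap.funLeft ℝ ℝ (Nerve.degen (𝒢 := 𝒢) (⟨j, h⟩ : Fin (p + 1)))).restrict (hs p ⟨j, h⟩)
    else 0
  s_d_self p i f hi := by
    rw [dif_pos (by omega), dif_pos (by omega)]
    ext x
    exact congrArg f.1 (Nerve.face_castSucc_degen ⟨i, by omega⟩ x)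
  s_d_succ p i f hi := by
    rw [dif_pos (by omega), dif_pos (by omega)]
    ext x
    exact congrArg f.1 (Nerve.face_succ_degen ⟨i, by omega⟩ x)
  s_d_of_le p i j f hj hi := by
    rw [dif_pos (by omega), dif_pos (by omega), dif_pos (by omega), dif_pos (by omega)]
    ext x
    exact congrArg f.1 (Nerve.face_degen_of_le ⟨i, by omega⟩ ⟨j, by omega⟩ hj x)
  s_d_of_lt p i j f hj hi := by
    rw [dif_pos (by omega), dif_pos (by omega), dif_pos (by omega), dif_pos (by omega)]
    ext x
    exact congrArg f.1 (Nerve.face_degen_of_lt ⟨i, by omega⟩ ⟨j, by omega⟩ hj x)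
  s_s p i j f hi hj := by
    rw [dif_pos (by omega), dif_pos (by omega), dif_pos (by omega), dif_pos (by omega)]
    ext x
    exact congrArg f.1 (Nerve.degen_degen ⟨i, by omega⟩ ⟨j, by omega⟩ hi x)

section

variable (S : ∀ p, Submodule ℝ (𝒢.Nerve p → ℝ))
    (hd : ∀ p (i : Fin (p + 2)), ∀ f ∈ S p, (fun x => f (Nerve.face i x)) ∈ S (p + 1))
    (hs : ∀ p (j : Fin (p + 1)), ∀ f ∈ S (p + 1), (fun x => f (Nerve.degen j x)) ∈ S p)

theorem cosimplicialOf_d {p i : ℕ} (h : i < p + 2) (f : S p) (x : 𝒢.Nerve (p + 1)) :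
    ((cosimplicialOf S hd hs).d p i f).1 x = f.1 (Nerve.face ⟨i, h⟩ x) := by
  simp only [cosimplicialOf, dif_pos h]
  rfl

theorem cosimplicialOf_s {p j : ℕ} (h : j < p + 1) (f : S (p + 1)) (x : 𝒢.Nerve p) :
    ((cosimplicialOf S hd hs).s p j f).1 x = f.1 (Nerve.degen ⟨j, h⟩ x) := by
  simp only [cosimplicialOf, dif_pos h]
  rfl

theorem cosimplicialOf_δ (p : ℕ) (f : S p) :
    ((cosimplicialOf S hd hs).δ p f).1 = 𝒢.coboundary p f.1 := by
  ext x
  rw [CosimplicialData.δ_apply, Finset.sum_range]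
  simp only [coboundary, LinearMap.coe_mk, AddHom.coe_mk, Submodule.coe_sum, Finset.sum_apply,
    Submodule.coe_smul, Pi.smul_apply, smul_eq_mul, cosimplicialOf_d S hd hs (Fin.is_lt _)]

theorem cosimplicialOf_δ_δ (p : ℕ) (f : S p) :
    (cosimplicialOf S hd hs).δ (p + 1) ((cosimplicialOf S hd hs).δ p f) = 0 := by
  apply Subtype.ext
  rw [cosimplicialOf_δ, cosimplicialOf_δ, coboundary_coboundary]
  rfl

end

theorem comp_face_mem_cochains (p : ℕ) (i : Fin (p + 2)) (f : 𝒢.Nerve p → ℝ)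
    (hf : f ∈ 𝒢.cochains p) : (fun x => f (Nerve.face i x)) ∈ 𝒢.cochains (p + 1) := by
  intro n U φ hU h1 h2
  refine hf n U (fun u => (φ u).face i) hU (fun k => h1 _) (fun k => ?_)
  simp only [Nerve.face]
  split_ifs
  · exact h2 _
  · exact 𝒢.contMDiffOn_mul.comp ((h2 k.castSucc).prodMk (h2 k.succ))
      fun u _ => (φ u).src_eq_tgt _ _ (by simp)
  · exact h2 _

theorem comp_degen_mem_cochains (p : ℕ) (j : Fin (p + 1)) (f : 𝒢.Nerve (p + 1) → ℝ)
    (hf : f ∈ 𝒢.cochains (p + 1)) : (fun x => f (Nerve.degen j x)) ∈ 𝒢.cochains p := by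
  intro n U φ hU h1 h2
  refine hf n U (fun u => (φ u).degen j) hU (fun k => h1 _) (fun k => ?_)
  simp only [Nerve.degen]
  split_ifs
  · exact h2 _
  · exact 𝒢.contMDiff_one.comp_contMDiffOn (h1 j)
  · exact h2 _

theorem comp_face_mem_invariantCochains (p : ℕ) (i : Fin (p + 2)) (f : 𝒢.Nerve p → ℝ)
    (hf : f ∈ invariantCochains 𝒦 p) :
    (fun x => f (Nerve.face i x)) ∈ invariantCochains 𝒦 (p + 1) := by
  refine ⟨comp_face_mem_cochains p i f hf.1, fun j x k hk => ?_⟩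
  rcases Fin.eq_self_or_eq_succAbove i j with rfl | ⟨j', rfl⟩
  · exact congrArg f (Nerve.face_act_self _ _ _ _)
  · exact (congrArg f (Nerve.face_act_succAbove i j' x _ hk)).trans (hf.2 j' (x.face i) k hk)

theorem comp_degen_mem_invariantCochains (p : ℕ) (j : Fin (p + 1)) (f : 𝒢.Nerve (p + 1) → ℝ)
    (hf : f ∈ invariantCochains 𝒦 (p + 1)) :
    (fun x => f (Nerve.degen j x)) ∈ invariantCochains 𝒦 p := by
  refine ⟨comp_degen_mem_cochains p j f hf.1, fun i x k hk => ?_⟩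
  rcases lt_trichotomy (i : ℕ) j with h | h | h
  · have hk' := hk.trans (Nerve.degen_base j x i.castSucc i (by simp [h.le])).symm
    exact (congrArg f (Nerve.degen_act_of_lt i j h x _ hk hk')).trans (hf.2 _ _ k hk')
  · obtain rfl : i = j := Fin.ext h
    have hk' := hk.trans (Nerve.degen_base i x i.succ i (by simp)).symm
    have hk'' : 𝒢.tgt (𝒦.incl k) =
        (Nerve.act i.succ (Nerve.degen i x) (𝒦.incl k) hk').base i.castSucc := by
      rw [hk, ← Nerve.degen_base i x i.castSucc i (by simp)]
      simp [Nerve.act, Fin.ext_iff]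
    exact (congrArg f (Nerve.degen_act_self i x _ hk hk' hk'')).trans
      ((hf.2 _ _ k hk'').trans (hf.2 _ _ k hk'))
  · have hk' := hk.trans (Nerve.degen_base j x i.succ i (by simp; omega)).symm
    exact (congrArg f (Nerve.degen_act_of_gt i j h x _ hk hk')).trans (hf.2 _ _ k hk')

variable (𝒢) in
/-- The smooth cochains as a cosimplicial vector space. -/
noncomputable def cochainsCosimplicial : CosimplicialData (fun p => 𝒢.cochains p) :=
  cosimplicialOf 𝒢.cochains comp_face_mem_cochains comp_degen_mem_cochains

variable (𝒦) in
/-- The invariant cochains as a cosimplicial vector space. -/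
noncomputable def invariantCosimplicial : CosimplicialData (fun p => invariantCochains 𝒦 p) :=
  cosimplicialOf (invariantCochains 𝒦) comp_face_mem_invariantCochains
    comp_degen_mem_invariantCochains

/-- An invariant cochain vanishes as soon as some `g_j` lies in `K` if and only if it vanishes on
the degenerate elements of the nerve: the action of `K` can move `g_j` to an identity. -/
theorem mem_normalizedInvariantCochains_iff {p : ℕ} (f : invariantCochains 𝒦 p) :
    f.1 ∈ normalizedInvariantCochains 𝒦 p ↔
      (invariantCosimplicial 𝒦).IsNormalizedUpTo p p f := by
  cases p with
  | zero => exact ⟨fun _ => trivial, fun _ => ⟨f.2, fun x ⟨j, _⟩ => j.elim0⟩⟩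
  | succ p =>
    constructor
    · intro h j hj hjp
      apply Subtype.ext
      ext x
      rw [invariantCosimplicial, cosimplicialOf_s _ _ _ hj]
      refine h.2 _ ⟨⟨j, hj⟩, 𝒦.one (x.base ⟨j, hj⟩), ?_⟩
      rw [𝒦.incl_one, Nerve.degen_arr_of_eq _ _ _ rfl]
    · refine fun h => ⟨f.2, ?_⟩
      rintro x ⟨j, k, hk⟩
      have ha : 𝒢.tgt (x.arr j) = x.base j.castSucc := x.tgt_arr j
      rw [← f.2.2 j.castSucc x k (by rw [hk, ha])]
      simp only [hk]
      rw [Nerve.act_arr_eq_degen j x ha]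
      have h1 := congrArg (fun g : invariantCochains 𝒦 p => g.1 (Nerve.face j.castSucc x))
        (h j j.is_lt (Nat.lt_succ_iff.1 j.is_lt))
      simp only [invariantCosimplicial] at h1
      rwa [cosimplicialOf_s _ _ _ j.is_lt] at h1

/-! ### Deformation retractions onto subcomplexes -/

theorem inclusionOf_comp {S T U : ∀ p, Submodule ℝ (𝒢.Nerve p → ℝ)}
    (hS : ∀ p, ∀ f ∈ S p, 𝒢.coboundary p f ∈ S (p + 1))
    (hT : ∀ p, ∀ f ∈ T p, 𝒢.coboundary p f ∈ T (p + 1))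
    (hU : ∀ p, ∀ f ∈ U p, 𝒢.coboundary p f ∈ U (p + 1)) (h1 : ∀ p, S p ≤ T p)
    (h2 : ∀ p, T p ≤ U p) : inclusionOf S T hS hT h1 ≫ inclusionOf T U hT hU h2 =
      inclusionOf S U hS hU fun p => (h1 p).trans (h2 p) :=
  rfl

section Retraction

variable {S T : ∀ p, Submodule ℝ (𝒢.Nerve p → ℝ)}
    (hS : ∀ p, ∀ f ∈ S p, 𝒢.coboundary p f ∈ S (p + 1))
    (hT : ∀ p, ∀ f ∈ T p, 𝒢.coboundary p f ∈ T (p + 1)) (hST : ∀ p, S p ≤ T p)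
    (π : ∀ p, T p →ₗ[ℝ] S p) (H : ∀ p, T (p + 1) →ₗ[ℝ] T p)
    (hπ : ∀ p (f : T p), f.1 ∈ S p → (π p f).1 = f.1)
    (h0 : ∀ f : T 0, (H 0 ((𝒢.coboundary 0).restrict (hT 0) f)).1 = f.1 - (π 0 f).1)
    (hsucc : ∀ p (f : T (p + 1)), (H (p + 1) ((𝒢.coboundary (p + 1)).restrict (hT (p + 1)) f)).1 +
      𝒢.coboundary p (H p f).1 = f.1 - (π (p + 1) f).1)

include h0 hsucc in
/-- A projection that is homotopic to the identity commutes with the differential. -/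
theorem coboundary_projection (p : ℕ) (f : T p) :
    𝒢.coboundary p (π p f).1 = (π (p + 1) ((𝒢.coboundary p).restrict (hT p) f)).1 := by
  set δf := (𝒢.coboundary p).restrict (hT p) f with hδf
  have hδδ : (𝒢.coboundary (p + 1)).restrict (hT (p + 1)) δf = 0 :=
    Subtype.ext (𝒢.coboundary_coboundary p f.1)
  have h1 := hsucc p δf
  rw [hδδ, map_zero, Submodule.coe_zero, zero_add] at h1
  have h2 : 𝒢.coboundary p (H p δf).1 = δf.1 - 𝒢.coboundary p (π p f).1 := by
    cases p with
    | zero => rw [h0, map_sub]; rfl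
    | succ p =>
      rw [eq_sub_of_add_eq (hsucc p f), map_sub, map_sub, coboundary_coboundary, sub_zero]
      rfl
  rw [h1] at h2
  exact (sub_right_injective h2).symm

/-- The projection onto a subcomplex, as a cochain map. -/
noncomputable def projectionOf : complexOf T hT ⟶ complexOf S hS :=
  CochainComplex.ofHom (fun p => ModuleCat.ofHom (π p)) (fun p => by
    simp only [complexOf, CochainComplex.of_d]
    exact ModuleCat.hom_ext (LinearMap.ext fun f =>
      Subtype.ext (coboundary_projection hT π H h0 hsucc p f)))

theorem complexOf_d (p : ℕ) : (complexOf T hT).d p (p + 1) =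
    ModuleCat.ofHom ((𝒢.coboundary p).restrict (hT p)) := by
  simp only [complexOf, CochainComplex.of_d]

/-- The components of the homotopy, indexed as in `Homotopy`. -/
noncomputable def homotopyComponent (i j : ℕ) (r : (ComplexShape.up ℕ).Rel j i) :
    (complexOf T hT).X i ⟶ (complexOf T hT).X j :=
  eqToHom (congrArg (complexOf T hT).X (show i = j + 1 from r.symm)) ≫ ModuleCat.ofHom (H j)

include h0 hsucc in
theorem id_sub_projection_eq :
    𝟙 (complexOf T hT) - projectionOf hS hT π H h0 hsucc ≫ inclusionOf S T hS hT hST =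
      Homotopy.nullHomotopicMap' (c := ComplexShape.up ℕ) (homotopyComponent hT H) := by
  ext p : 1
  cases p with
  | zero =>
    refine Eq.trans ?_ (Homotopy.nullHomotopicMap'_f_of_not_rel_right (k₁ := 0) (k₀ := 0 + 1)
      (by simp) (fun l => by simp) _).symm
    rw [complexOf_d hT 0]
    exact ModuleCat.hom_ext (LinearMap.ext fun f => Subtype.ext (h0 f).symm)
  | succ p =>
    refine Eq.trans ?_ (Homotopy.nullHomotopicMap'_f (k₂ := p) (k₁ := p + 1) (k₀ := p + 1 + 1)
      (by simp) (by simp) _).symm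
    rw [complexOf_d, complexOf_d]
    exact ModuleCat.hom_ext (LinearMap.ext fun f => Subtype.ext (hsucc p f).symm)

/-- A subcomplex is a deformation retract of a complex if there is a projection onto it that is
homotopic to the identity. -/
noncomputable def homotopyEquivOf : HomotopyEquiv (complexOf T hT) (complexOf S hS) where
  hom := projectionOf hS hT π H h0 hsucc
  inv := inclusionOf S T hS hT hST
  homotopyHomInvId := (Homotopy.equivSubZero.symm
    ((Homotopy.ofEq (id_sub_projection_eq hS hT hST π H h0 hsucc)).trans
      (Homotopy.nullHomotopy' _))).symm
  homotopyInvHomId := Homotopy.ofEq (by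
    ext p : 1
    exact ModuleCat.hom_ext (LinearMap.ext fun f => Subtype.ext (hπ p _ f.2)))

end Retraction

theorem cochainsCosimplicial_δ (p : ℕ) (f : 𝒢.cochains p) :
    (𝒢.coboundary p).restrict (𝒢.coboundary_mem_cochains p) f = (cochainsCosimplicial 𝒢).δ p f :=
  Subtype.ext (cosimplicialOf_δ _ _ _ p f).symm

theorem invariantCosimplicial_δ (p : ℕ) (f : invariantCochains 𝒦 p) :
    (𝒢.coboundary p).restrict (coboundary_mem_invariantCochains 𝒦 p) f =
      (invariantCosimplicial 𝒦).δ p f :=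
  Subtype.ext (cosimplicialOf_δ _ _ _ p f).symm

variable (𝒦) in
/-- The projection onto the normalized invariant cochains. -/
noncomputable def normalizationLinear (p : ℕ) :
    invariantCochains 𝒦 p →ₗ[ℝ] normalizedInvariantCochains 𝒦 p :=
  LinearMap.codRestrict _
    ((invariantCochains 𝒦 p).subtype ∘ₗ (invariantCosimplicial 𝒦).normalization p)
    fun f => (mem_normalizedInvariantCochains_iff ((invariantCosimplicial 𝒦).normalization p f)).2
      (CosimplicialData.isNormalizedUpTo_normalization (X := invariantCosimplicial 𝒦) p f)

variable (𝒦) in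
/-- The normalized invariant cochains are a deformation retract of the invariant cochains. -/
noncomputable def normalizationEquiv :
    HomotopyEquiv (invariantComplex 𝒦) (normalizedInvariantComplex 𝒦) :=
  homotopyEquivOf (coboundary_mem_normalizedInvariantCochains 𝒦)
    (coboundary_mem_invariantCochains 𝒦) (fun _ _ hf => hf.1) (normalizationLinear 𝒦)
    (fun p => (invariantCosimplicial 𝒦).normalizationHomotopy p)
    (fun p f hf => congrArg (fun g : invariantCochains 𝒦 p => g.1)
      (CosimplicialData.normalization_eq_self (X := invariantCosimplicial 𝒦) p f
        ((mem_normalizedInvariantCochains_iff f).1 hf)))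
    (fun f => by
      rw [invariantCosimplicial_δ, CosimplicialData.normalizationHomotopy_zero]
      rfl)
    (fun p f => by
      have := CosimplicialData.normalizationHomotopy_δ (X := invariantCosimplicial 𝒦)
        (cosimplicialOf_δ_δ _ _ _) p f
      rw [← invariantCosimplicial_δ, ← invariantCosimplicial_δ] at this
      exact congrArg Subtype.val this)

/-! ### The homotopy equivalences -/

section Equivalences

variable [FiniteDimensional ℝ EM] [FiniteDimensional ℝ EK] [IsManifold 𝓘(ℝ, EM) ∞ M]
  [IsManifold 𝓘(ℝ, EG) ∞ G] [IsManifold 𝓘(ℝ, EK) ∞ K] [T2Space M] [T2Space K]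
  [SecondCountableTopology K] [MeasurableSpace K] [BorelSpace K]
  (μ : HaarSystem 𝒦.toLieGroupoid)

/-- The averaging operators on cochains, indexed by natural numbers. -/
noncomputable def avgOperator (p k : ℕ) : 𝒢.cochains p →ₗ[ℝ] 𝒢.cochains p :=
  if h : k < p + 1 then avgLinear μ ⟨k, h⟩ else 0

theorem coe_avgOperator {p k : ℕ} (h : k < p + 1) (f : 𝒢.cochains p) :
    (avgOperator μ p k f).1 = avg μ ⟨k, h⟩ f.1 := by
  rw [avgOperator, dif_pos h]
  rfl

theorem cochainsCosimplicial_isAveraging :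
    (cochainsCosimplicial 𝒢).IsAveraging (avgOperator μ) where
  self p i f hi := by
    apply Subtype.ext
    rw [coe_avgOperator μ (show i < p + 1 + 1 by omega)]
    have h : ((cochainsCosimplicial 𝒢).d p i f).1 = fun x => f.1 (Nerve.face ⟨i, by omega⟩ x) :=
      funext fun x => cosimplicialOf_d _ _ _ _ _ _
    rw [h]
    exact avg_of_isInvariantAt μ (isInvariantAt_face_self _ _)
  of_lt p k j f hk hj := by
    apply Subtype.ext
    rw [coe_avgOperator μ (show k < p + 1 + 1 by omega)]
    have h : ∀ f : 𝒢.cochains p,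
        ((cochainsCosimplicial 𝒢).d p j f).1 = fun x => f.1 (Nerve.face ⟨j, by omega⟩ x) :=
      fun f => funext fun x => cosimplicialOf_d _ _ _ _ _ _
    rw [h, h, coe_avgOperator μ (show k < p + 1 by omega), ← avg_comp_face]
    congr 1
    ext
    rw [val_succAbove]
    simp [hk]
  of_le p k j f hj hk := by
    apply Subtype.ext
    rw [coe_avgOperator μ (show k + 1 < p + 1 + 1 by omega)]
    have h : ∀ f : 𝒢.cochains p,
        ((cochainsCosimplicial 𝒢).d p j f).1 = fun x => f.1 (Nerve.face ⟨j, by omega⟩ x) :=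
      fun f => funext fun x => cosimplicialOf_d _ _ _ _ _ _
    rw [h, h, coe_avgOperator μ (show k < p + 1 by omega), ← avg_comp_face]
    congr 1
    ext
    rw [val_succAbove]
    simp [Nat.not_lt.2 hj]

/-- The composition of the averaging operators, as it enters the prism homotopy, is the total
average. -/
theorem partialProd_avgOperator (p : ℕ) (f : 𝒢.cochains p) :
    (CosimplicialData.partialProd (avgOperator μ) p (p + 1) f).1 = totalAvg μ p f.1 := by
  have h1 : ∀ k (f : 𝒢.cochains p), CosimplicialData.partialProd (avgOperator μ) p k f =
      (List.range k).foldr (fun i h => avgOperator μ p i h) f := fun k => by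
    induction k with
    | zero => exact fun _ => rfl
    | succ k ih =>
      intro f
      rw [CosimplicialData.partialProd, LinearMap.comp_apply, ih, List.range_succ,
        List.foldr_append]
      rfl
  have h2 : ∀ l : List (Fin (p + 1)),
      (l.foldr (fun (i : Fin (p + 1)) h => avgOperator μ p i h) f).1 =
        l.foldr (fun i h => avg μ i h) f.1 := by
    intro l
    induction l with
    | nil => rfl
    | cons i l ih => rw [List.foldr_cons, List.foldr_cons, coe_avgOperator μ i.is_lt, ih]
  rw [h1, totalAvg, ← h2, ← List.map_coe_finRange_eq_range, List.foldr_map]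

theorem totalAvg_mem_invariantCochains {p : ℕ} {f : 𝒢.Nerve p → ℝ} (hf : f ∈ 𝒢.cochains p) :
    totalAvg μ p f ∈ invariantCochains 𝒦 p := by
  have h : ∀ l : List (Fin (p + 1)), l.foldr (fun i h => avg μ i h) f ∈ 𝒢.cochains p ∧
      ∀ i ∈ l, IsInvariantAt 𝒦 i (l.foldr (fun i h => avg μ i h) f) := by
    intro l
    induction l with
    | nil => exact ⟨hf, fun i hi => absurd hi List.not_mem_nil⟩
    | cons j l ih =>
      refine ⟨avg_mem_cochains μ j ih.1, fun i hi => ?_⟩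
      rcases List.mem_cons.1 hi with rfl | hi
      · exact isInvariantAt_avg_self μ i ih.1
      · exact (ih.2 i hi).avg μ ih.1
  exact mem_invariantCochains_iff.2 ⟨(h _).1, fun i => (h _).2 i (List.mem_finRange i)⟩

omit [FiniteDimensional ℝ EM] [FiniteDimensional ℝ EK] [IsManifold 𝓘(ℝ, EM) ∞ M]
  [IsManifold 𝓘(ℝ, EG) ∞ G] [IsManifold 𝓘(ℝ, EK) ∞ K] [T2Space K]
  [SecondCountableTopology K] in
theorem totalAvg_of_mem {p : ℕ} {f : 𝒢.Nerve p → ℝ} (hf : f ∈ invariantCochains 𝒦 p) :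
    totalAvg μ p f = f := by
  have h : ∀ l : List (Fin (p + 1)), l.foldr (fun i h => avg μ i h) f = f := by
    intro l
    induction l with
    | nil => rfl
    | cons j l ih =>
      rw [List.foldr_cons, ih, avg_of_isInvariantAt μ ((mem_invariantCochains_iff.1 hf).2 j)]
  exact h _

/-- The total averaging operator as a projection onto the invariant cochains. -/
noncomputable def totalAvgLinear (p : ℕ) : 𝒢.cochains p →ₗ[ℝ] invariantCochains 𝒦 p :=
  LinearMap.codRestrict _
    ((𝒢.cochains p).subtype ∘ₗ CosimplicialData.partialProd (avgOperator μ) p (p + 1))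
    fun f => by
      have := totalAvg_mem_invariantCochains μ f.2
      rwa [← partialProd_avgOperator] at this

theorem coe_totalAvgLinear (p : ℕ) (f : 𝒢.cochains p) :
    (totalAvgLinear μ p f).1 = totalAvg μ p f.1 :=
  partialProd_avgOperator μ p f

/-- Averaging is a homotopy inverse of the inclusion of the invariant cochains. -/
noncomputable def averagingEquiv :
    HomotopyEquiv 𝒢.groupoidComplex (invariantComplex 𝒦) :=
  homotopyEquivOf (coboundary_mem_invariantCochains 𝒦) 𝒢.coboundary_mem_cochains
    (invariantCochains_le 𝒦) (totalAvgLinear μ)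
    (fun p => (cochainsCosimplicial 𝒢).prism (avgOperator μ) p)
    (fun p f hf => by rw [coe_totalAvgLinear, totalAvg_of_mem μ hf])
    (fun f => by
      rw [cochainsCosimplicial_δ,
        CosimplicialData.prism_δ_zero (cochainsCosimplicial_isAveraging μ)]
      rfl)
    (fun p f => by
      have := CosimplicialData.prism_δ (cochainsCosimplicial_isAveraging μ) p f
      rw [← cochainsCosimplicial_δ, ← cochainsCosimplicial_δ] at this
      exact congrArg Subtype.val this)

theorem exists_homotopyEquiv_averaging :
    ∃ e : HomotopyEquiv 𝒢.groupoidComplex (invariantComplex 𝒦),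
      (∀ (p : ℕ) (f : 𝒢.cochains p),
        (invariantCochains 𝒦 p).subtype ((e.hom.f p).hom f) = totalAvg μ p f) ∧
      e.inv = invariantInclusion 𝒦 :=
  ⟨averagingEquiv μ, fun p f => coe_totalAvgLinear μ p f, rfl⟩

include μ in
theorem exists_homotopyEquiv_normalized :
    ∃ e : HomotopyEquiv (normalizedInvariantComplex 𝒦) 𝒢.groupoidComplex,
      e.hom = normalizedInvariantInclusion 𝒦 := by
  refine ⟨(normalizationEquiv 𝒦).symm.trans (averagingEquiv μ).symm, ?_⟩
  exact inclusionOf_comp (coboundary_mem_normalizedInvariantCochains 𝒦)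
    (coboundary_mem_invariantCochains 𝒦) 𝒢.coboundary_mem_cochains (fun _ _ hf => hf.1)
    (invariantCochains_le 𝒦)

end Equivalences

end LieGroupoid

/-! ### Left translations in charts -/

/-- The determinant is a smooth function of a linear endomorphism. -/
theorem ContinuousLinearMap.contDiff_det {F : Type*} [NormedAddCommGroup F] [NormedSpace ℝ F]
    [FiniteDimensional ℝ F] {n : WithTop ℕ∞} :
    ContDiff ℝ n (fun A : F →L[ℝ] F => A.det) := by
  let b := Module.finBasis ℝ F
  have h : ∀ A : F →L[ℝ] F, A.det = ∑ σ : Equiv.Perm (Fin (Module.finrank ℝ F)),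
      ((Equiv.Perm.sign σ : ℤ) : ℝ) * ∏ i, b.coord (σ i) (A (b i)) := fun A => by
    rw [ContinuousLinearMap.det, ← LinearMap.det_toMatrix b, Matrix.det_apply']
    simp [LinearMap.toMatrix_apply]
  simp only [h]
  refine ContDiff.sum fun σ _ => contDiff_const.mul (contDiff_prod fun i _ => ?_)
  exact (LinearMap.toContinuousLinearMap (b.coord (σ i))).contDiff.comp
    (ContinuousLinearMap.apply ℝ F (b i)).contDiff

namespace LieGroupoid

variable {EM EG M G : Type*}
  [NormedAddCommGroup EM] [NormedSpace ℝ EM] [TopologicalSpace M] [ChartedSpace EM M]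
  [NormedAddCommGroup EG] [NormedSpace ℝ EG] [TopologicalSpace G] [ChartedSpace EG G]
  {F : Type*} [NormedAddCommGroup F] [NormedSpace ℝ F]
  {𝒢 : LieGroupoid EM EG M G}

namespace TgtChart

/-- The coordinates of the points of a chart in the fibre over `m`: this is the whole slice, or
empty if the chart does not meet the fibre. -/
def fibreDomain (c : 𝒢.TgtChart F) (m : M) : Set F := {y | y ∈ c.slice ∧ m ∈ c.base.source}

theorem isOpen_fibreDomain (c : 𝒢.TgtChart F) (m : M) : IsOpen (c.fibreDomain m) :=
  c.isOpen_slice.inter isOpen_const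

theorem coord_mem_fibreDomain (c : 𝒢.TgtChart F) {a : G} (ha : a ∈ c.chart.source) :
    c.coord a ∈ c.fibreDomain (𝒢.tgt a) :=
  ⟨c.coord_mem ha, c.tgt_mem a ha⟩

theorem continuousOn_point (c : 𝒢.TgtChart F) (m : M) :
    ContinuousOn (c.point m) (c.fibreDomain m) :=
  (c.contMDiffOn_point (U := c.fibreDomain m) (b := fun _ => m) (y := id) contMDiffOn_const
    contDiffOn_id (fun _ h => h.2) (fun _ h => h.1)).continuousOn

/-- The left translation by `g` between fibres, in terms of two charts. -/
def transition (g : G) (c e : 𝒢.TgtChart F) (y : F) : F :=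
  e.coord (𝒢.mul g (c.point (𝒢.src g) y))

/-- The domain of definition of `transition`. -/
def transitionDomain (g : G) (c e : 𝒢.TgtChart F) : Set F :=
  {y | y ∈ c.fibreDomain (𝒢.src g) ∧ 𝒢.mul g (c.point (𝒢.src g) y) ∈ e.chart.source}

theorem contMDiffOn_mul_point (c : 𝒢.TgtChart F) {P : Type*} [NormedAddCommGroup P]
    [NormedSpace ℝ P] {U : Set P} {γ : P → G} {y : P → F} (hγ : ContMDiffOn 𝓘(ℝ, P) 𝓘(ℝ, EG) ∞ γ U)
    (hy : ContDiffOn ℝ ∞ y U) (h : ∀ u ∈ U, y u ∈ c.fibreDomain (𝒢.src (γ u))) :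
    ContMDiffOn 𝓘(ℝ, P) 𝓘(ℝ, EG) ∞ (fun u => 𝒢.mul (γ u) (c.point (𝒢.src (γ u)) (y u))) U := by
  have hp := c.contMDiffOn_point (𝒢.isSubmersion_src.contMDiff.comp_contMDiffOn hγ) hy
    (fun u hu => (h u hu).2) (fun u hu => (h u hu).1)
  exact 𝒢.contMDiffOn_mul.comp (hγ.prodMk hp) fun u hu =>
    (c.tgt_point (h u hu).2 (h u hu).1).symm

theorem contDiffOn_transition (c e : 𝒢.TgtChart F) {P : Type*} [NormedAddCommGroup P]
    [NormedSpace ℝ P] {U : Set P} {γ : P → G} {y : P → F} (hγ : ContMDiffOn 𝓘(ℝ, P) 𝓘(ℝ, EG) ∞ γ U)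
    (hy : ContDiffOn ℝ ∞ y U) (h : ∀ u ∈ U, y u ∈ transitionDomain (γ u) c e) :
    ContDiffOn ℝ ∞ (fun u => transition (γ u) c e (y u)) U := by
  rw [← contMDiffOn_iff_contDiffOn]
  exact e.contMDiffOn_coord.comp (c.contMDiffOn_mul_point hγ hy fun u hu => (h u hu).1)
    fun u hu => (h u hu).2

theorem continuousOn_mul_point (g : G) (c : 𝒢.TgtChart F) :
    ContinuousOn (fun y => 𝒢.mul g (c.point (𝒢.src g) y)) (c.fibreDomain (𝒢.src g)) :=
  (c.contMDiffOn_mul_point (γ := fun _ => g) (y := id) contMDiffOn_const contDiffOn_id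
    fun _ h => h).continuousOn

theorem isOpen_transitionDomain (g : G) (c e : 𝒢.TgtChart F) :
    IsOpen (transitionDomain g c e) :=
  (continuousOn_mul_point g c).isOpen_inter_preimage (c.isOpen_fibreDomain _) e.chart.open_source

theorem differentiableAt_transition {g : G} {c e : 𝒢.TgtChart F} {y : F}
    (hy : y ∈ transitionDomain g c e) : DifferentiableAt ℝ (transition g c e) y :=
  ((contDiffOn_transition c e (γ := fun _ => g) (y := id) contMDiffOn_const contDiffOn_id
    fun _ h => h).contDiffAt ((isOpen_transitionDomain g c e).mem_nhds hy)).differentiableAt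
    (by simp)

theorem src_eq_tgt_point {g : G} {c : 𝒢.TgtChart F} {y : F} (hy : y ∈ c.fibreDomain (𝒢.src g)) :
    𝒢.src g = 𝒢.tgt (c.point (𝒢.src g) y) :=
  (c.tgt_point hy.2 hy.1).symm

theorem point_transition {g : G} {c e : 𝒢.TgtChart F} {y : F} (hy : y ∈ transitionDomain g c e) :
    e.point (𝒢.tgt g) (transition g c e y) = 𝒢.mul g (c.point (𝒢.src g) y) := by
  have h := e.point_coord hy.2
  rwa [𝒢.tgt_mul _ _ (src_eq_tgt_point hy.1)] at h

theorem transition_mem_fibreDomain {g : G} {c e : 𝒢.TgtChart F} {y : F}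
    (hy : y ∈ transitionDomain g c e) : transition g c e y ∈ e.fibreDomain (𝒢.tgt g) := by
  have h := e.coord_mem_fibreDomain hy.2
  rwa [𝒢.tgt_mul _ _ (src_eq_tgt_point hy.1)] at h

theorem transition_transition {g h : G} {c e e' : 𝒢.TgtChart F} {y : F}
    (hy : y ∈ transitionDomain g c e) (hgh : 𝒢.src h = 𝒢.tgt g) :
    transition h e e' (transition g c e y) = transition (𝒢.mul h g) c e' y := by
  rw [transition, hgh, point_transition hy, transition, 𝒢.src_mul _ _ hgh,
    𝒢.mul_assoc _ _ _ hgh (src_eq_tgt_point hy.1)]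

theorem transition_mem {g : G} {c e : 𝒢.TgtChart F} {y : F} (hy : y ∈ transitionDomain g c e) :
    transition g c e y ∈ transitionDomain (𝒢.inv g) e c := by
  refine ⟨by rw [𝒢.src_inv]; exact transition_mem_fibreDomain hy, ?_⟩
  rw [𝒢.src_inv, point_transition hy, 𝒢.inv_mul_cancel_left _ _ (src_eq_tgt_point hy.1)]
  exact c.point_mem hy.1.2 hy.1.1

theorem transition_inv_transition {g : G} {c e : 𝒢.TgtChart F} {y : F}
    (hy : y ∈ transitionDomain g c e) : transition (𝒢.inv g) e c (transition g c e y) = y := by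
  rw [transition, 𝒢.src_inv, point_transition hy,
    𝒢.inv_mul_cancel_left _ _ (src_eq_tgt_point hy.1), c.coord_point hy.1.2 hy.1.1]

theorem injOn_transition (g : G) (c e : 𝒢.TgtChart F) :
    InjOn (transition g c e) (transitionDomain g c e) := fun y hy z hz h => by
  rw [← transition_inv_transition hy, h, transition_inv_transition hz]

theorem image_transition (g : G) (c e : 𝒢.TgtChart F) :
    transition g c e '' transitionDomain g c e = transitionDomain (𝒢.inv g) e c := by
  refine Subset.antisymm (by rintro _ ⟨y, hy, rfl⟩; exact transition_mem hy) fun z hz => ?_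
  have h1 := transition_mem hz
  have h2 := transition_inv_transition hz
  rw [𝒢.inv_inv] at h1 h2
  exact ⟨_, h1, h2⟩

theorem det_fderiv_transition_ne_zero {g : G} {c e : 𝒢.TgtChart F} {y : F}
    (hy : y ∈ transitionDomain g c e) : (fderiv ℝ (transition g c e) y).det ≠ 0 := by
  have h1 : (fun z => transition (𝒢.inv g) e c (transition g c e z)) =ᶠ[𝓝 y] id := by
    filter_upwards [(isOpen_transitionDomain g c e).mem_nhds hy] with z hz
    exact transition_inv_transition hz
  have h2 := h1.fderiv_eq (𝕜 := ℝ)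
  rw [fderiv_id, fderiv_fun_comp y (differentiableAt_transition (transition_mem hy))
    (differentiableAt_transition hy)] at h2
  have h3 := congrArg ContinuousLinearMap.det h2
  rw [ContinuousLinearMap.det, ContinuousLinearMap.det, ContinuousLinearMap.toLinearMap_comp,
    LinearMap.det_comp] at h3
  exact right_ne_zero_of_mul_eq_one (h3.trans LinearMap.det_id)

/-- The Jacobian at `a`, in terms of charts `c` at `a` and `e` at the identity of the source of
`a`, of the left translation by `a⁻¹`. -/
noncomputable def jacobian (c e : 𝒢.TgtChart F) (a : G) : ℝ :=
  |(fderiv ℝ (transition (𝒢.inv a) c e) (c.coord a)).det|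

theorem coord_mem_transitionDomain {c e : 𝒢.TgtChart F} {g a : G} (hga : 𝒢.src g = 𝒢.tgt a)
    (ha : a ∈ c.chart.source) (he : 𝒢.mul g a ∈ e.chart.source) :
    c.coord a ∈ transitionDomain g c e := by
  refine ⟨by rw [hga]; exact c.coord_mem_fibreDomain ha, ?_⟩
  rwa [hga, c.point_coord ha]

theorem coord_mem_transitionDomain_inv {c e : 𝒢.TgtChart F} {a : G} (ha : a ∈ c.chart.source)
    (he : 𝒢.one (𝒢.src a) ∈ e.chart.source) : c.coord a ∈ transitionDomain (𝒢.inv a) c e :=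
  coord_mem_transitionDomain (𝒢.src_inv a) ha (by rwa [𝒢.inv_mul])

theorem jacobian_pos {c e : 𝒢.TgtChart F} {a : G} (ha : a ∈ c.chart.source)
    (he : 𝒢.one (𝒢.src a) ∈ e.chart.source) : 0 < jacobian c e a :=
  abs_pos.2 (det_fderiv_transition_ne_zero (coord_mem_transitionDomain_inv ha he))

/-- The behaviour of the Jacobian under left translations: it is the chain rule for
`a⁻¹ = (g a)⁻¹ g`. -/
theorem jacobian_eq_mul {c c' e : 𝒢.TgtChart F} {g a : G} (hga : 𝒢.src g = 𝒢.tgt a)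
    (ha : a ∈ c.chart.source) (hga' : 𝒢.mul g a ∈ c'.chart.source)
    (he : 𝒢.one (𝒢.src a) ∈ e.chart.source) :
    jacobian c e a =
      |(fderiv ℝ (transition g c c') (c.coord a)).det| * jacobian c' e (𝒢.mul g a) := by
  have h0 := coord_mem_transitionDomain hga ha hga'
  have hcoord : transition g c c' (c.coord a) = c'.coord (𝒢.mul g a) := by
    rw [transition, hga, c.point_coord ha]
  have h1 : (fun z => transition (𝒢.inv (𝒢.mul g a)) c' e (transition g c c' z)) =ᶠ[𝓝 (c.coord a)]
      transition (𝒢.inv a) c e := by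
    filter_upwards [(isOpen_transitionDomain g c c').mem_nhds h0] with z hz
    rw [transition_transition hz (by rw [𝒢.src_inv, 𝒢.tgt_mul _ _ hga]), 𝒢.inv_mul_rev _ _ hga,
      𝒢.mul_assoc _ _ _ (by rw [𝒢.src_inv, 𝒢.tgt_inv, hga]) (𝒢.src_inv g), 𝒢.inv_mul, hga,
      ← 𝒢.src_inv a, 𝒢.mul_one]
  have h2 := h1.fderiv_eq (𝕜 := ℝ)
  have h3 : c'.coord (𝒢.mul g a) ∈ transitionDomain (𝒢.inv (𝒢.mul g a)) c' e :=
    coord_mem_transitionDomain_inv hga' (by rwa [𝒢.src_mul _ _ hga])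
  rw [fderiv_fun_comp _ (by rw [hcoord]; exact differentiableAt_transition h3)
    (differentiableAt_transition h0), hcoord] at h2
  rw [jacobian, jacobian, ← h2, ContinuousLinearMap.det, ContinuousLinearMap.toLinearMap_comp,
    LinearMap.det_comp, abs_mul, mul_comm]

theorem contMDiffAt_jacobian [FiniteDimensional ℝ F] {c e : 𝒢.TgtChart F} {a : G}
    (ha : a ∈ c.chart.source) (he : 𝒢.one (𝒢.src a) ∈ e.chart.source) :
    ContMDiffAt 𝓘(ℝ, EG) 𝓘(ℝ, ℝ) ∞ (jacobian c e) a := by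
  have hw : c.chart a ∈ c.chart.target := c.chart.map_source ha
  have hγ : ContMDiffOn 𝓘(ℝ, (EM × F) × F) 𝓘(ℝ, EG) ∞
      (fun q : (EM × F) × F => 𝒢.inv (c.chart.symm q.1)) (c.chart.target ×ˢ c.slice) :=
    𝒢.contMDiff_inv.comp_contMDiffOn
      (c.contMDiffOn_chart_symm.comp contDiff_fst.contMDiff.contMDiffOn fun q hq => hq.1)
  have hdom : ∀ q ∈ c.chart.target ×ˢ c.slice,
      q.2 ∈ c.fibreDomain (𝒢.src (𝒢.inv (c.chart.symm q.1))) := fun q hq =>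
    ⟨hq.2, by rw [𝒢.src_inv]; exact c.tgt_mem _ (c.chart.map_target hq.1)⟩
  have hcont := (c.contMDiffOn_mul_point hγ contDiff_snd.contDiffOn hdom).continuousOn
  have hV := hcont.isOpen_inter_preimage (c.chart.open_target.prod c.isOpen_slice)
    e.chart.open_source
  have hΦ := contDiffOn_transition c e (hγ.mono inter_subset_left) contDiff_snd.contDiffOn
    fun q hq => ⟨hdom q hq.1, hq.2⟩
  have hmem : (c.chart a, (c.chart a).2) ∈ c.chart.target ×ˢ c.slice ∩
      (fun q : (EM × F) × F => 𝒢.mul (𝒢.inv (c.chart.symm q.1))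
        (c.point (𝒢.src (𝒢.inv (c.chart.symm q.1))) q.2)) ⁻¹' e.chart.source := by
    have h := coord_mem_transitionDomain_inv ha he
    refine ⟨⟨hw, c.coord_mem ha⟩, ?_⟩
    simp only [mem_preimage, c.chart.left_inv ha]
    exact h.2
  have hfd : ContDiffAt ℝ ∞ (fun w : EM × F =>
      fderiv ℝ (transition (𝒢.inv (c.chart.symm w)) c e) w.2) (c.chart a) :=
    ContDiffAt.fderiv (f := fun w : EM × F => transition (𝒢.inv (c.chart.symm w)) c e)
      (g := Prod.snd) (n := ∞) (m := ∞) (hΦ.contDiffAt (hV.mem_nhds hmem)) contDiffAt_snd le_rfl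
  have hdet : ContDiffAt ℝ ∞ (fun w : EM × F =>
      |(fderiv ℝ (transition (𝒢.inv (c.chart.symm w)) c e) w.2).det|) (c.chart a) := by
    refine ContDiffAt.abs (ContDiffAt.comp (g := fun A : F →L[ℝ] F => A.det) (c.chart a)
      ContinuousLinearMap.contDiff_det.contDiffAt hfd) ?_
    simp only [c.chart.left_inv ha]
    exact det_fderiv_transition_ne_zero (coord_mem_transitionDomain_inv ha he)
  have hch := c.contMDiffOn_chart.contMDiffAt (c.chart.open_source.mem_nhds ha)
  refine (ContMDiffAt.comp a hdet.contMDiffAt hch).congr_of_eventuallyEq ?_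
  filter_upwards [c.chart.open_source.mem_nhds ha] with b hb
  simp only [Function.comp_apply, c.chart.left_inv hb]
  rfl

end TgtChart

/-! ### An invariant density -/

/-- A smooth positive density on the fibres of the target map that is invariant under left
translations, in terms of charts. -/
structure InvariantDensity (𝒢 : LieGroupoid EM EG M G) (F : Type*) [NormedAddCommGroup F]
    [NormedSpace ℝ F] where
  density : 𝒢.TgtChart F → G → ℝ
  pos : ∀ c, ∀ a ∈ c.chart.source, 0 < density c a
  contMDiffOn : ∀ c, ContMDiffOn 𝓘(ℝ, EG) 𝓘(ℝ, ℝ) ∞ (density c) c.chart.source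
  eq_mul : ∀ (c c' : 𝒢.TgtChart F) (g a : G), 𝒢.src g = 𝒢.tgt a → a ∈ c.chart.source →
    𝒢.mul g a ∈ c'.chart.source → density c a =
      |(fderiv ℝ (TgtChart.transition g c c') (c.coord a)).det| * density c' (𝒢.mul g a)

/-- Densities at the identities, chosen by means of charts and patched together by a partition of
unity, extend to an invariant density. -/
theorem nonempty_invariantDensity [FiniteDimensional ℝ EM] [FiniteDimensional ℝ F]
    [IsManifold 𝓘(ℝ, EM) ∞ M] [T2Space M] [SigmaCompactSpace M]
    (hF : ∀ a : G, ∃ c : 𝒢.TgtChart F, a ∈ c.chart.source) :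
    Nonempty (𝒢.InvariantDensity F) := by
  choose e he using fun m => hF (𝒢.one m)
  obtain ⟨σ, hσ⟩ := SmoothPartitionOfUnity.exists_isSubordinate 𝓘(ℝ, EM) (s := univ)
    isClosed_univ (fun m => 𝒢.one ⁻¹' (e m).chart.source)
    (fun m => (e m).chart.open_source.preimage 𝒢.contMDiff_one.continuous)
    fun m _ => mem_iUnion.2 ⟨m, he m⟩
  have hσ' : ∀ j m, σ j m ≠ 0 → 𝒢.one m ∈ (e j).chart.source := fun j m h =>
    hσ j (subset_tsupport _ h)
  have hfin : ∀ c a, (Function.support fun j => σ j (𝒢.src a) *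
      TgtChart.jacobian c (e j) a).Finite := fun c a =>
    (σ.locallyFinite.point_finite (𝒢.src a)).subset fun j hj => left_ne_zero_of_mul hj
  refine ⟨⟨fun c a => ∑ᶠ j, σ j (𝒢.src a) * TgtChart.jacobian c (e j) a, ?_, ?_, ?_⟩⟩
  · intro c a ha
    obtain ⟨j, hj⟩ := σ.exists_pos_of_mem (mem_univ (𝒢.src a))
    refine finsum_pos (fun i => mul_nonneg (σ.nonneg _ _) (abs_nonneg _)) ⟨j, ?_⟩ (hfin c a)
    exact mul_pos hj (TgtChart.jacobian_pos ha (hσ' j _ hj.ne'))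
  · intro c a ha
    refine (contMDiffAt_finsum ?_ fun j => ?_).contMDiffWithinAt
    · exact (σ.locallyFinite.preimage_continuous 𝒢.continuous_src).subset
        fun j b hb => left_ne_zero_of_mul hb
    · by_cases h : 𝒢.src a ∈ tsupport (σ j)
      · exact ((σ j).contMDiff.comp 𝒢.isSubmersion_src.contMDiff a).mul
          (TgtChart.contMDiffAt_jacobian ha (hσ j h))
      · refine contMDiffAt_const (c := (0 : ℝ)).congr_of_eventuallyEq ?_
        filter_upwards [𝒢.continuous_src.continuousAt
          ((isClosed_tsupport (σ j)).isOpen_compl.mem_nhds h)] with b hb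
        rw [image_eq_zero_of_notMem_tsupport hb, zero_mul]
  · intro c c' g a hga ha hga'
    rw [mul_finsum' _ _ (hfin c' _)]
    refine finsum_congr fun j => ?_
    rw [𝒢.src_mul _ _ hga]
    by_cases h : σ j (𝒢.src a) = 0
    · simp [h]
    · rw [TgtChart.jacobian_eq_mul hga ha hga' (hσ' j _ h)]
      ring

end LieGroupoid

/-! ### Integration over the fibres of a chart -/

/-- Integration over one of two variables preserves smoothness. -/
theorem ContDiff.integral_of_hasCompactSupport {P F : Type*} [NormedAddCommGroup P]
    [NormedSpace ℝ P] [FiniteDimensional ℝ P] [NormedAddCommGroup F] [NormedSpace ℝ F]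
    [FiniteDimensional ℝ F]
    [MeasurableSpace F] [BorelSpace F] {μ : MeasureTheory.Measure F}
    [MeasureTheory.IsFiniteMeasureOnCompacts μ] {H : P × F → ℝ} (h1 : ContDiff ℝ ∞ H)
    (h2 : HasCompactSupport H) : ContDiff ℝ ∞ (fun x => ∫ y, H (x, y) ∂μ) := by
  obtain ⟨R, hR⟩ := (h2.isCompact.image continuous_snd).isBounded.subset_closedBall (0 : F)
  let ρ : ContDiffBump (0 : F) := ⟨max R 1, max R 1 + 1, by positivity, by simp⟩
  have hΛ : WeaklySmooth (univ : Set ℝ) (fun _ (g : F → ℝ) => ∫ y, ρ y * g (id y) ∂μ) := by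
    refine WeaklySmooth.of_integral (fun _ => μ) ρ id (fun _ _ => contDiffOn_const)
      (fun _ _ g hg => ?_) (fun _ _ => ?_)
    · exact (ρ.continuous.mul (hg.1 ()).continuous).aestronglyMeasurable
    · exact ρ.continuous.integrable_of_hasCompactSupport ρ.hasCompactSupport
  have h3 := hΛ.contDiffOn_slice isOpen_univ h1 h2
  rw [univ_prod_univ, contDiffOn_univ] at h3
  have h4 := h3.comp (contDiff_prodMk_left (0 : ℝ))
  convert h4 using 1
  ext x
  refine MeasureTheory.integral_congr_ae (Eventually.of_forall fun y => ?_)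
  by_cases hy : H (x, y) = 0
  · simp [hy]
  · have : y ∈ Metric.closedBall (0 : F) (max R 1) :=
      Metric.closedBall_subset_closedBall (le_max_left _ _)
        (hR ⟨(x, y), subset_tsupport _ hy, rfl⟩)
    simp [ρ.one_of_mem_closedBall this]

namespace LieGroupoid

open MeasureTheory

variable {EM EG M G : Type*}
  [NormedAddCommGroup EM] [NormedSpace ℝ EM] [TopologicalSpace M] [ChartedSpace EM M]
  [NormedAddCommGroup EG] [NormedSpace ℝ EG] [TopologicalSpace G] [ChartedSpace EG G]
  {F : Type*} [NormedAddCommGroup F] [NormedSpace ℝ F] [FiniteDimensional ℝ F]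
  [MeasureSpace F] [BorelSpace F] [(volume : Measure F).IsAddHaarMeasure]
  {𝒢 : LieGroupoid EM EG M G}

namespace TgtChart

variable [MeasurableSpace G]

/-- Lebesgue measure on the part of a fibre that lies in a chart. -/
noncomputable def fibreMeasure (c : 𝒢.TgtChart F) (m : M) : Measure G :=
  (volume.restrict (c.fibreDomain m)).map (c.point m)

variable [BorelSpace G]

omit [FiniteDimensional ℝ F] [(volume : Measure F).IsAddHaarMeasure] in
theorem aemeasurable_point (c : 𝒢.TgtChart F) (m : M) :
    AEMeasurable (c.point m) (volume.restrict (c.fibreDomain m)) :=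
  (c.continuousOn_point m).aemeasurable (c.isOpen_fibreDomain m).measurableSet

omit [FiniteDimensional ℝ F] [(volume : Measure F).IsAddHaarMeasure] in
theorem lintegral_fibreMeasure (c : 𝒢.TgtChart F) (m : M) {h : G → ENNReal} (hh : Measurable h) :
    ∫⁻ a, h a ∂(c.fibreMeasure m) = ∫⁻ y in c.fibreDomain m, h (c.point m y) :=
  lintegral_map' hh.aemeasurable (c.aemeasurable_point m)

/-- The integrals over the fibres of a smooth function with compact support in a chart. -/
theorem integrable_and_contMDiff_fibreMeasure [FiniteDimensional ℝ EM] [T2Space G] [T2Space M]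
    (c : 𝒢.TgtChart F) {ψ : G → ℝ}
    (hψ : ContMDiff 𝓘(ℝ, EG) 𝓘(ℝ, ℝ) ∞ ψ) (hψc : HasCompactSupport ψ)
    (hψs : tsupport ψ ⊆ c.chart.source) :
    (∀ m, Integrable ψ (c.fibreMeasure m)) ∧
      ContMDiff 𝓘(ℝ, EM) 𝓘(ℝ, ℝ) ∞ (fun m => ∫ a, ψ a ∂(c.fibreMeasure m)) := by
  classical
  -- the function in the coordinates of the chart, extended by zero
  let H : EM × F → ℝ := c.chart.target.indicator fun w => ψ (c.chart.symm w)
  have hC : IsCompact (c.chart '' tsupport ψ) :=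
    hψc.isCompact.image_of_continuousOn (c.chart.continuousOn.mono hψs)
  have hHsupp : tsupport H ⊆ c.chart '' tsupport ψ := by
    refine closure_minimal (fun w hw => ?_) hC.isClosed
    have hw1 : w ∈ c.chart.target := mem_of_indicator_ne_zero hw
    have hw2 : ψ (c.chart.symm w) ≠ 0 := by simpa [H, hw1] using hw
    exact ⟨c.chart.symm w, subset_tsupport _ hw2, c.chart.right_inv hw1⟩
  have hHc : HasCompactSupport H := hC.of_isClosed_subset (isClosed_tsupport H) hHsupp
  have hHs : ContDiff ℝ ∞ H := by
    rw [← contMDiff_iff_contDiff]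
    refine contMDiff_of_tsupport fun w hw => ContDiffAt.contMDiffAt ?_
    obtain ⟨a, ha, rfl⟩ := hHsupp hw
    have hw1 : c.chart a ∈ c.chart.target := c.chart.map_source (hψs ha)
    have h1 : ContDiffOn ℝ ∞ (fun w => ψ (c.chart.symm w)) c.chart.target :=
      contMDiffOn_iff_contDiffOn.1 (hψ.comp_contMDiffOn c.contMDiffOn_chart_symm)
    refine (h1.contDiffAt (c.chart.open_target.mem_nhds hw1)).congr_of_eventuallyEq ?_
    filter_upwards [c.chart.open_target.mem_nhds hw1] with w hw
    simp [H, hw]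
  have hHeq : ∀ m ∈ c.base.source, (c.fibreDomain m).indicator (fun y => ψ (c.point m y)) =
      fun y => H (c.base m, y) := fun m hm => by
    ext y
    by_cases hy : y ∈ c.slice
    · rw [indicator_of_mem (show y ∈ c.fibreDomain m from ⟨hy, hm⟩)]
      simp only [H]
      rw [indicator_of_mem (c.mem_target hm hy)]
      rfl
    · rw [indicator_of_notMem fun h => hy h.1]
      simp only [H]
      rw [indicator_of_notMem fun h => hy (c.target_eq ▸ h : _ ∈ c.base.target ×ˢ c.slice).2]
  have hmeas : ∀ m, AEStronglyMeasurable ψ (c.fibreMeasure m) := fun m =>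
    hψ.continuous.aestronglyMeasurable
  have hempty : ∀ m, m ∉ c.base.source → c.fibreMeasure m = 0 := fun m hm => by
    have : c.fibreDomain m = ∅ := eq_empty_of_forall_notMem fun y hy => hm hy.2
    simp [fibreMeasure, this]
  refine ⟨fun m => ?_, ?_⟩
  · by_cases hm : m ∈ c.base.source
    · rw [fibreMeasure, integrable_map_measure (hmeas m) (c.aemeasurable_point m),
        ← IntegrableOn, ← integrable_indicator_iff (c.isOpen_fibreDomain m).measurableSet]
      change Integrable ((c.fibreDomain m).indicator (fun y => ψ (c.point m y))) volume
      rw [hHeq m hm]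
      refine (hHs.continuous.comp (Continuous.prodMk_right _)).integrable_of_hasCompactSupport ?_
      refine (hHc.isCompact.image continuous_snd).of_isClosed_subset (isClosed_tsupport _) ?_
      exact closure_minimal (fun y hy => ⟨(c.base m, y), subset_tsupport _ hy, rfl⟩)
        (hHc.isCompact.image continuous_snd).isClosed
    · rw [hempty m hm]
      exact integrable_zero_measure
  · have hJ : ContDiff ℝ ∞ (fun x => ∫ y, H (x, y)) := hHs.integral_of_hasCompactSupport hHc
    have hJeq : ∀ m ∈ c.base.source,
        ∫ a, ψ a ∂(c.fibreMeasure m) = ∫ y, H (c.base m, y) := fun m hm => by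
      rw [fibreMeasure, integral_map (c.aemeasurable_point m) (hmeas m),
        ← integral_indicator (c.isOpen_fibreDomain m).measurableSet, hHeq m hm]
    have hT : IsCompact (𝒢.tgt '' tsupport ψ) := hψc.isCompact.image 𝒢.continuous_tgt
    refine contMDiff_of_tsupport fun m hm => ?_
    have hm' : m ∈ 𝒢.tgt '' tsupport ψ := by
      refine closure_minimal (fun m hm => ?_) hT.isClosed hm
      by_contra hcon
      refine hm ?_
      by_cases hmb : m ∈ c.base.source
      · change ∫ a, ψ a ∂(c.fibreMeasure m) = 0
        rw [fibreMeasure, integral_map (c.aemeasurable_point m) (hmeas m)]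
        refine setIntegral_eq_zero_of_forall_eq_zero fun y hy => ?_
        refine image_eq_zero_of_notMem_tsupport fun h => hcon ⟨_, h, c.tgt_point hy.2 hy.1⟩
      · change ∫ a, ψ a ∂(c.fibreMeasure m) = 0
        rw [hempty m hmb, integral_zero_measure]
    have hmb : m ∈ c.base.source := by
      obtain ⟨a, ha, rfl⟩ := hm'
      exact c.tgt_mem a (hψs ha)
    have hb := c.contMDiffOn_base.contMDiffAt (c.base.open_source.mem_nhds hmb)
    refine (ContMDiffAt.comp m hJ.contMDiff.contMDiffAt hb).congr_of_eventuallyEq ?_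
    filter_upwards [c.base.open_source.mem_nhds hmb] with m' hm'
    exact hJeq m' hm'

end TgtChart

/-! ### The measures of an invariant density -/

/-- Left translation by `g` on the fibre over the source of `g`, extended by the identity to the
other arrows. -/
noncomputable def translate (𝒢 : LieGroupoid EM EG M G) (g : G) (a : G) : G :=
  open Classical in if 𝒢.tgt a = 𝒢.src g then 𝒢.mul g a else a

theorem translate_eq {g a : G} (h : 𝒢.tgt a = 𝒢.src g) : 𝒢.translate g a = 𝒢.mul g a :=
  if_pos h

theorem measurable_translate [T1Space M] [MeasurableSpace G] [BorelSpace G] (g : G) :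
    Measurable (𝒢.translate g) := by
  classical
  have h1 : ContinuousOn (𝒢.mul g) {a | 𝒢.tgt a = 𝒢.src g} := by
    have := 𝒢.contMDiffOn_mul.continuousOn.comp (f := fun a => (g, a))
      (s := {a | 𝒢.tgt a = 𝒢.src g}) (Continuous.prodMk_right g).continuousOn
      fun a (ha : 𝒢.tgt a = 𝒢.src g) => ha.symm
    exact this
  have h2 : IsClosed {a | 𝒢.tgt a = 𝒢.src g} := isClosed_singleton.preimage 𝒢.continuous_tgt
  have h3 : 𝒢.translate g = {a | 𝒢.tgt a = 𝒢.src g}.piecewise (𝒢.mul g) id := by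
    ext a
    simp only [translate, piecewise, mem_ofPred_eq, id]
  rw [h3]
  exact h1.measurable_piecewise continuousOn_id h2.measurableSet

namespace InvariantDensity

open TgtChart

variable (D : 𝒢.InvariantDensity F) {ι : Type*} (c : ι → 𝒢.TgtChart F)
  (ρ : SmoothPartitionOfUnity ι 𝓘(ℝ, EG) G)

/-- The density in the `i`-th chart, cut off by the `i`-th function of the partition of unity. -/
noncomputable def weight (i : ι) (a : G) : ℝ := ρ i a * D.density (c i) a

/-- The measures on the fibres given by an invariant density, as measures on `G`. -/
noncomputable def fibreMeasure [MeasurableSpace G] (m : M) : Measure G :=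
  Measure.sum fun i => ((c i).fibreMeasure m).withDensity
    fun a => ENNReal.ofReal (D.weight c ρ i a)

variable {D c ρ} (hρ : ρ.IsSubordinate fun i => (c i).chart.source)
include hρ

omit [FiniteDimensional ℝ F] [MeasureSpace F] [BorelSpace F]
  [(volume : Measure F).IsAddHaarMeasure] in
theorem weight_nonneg (i : ι) (a : G) : 0 ≤ D.weight c ρ i a := by
  rw [weight]
  by_cases h : ρ i a = 0
  · simp [h]
  · exact mul_nonneg (ρ.nonneg _ _) (D.pos _ _ (hρ i (subset_tsupport _ h))).le

omit [FiniteDimensional ℝ F] [MeasureSpace F] [BorelSpace F]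
  [(volume : Measure F).IsAddHaarMeasure] in
theorem contMDiff_weight (i : ι) : ContMDiff 𝓘(ℝ, EG) 𝓘(ℝ, ℝ) ∞ (D.weight c ρ i) := by
  refine contMDiff_of_tsupport fun a ha => ?_
  have ha' : a ∈ (c i).chart.source := hρ i (tsupport_mul_subset_left ha)
  exact ((ρ i).contMDiff a).mul ((D.contMDiffOn _).contMDiffAt
    ((c i).chart.open_source.mem_nhds ha'))

variable [MeasurableSpace G] [BorelSpace G]

omit [FiniteDimensional ℝ F] [MeasureSpace F] [BorelSpace F]
  [(volume : Measure F).IsAddHaarMeasure] in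
theorem measurable_weight (i : ι) :
    Measurable fun a => ENNReal.ofReal (D.weight c ρ i a) :=
  (contMDiff_weight hρ i).continuous.measurable.ennreal_ofReal

omit [FiniteDimensional ℝ F] [(volume : Measure F).IsAddHaarMeasure] in
theorem lintegral_fibreMeasure (m : M) {h : G → ENNReal} (hh : Measurable h) :
    ∫⁻ a, h a ∂(D.fibreMeasure c ρ m) = ∑' i, ∫⁻ y in (c i).fibreDomain m,
      ENNReal.ofReal (D.weight c ρ i ((c i).point m y)) * h ((c i).point m y) := by
  rw [fibreMeasure, lintegral_sum_measure]
  refine tsum_congr fun i => ?_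
  rw [lintegral_withDensity_eq_lintegral_mul _ (measurable_weight hρ i) hh,
    TgtChart.lintegral_fibreMeasure _ _ ((measurable_weight hρ i).mul hh)]
  rfl

omit hρ [MeasurableSpace G] [BorelSpace G] in
theorem tsum_ofReal_partition (a : G) : ∑' k, ENNReal.ofReal (ρ k a) = 1 := by
  have hfin : (Function.support fun k => ρ k a).Finite := ρ.locallyFinite.point_finite a
  rw [← ENNReal.ofReal_tsum_of_nonneg (fun k => ρ.nonneg k a)
    (summable_of_hasFiniteSupport hfin), tsum_eq_finsum hfin, ρ.sum_eq_one (mem_univ a),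
    ENNReal.ofReal_one]

omit [FiniteDimensional ℝ F] [(volume : Measure F).IsAddHaarMeasure] [MeasurableSpace G]
  [BorelSpace G] in
/-- A part of an integral over a fibre, decomposed by the chart in which the translates of the
points lie. -/
theorem setLIntegral_eq_tsum [Countable ι] (g : G) (c' : 𝒢.TgtChart F) {H : F → ENNReal}
    (hH : AEMeasurable H (volume.restrict (c'.fibreDomain (𝒢.src g)))) :
    ∫⁻ y in c'.fibreDomain (𝒢.src g), H y = ∑' k, ∫⁻ y in transitionDomain g c' (c k),
      ENNReal.ofReal (ρ k (𝒢.mul g (c'.point (𝒢.src g) y))) * H y := by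
  have h1 : ∀ y, H y =
      ∑' k, ENNReal.ofReal (ρ k (𝒢.mul g (c'.point (𝒢.src g) y))) * H y := fun y => by
    rw [ENNReal.tsum_mul_right, tsum_ofReal_partition, _root_.one_mul]
  have hO := (c'.isOpen_fibreDomain (𝒢.src g)).measurableSet
  rw [lintegral_congr h1, lintegral_tsum]
  · refine tsum_congr fun k => ?_
    rw [← lintegral_indicator hO, ← lintegral_indicator
      (isOpen_transitionDomain g c' (c k)).measurableSet]
    refine lintegral_congr fun y => ?_
    by_cases h2 : y ∈ transitionDomain g c' (c k)
    · rw [indicator_of_mem h2, indicator_of_mem h2.1]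
    · rw [indicator_of_notMem h2]
      by_cases h3 : y ∈ c'.fibreDomain (𝒢.src g)
      · rw [indicator_of_mem h3]
        have : ρ k (𝒢.mul g (c'.point (𝒢.src g) y)) = 0 := by
          by_contra h4
          exact h2 ⟨h3, hρ k (subset_tsupport _ h4)⟩
        simp [this]
      · rw [indicator_of_notMem h3]
  · intro k
    exact (((ρ k).contMDiff.continuous.comp_continuousOn
      (continuousOn_mul_point g c')).aemeasurable hO).ennreal_ofReal.mul hH

omit hρ [MeasurableSpace G] [BorelSpace G] in
/-- The change of variables formula for a left translation in two charts. -/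
theorem setLIntegral_transition (g : G) (i k : ι) (h : G → ENNReal) :
    ∫⁻ y in transitionDomain g (c i) (c k),
      ENNReal.ofReal (ρ k (𝒢.mul g ((c i).point (𝒢.src g) y))) *
        (ENNReal.ofReal (D.weight c ρ i ((c i).point (𝒢.src g) y)) *
          h (𝒢.mul g ((c i).point (𝒢.src g) y))) =
    ∫⁻ z in transitionDomain (𝒢.inv g) (c k) (c i),
      ENNReal.ofReal (ρ i (𝒢.mul (𝒢.inv g) ((c k).point (𝒢.tgt g) z))) *
        (ENNReal.ofReal (D.weight c ρ k ((c k).point (𝒢.tgt g) z)) *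
          h ((c k).point (𝒢.tgt g) z)) := by
  have hO := (isOpen_transitionDomain g (c i) (c k)).measurableSet
  rw [← image_transition, lintegral_image_eq_lintegral_abs_det_fderiv_mul volume hO
    (fun y hy => (differentiableAt_transition hy).hasFDerivAt.hasFDerivWithinAt)
    (injOn_transition g (c i) (c k))]
  refine setLIntegral_congr_fun hO fun y hy => ?_
  have h0 := src_eq_tgt_point hy.1
  have hmem := (c i).point_mem hy.1.2 hy.1.1
  simp only [point_transition hy, 𝒢.inv_mul_cancel_left _ _ h0]
  have h1 := D.eq_mul (c i) (c k) g _ h0 hmem hy.2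
  rw [(c i).coord_point hy.1.2 hy.1.1] at h1
  rw [weight, h1, weight, ENNReal.ofReal_mul (ρ.nonneg _ _), ENNReal.ofReal_mul (abs_nonneg _),
    ENNReal.ofReal_mul (ρ.nonneg _ _)]
  ring

/-- The measures of an invariant density are invariant under left translations. -/
theorem map_translate_fibreMeasure [T1Space M] [Countable ι] (g : G) :
    (D.fibreMeasure c ρ (𝒢.src g)).map (𝒢.translate g) = D.fibreMeasure c ρ (𝒢.tgt g) := by
  refine Measure.ext_of_lintegral _ fun h hh => ?_
  rw [lintegral_map hh (measurable_translate g),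
    lintegral_fibreMeasure hρ (h := fun a => h (𝒢.translate g a)) _
      (hh.comp (measurable_translate g)), lintegral_fibreMeasure hρ _ hh]
  have hpt : ∀ i m, AEMeasurable (fun y => ENNReal.ofReal (D.weight c ρ i ((c i).point m y)))
      (volume.restrict ((c i).fibreDomain m)) := fun i m =>
    (measurable_weight hρ i).comp_aemeasurable ((c i).aemeasurable_point m)
  have h1 : ∀ i, ∫⁻ y in (c i).fibreDomain (𝒢.src g),
      ENNReal.ofReal (D.weight c ρ i ((c i).point (𝒢.src g) y)) *
        h (𝒢.translate g ((c i).point (𝒢.src g) y)) =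
      ∑' k, ∫⁻ y in transitionDomain g (c i) (c k),
        ENNReal.ofReal (ρ k (𝒢.mul g ((c i).point (𝒢.src g) y))) *
          (ENNReal.ofReal (D.weight c ρ i ((c i).point (𝒢.src g) y)) *
            h (𝒢.mul g ((c i).point (𝒢.src g) y))) := fun i => by
    have hO := ((c i).isOpen_fibreDomain (𝒢.src g)).measurableSet
    rw [← setLIntegral_eq_tsum hρ]
    · refine setLIntegral_congr_fun hO fun y hy => ?_
      simp only [translate_eq ((c i).tgt_point hy.2 hy.1)]
    · exact (hpt i _).mul (hh.comp_aemeasurable ((continuousOn_mul_point g (c i)).aemeasurable hO))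
  have h2 : ∀ k, ∫⁻ z in (c k).fibreDomain (𝒢.tgt g),
      ENNReal.ofReal (D.weight c ρ k ((c k).point (𝒢.tgt g) z)) * h ((c k).point (𝒢.tgt g) z) =
      ∑' i, ∫⁻ z in transitionDomain (𝒢.inv g) (c k) (c i),
        ENNReal.ofReal (ρ i (𝒢.mul (𝒢.inv g) ((c k).point (𝒢.tgt g) z))) *
          (ENNReal.ofReal (D.weight c ρ k ((c k).point (𝒢.tgt g) z)) *
            h ((c k).point (𝒢.tgt g) z)) := fun k => by
    have := setLIntegral_eq_tsum hρ (𝒢.inv g) (c k)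
      (H := fun z => ENNReal.ofReal (D.weight c ρ k ((c k).point (𝒢.tgt g) z)) *
        h ((c k).point (𝒢.tgt g) z))
    simp only [𝒢.src_inv] at this
    exact this ((hpt k _).mul (hh.comp_aemeasurable ((c k).aemeasurable_point _)))
  simp only [h1, h2, setLIntegral_transition]
  exact ENNReal.tsum_comm

omit [FiniteDimensional ℝ F] [(volume : Measure F).IsAddHaarMeasure] hρ in
theorem ae_tgt_eq [T1Space M] (m : M) : ∀ᵐ a ∂(D.fibreMeasure c ρ m), 𝒢.tgt a = m := by
  have hms : MeasurableSet {a | 𝒢.tgt a = m} :=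
    (isClosed_singleton.preimage 𝒢.continuous_tgt).measurableSet
  rw [fibreMeasure, Measure.ae_sum_iff' hms]
  intro i
  have h : ∀ᵐ a ∂((c i).fibreMeasure m), 𝒢.tgt a = m := by
    rw [TgtChart.fibreMeasure, ae_map_iff ((c i).aemeasurable_point m) hms]
    refine (ae_restrict_mem ((c i).isOpen_fibreDomain m).measurableSet).mono fun y hy => ?_
    exact (c i).tgt_point hy.2 hy.1
  exact (withDensity_absolutelyContinuous _ _).ae_le h

/-- The integrals of a compactly supported smooth function with respect to the measures of an
invariant density exist and form a smooth function. -/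
theorem integrable_and_contMDiff [Countable ι] [FiniteDimensional ℝ EM] [T2Space G] [T2Space M]
    {φ : G → ℝ} (hφ : ContMDiff 𝓘(ℝ, EG) 𝓘(ℝ, ℝ) ∞ φ) (hφc : HasCompactSupport φ) :
    (∀ m, Integrable φ (D.fibreMeasure c ρ m)) ∧
      ContMDiff 𝓘(ℝ, EM) 𝓘(ℝ, ℝ) ∞ (fun m => ∫ a, φ a ∂(D.fibreMeasure c ρ m)) := by
  set ψ : ι → G → ℝ := fun i a => D.weight c ρ i a * φ a with hψ
  have hψs : ∀ i, tsupport (ψ i) ⊆ (c i).chart.source := fun i a ha =>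
    hρ i (tsupport_mul_subset_left (tsupport_mul_subset_left ha))
  have hpiece := fun i => (c i).integrable_and_contMDiff_fibreMeasure
    ((contMDiff_weight (D := D) hρ i).mul hφ) hφc.mul_left (hψs i)
  have hfin : {i | (Function.support (ρ i) ∩ tsupport φ).Nonempty}.Finite :=
    ρ.locallyFinite.finite_nonempty_inter_compact hφc.isCompact
  have hzero : ∀ i, i ∉ hfin.toFinset → ψ i = 0 := fun i hi => by
    ext a
    simp only [hψ, Pi.zero_apply, weight]
    by_contra hne
    rw [hfin.mem_toFinset] at hi
    exact hi ⟨a, left_ne_zero_of_mul (left_ne_zero_of_mul hne),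
      subset_tsupport _ (right_ne_zero_of_mul hne)⟩
  have hsmul : ∀ i a, (ENNReal.ofReal (D.weight c ρ i a)).toReal • φ a = ψ i a := fun i a => by
    rw [ENNReal.toReal_ofReal (weight_nonneg hρ i a), smul_eq_mul]
  have hint : ∀ i m, Integrable φ (((c i).fibreMeasure m).withDensity
      fun a => ENNReal.ofReal (D.weight c ρ i a)) := fun i m => by
    rw [integrable_withDensity_iff_integrable_smul' (measurable_weight hρ i)
      (Eventually.of_forall fun a => ENNReal.ofReal_lt_top)]
    simp only [hsmul]
    exact (hpiece i).1 m
  have heq : ∀ i m (f : G → ℝ), ∫ a, f a ∂(((c i).fibreMeasure m).withDensity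
      fun a => ENNReal.ofReal (D.weight c ρ i a)) =
      ∫ a, D.weight c ρ i a * f a ∂((c i).fibreMeasure m) := fun i m f => by
    rw [integral_withDensity_eq_integral_toReal_smul (measurable_weight hρ i)
      (Eventually.of_forall fun a => ENNReal.ofReal_lt_top)]
    refine integral_congr_ae (Eventually.of_forall fun a => ?_)
    simp only [ENNReal.toReal_ofReal (weight_nonneg hρ i a), smul_eq_mul]
  have hI : ∀ m, Integrable φ (D.fibreMeasure c ρ m) := fun m => by
    refine integrable_sum_measure (fun i => hint i m) (summable_of_ne_finset_zero
      (s := hfin.toFinset) fun i hi => ?_)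
    rw [heq]
    have h1 : ∀ a, D.weight c ρ i a * ‖φ a‖ = 0 := fun a => by
      have h2 := congrFun (hzero i hi) a
      simp only [hψ, Pi.zero_apply, mul_eq_zero] at h2
      rcases h2 with h2 | h2 <;> simp [h2]
    simp only [h1, integral_zero]
  refine ⟨hI, ?_⟩
  have hsum : ∀ m, ∫ a, φ a ∂(D.fibreMeasure c ρ m) =
      ∑ i ∈ hfin.toFinset, ∫ a, ψ i a ∂((c i).fibreMeasure m) := fun m => by
    rw [fibreMeasure, integral_sum_measure (hI m), tsum_eq_sum (s := hfin.toFinset)]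
    · exact Finset.sum_congr rfl fun i _ => heq i m φ
    · intro i hi
      rw [heq]
      change ∫ a, ψ i a ∂((c i).fibreMeasure m) = 0
      rw [hzero i hi]
      simp
  simp only [hsum]
  exact contMDiff_finsetSum fun i _ => (hpiece i).2

omit [FiniteDimensional ℝ F] in
/-- A continuous function that is positive somewhere on a fibre has a positive part with nonzero
integral over the fibre. -/
theorem lintegral_pos {m : M} {φ : G → ℝ} (hφ : Continuous φ) {a : G}
    (ha : 𝒢.tgt a = m) (hφa : 0 < φ a) :
    0 < ∫⁻ a, ENNReal.ofReal (φ a) ∂(D.fibreMeasure c ρ m) := by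
  subst ha
  obtain ⟨i, hi⟩ := ρ.exists_pos_of_mem (mem_univ a)
  have ha : a ∈ (c i).chart.source := hρ i (subset_tsupport _ hi.ne')
  rw [lintegral_fibreMeasure hρ _ hφ.measurable.ennreal_ofReal]
  refine lt_of_lt_of_le ?_ (ENNReal.le_tsum i)
  have hO : IsOpen ((c i).fibreDomain (𝒢.tgt a) ∩
      (c i).point (𝒢.tgt a) ⁻¹' {b | 0 < D.weight c ρ i b ∧ 0 < φ b}) :=
    ((c i).continuousOn_point _).isOpen_inter_preimage ((c i).isOpen_fibreDomain _)
      ((isOpen_lt continuous_const (contMDiff_weight hρ i).continuous).inter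
        (isOpen_lt continuous_const hφ))
  have hmem : (c i).coord a ∈ (c i).fibreDomain (𝒢.tgt a) ∩
      (c i).point (𝒢.tgt a) ⁻¹' {b | 0 < D.weight c ρ i b ∧ 0 < φ b} := by
    refine ⟨(c i).coord_mem_fibreDomain ha, ?_⟩
    rw [mem_preimage, (c i).point_coord ha]
    exact ⟨mul_pos hi (D.pos _ _ ha), hφa⟩
  have hmeas : AEMeasurable (fun y => ENNReal.ofReal (D.weight c ρ i ((c i).point (𝒢.tgt a) y)) *
      ENNReal.ofReal (φ ((c i).point (𝒢.tgt a) y)))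
      (volume.restrict ((c i).fibreDomain (𝒢.tgt a))) :=
    ((measurable_weight hρ i).mul hφ.measurable.ennreal_ofReal).comp_aemeasurable
      ((c i).aemeasurable_point _)
  rw [pos_iff_ne_zero, Ne, lintegral_eq_zero_iff' hmeas]
  intro h
  have h' := (ae_restrict_iff' ((c i).isOpen_fibreDomain _).measurableSet).1 h
  refine (hO.measure_pos volume ⟨_, hmem⟩).ne' (measure_mono_null ?_ (ae_iff.1 h'))
  refine fun y hy => mem_ofPred_eq.mpr fun hy' => ?_
  have h1 := hy' hy.1
  simp only [Pi.zero_apply, mul_eq_zero, ENNReal.ofReal_eq_zero] at h1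
  exact h1.elim (fun h => (hy.2.1.trans_le h).false) fun h => (hy.2.2.trans_le h).false

end InvariantDensity

end LieGroupoid

namespace LieGroupoid

variable {EM EG M G : Type*}
  [NormedAddCommGroup EM] [NormedSpace ℝ EM] [TopologicalSpace M] [ChartedSpace EM M]
  [NormedAddCommGroup EG] [NormedSpace ℝ EG] [TopologicalSpace G] [ChartedSpace EG G]

/-! ### Cutoff functions for a proper groupoid -/

/-- The saturation of a compact set under a proper groupoid is closed. -/
theorem IsProper.isClosed_saturation [T2Space M] {𝒢 : LieGroupoid EM EG M G} (h𝒢 : 𝒢.IsProper)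
    {X : Set M} (hX : IsCompact X) : IsClosed (𝒢.tgt '' (𝒢.src ⁻¹' X)) := by
  have h1 : IsClosed ((fun g => (𝒢.tgt g, 𝒢.src g)) '' (𝒢.src ⁻¹' X)) :=
    h𝒢.isClosedMap _ (hX.isClosed.preimage 𝒢.continuous_src)
  have : CompactSpace X := isCompact_iff_compactSpace.1 hX
  have h2 := isClosedMap_fst_of_compactSpace (X := M) (Y := X) _
    (h1.preimage (continuous_fst.prodMk (continuous_subtype_val.comp continuous_snd)))
  convert h2 using 1
  ext m
  constructor
  · rintro ⟨a, ha, rfl⟩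
    exact ⟨(𝒢.tgt a, ⟨𝒢.src a, ha⟩), ⟨a, ha, rfl⟩, rfl⟩
  · rintro ⟨⟨m, x⟩, ⟨a, ha, h⟩, rfl⟩
    exact ⟨a, ha, (Prod.mk.inj h).1⟩

/-- A proper groupoid has a nonnegative smooth function on its base that is positive somewhere on
every orbit, and whose support meets the orbits of the points of any compact set within a compact
set. -/
theorem IsProper.exists_cutoff [FiniteDimensional ℝ EM] [IsManifold 𝓘(ℝ, EM) ∞ M] [T2Space M]
    [SigmaCompactSpace M] {𝒢 : LieGroupoid EM EG M G} (h𝒢 : 𝒢.IsProper) :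
    ∃ χ : M → ℝ, ContMDiff 𝓘(ℝ, EM) 𝓘(ℝ, ℝ) ∞ χ ∧ (∀ m, 0 ≤ χ m) ∧
      (∀ m, ∃ a, 𝒢.tgt a = m ∧ 0 < χ (𝒢.src a)) ∧
      ∀ C, IsCompact C → ∃ C', IsCompact C' ∧
        ∀ a, 𝒢.tgt a ∈ C → χ (𝒢.src a) ≠ 0 → 𝒢.src a ∈ C' := by
  classical
  have : LocallyCompactSpace M := Manifold.locallyCompact_of_finiteDimensional 𝓘(ℝ, EM)
  set K : CompactExhaustion M := (default : CompactExhaustion M).shiftr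
  -- the exhaustion is shifted in order to start with the empty set
  have hK0 : K 0 = ∅ := rfl
  -- the `n`-th set consists of points near the `(n+1)`-st compact set whose orbit misses the `n`-th
  set O : Set M := ⋃ n, interior (K (n + 2)) \ 𝒢.tgt '' (𝒢.src ⁻¹' K n) with hO
  have hOo : IsOpen O := isOpen_iUnion fun n =>
    isOpen_interior.sdiff (h𝒢.isClosed_saturation (K.isCompact n))
  obtain ⟨χ, hχO, hχ, hχ0⟩ := hOo.exists_contMDiff_support_eq 𝓘(ℝ, EM) (n := ⊤)
  have hmem : ∀ m, χ m ≠ 0 ↔ m ∈ O := fun m => by rw [← hχO, Function.mem_support]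
  refine ⟨χ, hχ, hχ0, fun m => ?_, fun C hC => ?_⟩
  · have hex : ∃ n, ∃ a, 𝒢.tgt a = m ∧ 𝒢.src a ∈ K n := by
      obtain ⟨n, hn⟩ := K.exists_mem m
      exact ⟨n, 𝒢.one m, 𝒢.tgt_one m, by rwa [𝒢.src_one]⟩
    -- the first compact set of the exhaustion that the orbit of `m` meets
    obtain ⟨a, ha, haK⟩ := Nat.find_spec hex
    obtain ⟨n, hn⟩ : ∃ n, Nat.find hex = n + 1 := Nat.exists_eq_succ_of_ne_zero fun h0 => by
      rw [h0, hK0] at haK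
      exact haK
    refine ⟨a, ha, (hχ0 _).lt_of_ne' ((hmem _).2 (mem_iUnion.2 ⟨n, ?_, ?_⟩))⟩
    · rw [hn] at haK
      exact K.subset_interior_succ (n + 1) haK
    · rintro ⟨b, hb, hba⟩
      refine Nat.find_min hex (m := n) (by omega) ⟨𝒢.mul a b, ?_, ?_⟩
      · rw [𝒢.tgt_mul _ _ hba.symm, ha]
      · rw [𝒢.src_mul _ _ hba.symm]
        exact hb
  · obtain ⟨k, hk⟩ := K.exists_superset_of_isCompact hC
    refine ⟨K (k + 1), K.isCompact _, fun a ha h => ?_⟩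
    obtain ⟨n, hn1, hn2⟩ := mem_iUnion.1 ((hmem _).1 h)
    -- otherwise the inverse of `a` shows that the orbit of `s(a)` meets the `n`-th compact set
    have hnk : n < k := by
      by_contra hkn
      refine hn2 ⟨𝒢.inv a, ?_, 𝒢.tgt_inv a⟩
      rw [mem_preimage, 𝒢.src_inv]
      exact K.subset (not_lt.1 hkn) (hk ha)
    exact K.subset (by omega) (interior_subset hn1)

/-- The support of a cutoff function, pulled back along the source map, is proper over the base. -/
theorem IsProper.isCompact_tsupport_inter [T2Space M] [LocallyCompactSpace M]
    {𝒢 : LieGroupoid EM EG M G} (h𝒢 : 𝒢.IsProper) {χ : M → ℝ}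
    (hχ : ∀ C, IsCompact C → ∃ C', IsCompact C' ∧
      ∀ a, 𝒢.tgt a ∈ C → χ (𝒢.src a) ≠ 0 → 𝒢.src a ∈ C')
    {C : Set M} (hC : IsCompact C) :
    IsCompact (tsupport (fun a => χ (𝒢.src a)) ∩ 𝒢.tgt ⁻¹' C) := by
  obtain ⟨C₁, hC₁, hCC₁⟩ := exists_compact_superset hC
  obtain ⟨C', hC', h⟩ := hχ C₁ hC₁
  have hcl : IsClosed ((fun g => (𝒢.tgt g, 𝒢.src g)) ⁻¹' C₁ ×ˢ C') :=
    (hC₁.isClosed.prod hC'.isClosed).preimage h𝒢.continuous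
  refine (h𝒢.isCompact_preimage (hC₁.prod hC')).of_isClosed_subset
    ((isClosed_tsupport _).inter (hC.isClosed.preimage 𝒢.continuous_tgt)) fun a ⟨ha, haC⟩ => ?_
  have h1 := (isOpen_interior.preimage 𝒢.continuous_tgt).inter_closure ⟨hCC₁ haC, ha⟩
  refine closure_minimal ?_ hcl h1
  rintro b ⟨hb, hb'⟩
  exact ⟨interior_subset hb, h b (interior_subset hb) hb'⟩

open MeasureTheory

/-! ### Existence of Haar systems -/

section

variable {F : Type*} [NormedAddCommGroup F] [NormedSpace ℝ F] [FiniteDimensional ℝ F]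
  [MeasureSpace F] [BorelSpace F] [(volume : Measure F).IsAddHaarMeasure]
  {𝒢 : LieGroupoid EM EG M G} [FiniteDimensional ℝ EM] [T2Space M]
  [FiniteDimensional ℝ EG] [IsManifold 𝓘(ℝ, EG) ∞ G] [T2Space G] [SecondCountableTopology G]
  [MeasurableSpace G] [BorelSpace G]
  {D : 𝒢.InvariantDensity F} {ι : Type*} [Countable ι] {c : ι → 𝒢.TgtChart F}
  {ρ : SmoothPartitionOfUnity ι 𝓘(ℝ, EG) G}

/-- The integrals of a smooth function whose support is proper over the base exist and form a smooth
function. -/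
theorem InvariantDensity.integrable_and_contMDiff_of_isCompact
    (hρ : ρ.IsSubordinate fun i => (c i).chart.source) {φ : G → ℝ}
    (hφ : ContMDiff 𝓘(ℝ, EG) 𝓘(ℝ, ℝ) ∞ φ)
    (hφc : ∀ C, IsCompact C → IsCompact (tsupport φ ∩ 𝒢.tgt ⁻¹' C)) :
    (∀ m, Integrable φ (D.fibreMeasure c ρ m)) ∧
      ContMDiff 𝓘(ℝ, EM) 𝓘(ℝ, ℝ) ∞ (fun m => ∫ a, φ a ∂(D.fibreMeasure c ρ m)) := by
  have : LocallyCompactSpace M := Manifold.locallyCompact_of_finiteDimensional 𝓘(ℝ, EM)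
  have : LocallyCompactSpace G := Manifold.locallyCompact_of_finiteDimensional 𝓘(ℝ, EG)
  have key : ∀ m₀, ∃ C ∈ 𝓝 m₀, ∃ ψ : G → ℝ, ContMDiff 𝓘(ℝ, EG) 𝓘(ℝ, ℝ) ∞ ψ ∧
      HasCompactSupport ψ ∧ ∀ m ∈ C, φ =ᵐ[D.fibreMeasure c ρ m] ψ := fun m₀ => by
    -- over a compact neighbourhood, `φ` may be cut off by a function that is one on its support
    obtain ⟨C, hC, hm₀⟩ := exists_compact_mem_nhds m₀
    obtain ⟨L, hL, hCL⟩ := exists_compact_superset (hφc C hC)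
    obtain ⟨η, hη0, hη1, -⟩ := exists_contMDiffMap_zero_one_of_isClosed 𝓘(ℝ, EG) (n := ⊤)
      (s := (interior L)ᶜ) isOpen_interior.isClosed_compl (hφc C hC).isClosed
      (disjoint_compl_left_iff_subset.2 hCL)
    refine ⟨C, hm₀, fun a => η a * φ a, η.contMDiff.mul hφ,
      HasCompactSupport.intro hL fun a ha => ?_, fun m hm => ?_⟩
    · rw [hη0 fun h => ha (interior_subset h)]
      exact zero_mul _
    · filter_upwards [InvariantDensity.ae_tgt_eq (D := D) (c := c) (ρ := ρ) m] with a ha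
      by_cases h : a ∈ tsupport φ
      · rw [hη1 ⟨h, by rwa [mem_preimage, ha]⟩]
        exact (_root_.one_mul _).symm
      · rw [image_eq_zero_of_notMem_tsupport h, mul_zero]
  constructor
  · intro m
    obtain ⟨C, hC, ψ, hψ, hψc, h⟩ := key m
    exact ((integrable_and_contMDiff hρ hψ hψc).1 m).congr (h m (mem_of_mem_nhds hC)).symm
  · intro m
    obtain ⟨C, hC, ψ, hψ, hψc, h⟩ := key m
    refine ((integrable_and_contMDiff (D := D) hρ hψ hψc).2 m).congr_of_eventuallyEq ?_
    filter_upwards [hC] with m' hm'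
    exact integral_congr_ae (h m' hm')

omit [FiniteDimensional ℝ EM] [FiniteDimensional ℝ EG]
  [IsManifold 𝓘(ℝ, EG) ∞ G] [T2Space G] [SecondCountableTopology G] in
/-- A Haar system may be given by measures on `G` that are concentrated on the fibres. -/
theorem nonempty_haarSystem_of_measure [LocallyCompactSpace M] (ν : M → Measure G)
    (h_tgt : ∀ m, ∀ᵐ a ∂(ν m), 𝒢.tgt a = m)
    (h_smooth : ∀ f : G → ℝ, ContMDiff 𝓘(ℝ, EG) 𝓘(ℝ, ℝ) ∞ f → HasCompactSupport f →
      ContMDiff 𝓘(ℝ, EM) 𝓘(ℝ, ℝ) ∞ (fun m => ∫ a, f a ∂(ν m)))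
    (h_inv : ∀ g, (ν (𝒢.src g)).map (𝒢.translate g) = ν (𝒢.tgt g))
    {Z : Set G} (hZ : IsClosed Z) (h_mem : ∀ m, ∀ᵐ a ∂(ν m), a ∈ Z)
    (hZc : ∀ C, IsCompact C → IsCompact (Z ∩ 𝒢.tgt ⁻¹' C)) (h_univ : ∀ m, ν m univ = 1) :
    Nonempty (HaarSystem 𝒢) := by
  have hval := fun m => 𝒢.measurableEmbedding_val m
  have hmap : ∀ m, ((ν m).comap (Subtype.val : 𝒢.TgtFiber m → G)).map Subtype.val = ν m :=
    fun m => by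
      rw [(hval m).map_comap, Measure.restrict_eq_self_of_ae_mem]
      filter_upwards [h_tgt m] with a ha using ⟨⟨a, ha⟩, rfl⟩
  refine ⟨⟨fun m => (ν m).comap Subtype.val, fun f hf hfc => ?_, fun g => ?_, ?_, fun m => ?_⟩⟩
  · convert h_smooth f hf hfc using 2 with m
    conv_rhs => rw [← hmap m]
    exact ((hval m).integral_map f).symm
  · have h1 : (Subtype.val : 𝒢.TgtFiber (𝒢.tgt g) → G) ∘ 𝒢.leftTranslation g =
        𝒢.translate g ∘ Subtype.val := by
      ext a
      exact (translate_eq a.2).symm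
    have h2 : Measurable (𝒢.leftTranslation g) := by
      rw [← (hval (𝒢.tgt g)).measurable_comp_iff, h1]
      exact (measurable_translate g).comp measurable_subtype_coe
    rw [← (hval (𝒢.tgt g)).comap_map (Measure.map _ _),
      Measure.map_map (hval _).measurable h2, h1,
      ← Measure.map_map (measurable_translate g) (hval _).measurable, hmap, h_inv]
  · have hsub : closure (⋃ m, (Subtype.val : 𝒢.TgtFiber m → G) ''
        ((ν m).comap (Subtype.val : 𝒢.TgtFiber m → G)).support) ⊆ Z := by
      refine closure_minimal (iUnion_subset fun m => ?_) hZ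
      rw [image_subset_iff]
      refine Measure.support_subset_of_isClosed (hZ.preimage continuous_subtype_val) ?_
      have := h_mem m
      rw [← hmap m, (hval m).ae_map_iff] at this
      exact this
    refine isProperMap_iff_isCompact_preimage.2
      ⟨𝒢.continuous_tgt.comp continuous_subtype_val, fun C hC => ?_⟩
    rw [Subtype.isCompact_iff]
    refine (hZc C hC).of_isClosed_subset ?_ ?_
    · exact isClosed_closure.isClosedMap_subtype_val _
        (hC.isClosed.preimage (𝒢.continuous_tgt.comp continuous_subtype_val))
    · rintro _ ⟨a, ha, rfl⟩
      exact ⟨hsub a.2, ha⟩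
  · rw [← h_univ m]
    conv_rhs => rw [← hmap m]
    rw [(hval m).map_apply, preimage_univ]

end

/-- A proper groupoid has a normalized Haar system with proper support: the measures of an invariant
density are multiplied by a cutoff function, pulled back along the source map, and normalized. The
cutoff and the normalizing factor are invariant because left translations preserve sources. -/
theorem nonempty_haarSystem [FiniteDimensional ℝ EM] [IsManifold 𝓘(ℝ, EM) ∞ M]
    [T2Space M] [SecondCountableTopology M] [FiniteDimensional ℝ EG] [IsManifold 𝓘(ℝ, EG) ∞ G]
    [T2Space G] [SecondCountableTopology G] [MeasurableSpace G] [BorelSpace G]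
    (𝒢 : LieGroupoid EM EG M G) (h𝒢 : 𝒢.IsProper) : Nonempty (HaarSystem 𝒢) := by
  have : LocallyCompactSpace M := Manifold.locallyCompact_of_finiteDimensional 𝓘(ℝ, EM)
  have : LocallyCompactSpace G := Manifold.locallyCompact_of_finiteDimensional 𝓘(ℝ, EG)
  have : SigmaCompactSpace M := sigmaCompactSpace_of_locallyCompact_secondCountable
  have : SigmaCompactSpace G := sigmaCompactSpace_of_locallyCompact_secondCountable
  obtain ⟨d, hd⟩ := exists_tgtChart 𝒢
  obtain ⟨D⟩ := nonempty_invariantDensity hd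
  choose e he using hd
  -- countably many charts suffice, as required for the interchange of sums and integrals
  obtain ⟨S, hS, hSu⟩ := TopologicalSpace.countable_cover_nhds
    fun a => (e a).chart.open_source.mem_nhds (he a)
  have : Countable S := hS.to_subtype
  set c : S → 𝒢.TgtChart (EuclideanSpace ℝ (Fin d)) := fun s => e s
  obtain ⟨ρ, hρ⟩ := SmoothPartitionOfUnity.exists_isSubordinate 𝓘(ℝ, EG) (s := (univ : Set G))
    isClosed_univ (fun s : S => (c s).chart.source) (fun s => (c s).chart.open_source)
    (by rw [← hSu, iUnion_subtype])
  obtain ⟨χ, hχ, hχ0, hχpos, hχc⟩ := h𝒢.exists_cutoff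
  have hZc : ∀ C, IsCompact C → IsCompact (tsupport (fun a => χ (𝒢.src a)) ∩ 𝒢.tgt ⁻¹' C) :=
    fun C hC => h𝒢.isCompact_tsupport_inter hχc hC
  have hχs : ContMDiff 𝓘(ℝ, EG) 𝓘(ℝ, ℝ) ∞ (fun a => χ (𝒢.src a)) :=
    hχ.comp 𝒢.isSubmersion_src.contMDiff
  have hχm : Measurable fun a => χ (𝒢.src a) := hχs.continuous.measurable
  obtain ⟨hint, hwsmooth⟩ := InvariantDensity.integrable_and_contMDiff_of_isCompact (D := D) hρ
    hχs hZc
  set lam : M → Measure G := fun m => D.fibreMeasure c ρ m with hlam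
  set w : M → ℝ := fun m => ∫ a, χ (𝒢.src a) ∂(lam m) with hw
  have hwl : ∀ m, ENNReal.ofReal (w m) = ∫⁻ a, ENNReal.ofReal (χ (𝒢.src a)) ∂(lam m) := fun m =>
    ofReal_integral_eq_lintegral_ofReal (hint m) (ae_of_all _ fun a => hχ0 _)
  have hwpos : ∀ m, 0 < w m := fun m => by
    obtain ⟨a, ha, hpos⟩ := hχpos m
    rw [← ENNReal.ofReal_pos, hwl]
    exact InvariantDensity.lintegral_pos hρ hχs.continuous ha hpos
  have hsrc : ∀ g, ∀ᵐ a ∂(lam (𝒢.src g)), 𝒢.src (𝒢.translate g a) = 𝒢.src a := fun g => by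
    filter_upwards [InvariantDensity.ae_tgt_eq (D := D) (c := c) (ρ := ρ) (𝒢.src g)] with a ha
    rw [translate_eq ha, 𝒢.src_mul _ _ ha.symm]
  have hinv : ∀ g, (lam (𝒢.src g)).map (𝒢.translate g) = lam (𝒢.tgt g) := fun g =>
    InvariantDensity.map_translate_fibreMeasure hρ g
  have hwinv : ∀ g, w (𝒢.tgt g) = w (𝒢.src g) := fun g => by
    rw [hw]
    simp only
    rw [← hinv g, integral_map (measurable_translate g).aemeasurable hχm.aestronglyMeasurable]
    refine integral_congr_ae ?_
    filter_upwards [hsrc g] with a ha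
    rw [ha]
  have hdm : ∀ m, Measurable fun a => ENNReal.ofReal (χ (𝒢.src a) / w m) := fun m =>
    (hχm.div_const _).ennreal_ofReal
  refine nonempty_haarSystem_of_measure
    (fun m => (lam m).withDensity fun a => ENNReal.ofReal (χ (𝒢.src a) / w m))
    (fun m => (withDensity_absolutelyContinuous _ _).ae_le (InvariantDensity.ae_tgt_eq m))
    (fun f hf _ => ?_) (fun g => ?_) (isClosed_tsupport _) (fun m => ?_) hZc fun m => ?_
  · have h1 := (InvariantDensity.integrable_and_contMDiff_of_isCompact (D := D) hρ (hχs.mul hf)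
      fun C hC => (hZc C hC).of_isClosed_subset
        ((isClosed_tsupport _).inter (hC.isClosed.preimage 𝒢.continuous_tgt))
        (inter_subset_inter_left _ tsupport_mul_subset_left)).2
    have h2 : ContMDiff 𝓘(ℝ, EM) 𝓘(ℝ, ℝ) ∞ fun m => (w m)⁻¹ :=
      hwsmooth.inv₀ fun m => (hwpos m).ne'
    convert h2.mul h1 using 2 with m
    rw [integral_withDensity_eq_integral_toReal_smul (hdm m) (ae_of_all _ fun a =>
      ENNReal.ofReal_lt_top), Pi.mul_apply, ← integral_const_mul]
    refine integral_congr_ae (ae_of_all _ fun a => ?_)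
    simp only [smul_eq_mul, Pi.mul_apply]
    rw [ENNReal.toReal_ofReal (div_nonneg (hχ0 _) (hwpos m).le)]
    ring
  · refine Measure.ext_of_lintegral _ fun h hh => ?_
    rw [lintegral_map hh (measurable_translate g),
      lintegral_withDensity_eq_lintegral_mul _ (hdm _) (g := fun a => h (𝒢.translate g a))
        (hh.comp (measurable_translate g)),
      lintegral_withDensity_eq_lintegral_mul _ (hdm _) hh]
    conv_rhs => rw [← hinv g, lintegral_map ((hdm _).mul hh) (measurable_translate g)]
    refine lintegral_congr_ae ?_
    filter_upwards [hsrc g] with a ha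
    simp only [Pi.mul_apply, ha, hwinv]
  · rw [ae_withDensity_iff (hdm m)]
    refine ae_of_all _ fun a ha => subset_tsupport _ fun h0 => ha ?_
    rw [h0, zero_div, ENNReal.ofReal_zero]
  · rw [withDensity_apply _ MeasurableSet.univ, Measure.restrict_univ]
    simp only [div_eq_mul_inv, ENNReal.ofReal_mul (hχ0 _)]
    rw [lintegral_mul_const _ hχm.ennreal_ofReal, ← hwl, ← ENNReal.ofReal_mul (hwpos m).le,
      mul_inv_cancel₀ (hwpos m).ne', ENNReal.ofReal_one]

end LieGroupoid

theorem mainTheorem1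
    {EM EG EK M G K : Type*}
    [NormedAddCommGroup EM] [NormedSpace ℝ EM] [FiniteDimensional ℝ EM]
    [TopologicalSpace M] [ChartedSpace EM M] [IsManifold 𝓘(ℝ, EM) ∞ M]
    [T2Space M] [SecondCountableTopology M]
    [NormedAddCommGroup EG] [NormedSpace ℝ EG] [FiniteDimensional ℝ EG]
    [TopologicalSpace G] [ChartedSpace EG G] [IsManifold 𝓘(ℝ, EG) ∞ G]
    [T2Space G] [SecondCountableTopology G]
    [NormedAddCommGroup EK] [NormedSpace ℝ EK] [FiniteDimensional ℝ EK]
    [TopologicalSpace K] [ChartedSpace EK K] [IsManifold 𝓘(ℝ, EK) ∞ K]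
    [T2Space K] [SecondCountableTopology K] [MeasurableSpace K] [BorelSpace K]
    (𝒢 : LieGroupoid EM EG M G) (𝒦 : 𝒢.WideSubgroupoid EK K)
    (hK : 𝒦.toLieGroupoid.IsProper) :
    Nonempty (LieGroupoid.HaarSystem 𝒦.toLieGroupoid) ∧
    (∀ μ : LieGroupoid.HaarSystem 𝒦.toLieGroupoid,
      (∀ (p : ℕ) (i : Fin (p + 1)), ∀ f ∈ 𝒢.cochains p,
        (∀ x, MeasureTheory.Integrable (fun a => f (LieGroupoid.actFiber i x a))
          (μ.measure (x.base i))) ∧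
        LieGroupoid.avg μ i f ∈ 𝒢.cochains p) ∧
      (∀ (p : ℕ) (i j : Fin (p + 1)), ∀ f ∈ 𝒢.cochains p,
        LieGroupoid.avg μ i (LieGroupoid.avg μ j f) =
          LieGroupoid.avg μ j (LieGroupoid.avg μ i f)) ∧
      ∃ e : HomotopyEquiv 𝒢.groupoidComplex (LieGroupoid.invariantComplex 𝒦),
        (∀ (p : ℕ) (f : 𝒢.cochains p),
          (LieGroupoid.invariantCochains 𝒦 p).subtype ((e.hom.f p).hom f) =
            LieGroupoid.totalAvg μ p f) ∧
        e.inv = LieGroupoid.invariantInclusion 𝒦) ∧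
    (∃ e : HomotopyEquiv (LieGroupoid.normalizedInvariantComplex 𝒦) 𝒢.groupoidComplex,
      e.hom = LieGroupoid.normalizedInvariantInclusion 𝒦) ∧
    QuasiIso (LieGroupoid.normalizedInvariantInclusion 𝒦) := by
  have hHaar := LieGroupoid.nonempty_haarSystem 𝒦.toLieGroupoid hK
  obtain ⟨μ⟩ := hHaar
  obtain ⟨e, he⟩ := LieGroupoid.exists_homotopyEquiv_normalized μ
  refine ⟨⟨μ⟩, fun μ => ⟨fun p i f hf => ⟨fun x => ?_, LieGroupoid.avg_mem_cochains μ i hf⟩,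
    fun p i j f hf => LieGroupoid.avg_comm μ i j hf,
    LieGroupoid.exists_homotopyEquiv_averaging μ⟩, ⟨e, he⟩, ?_⟩
  · exact (LieGroupoid.integrable_actFiber_iff μ i f x).2 (LieGroupoid.integrable_actK μ i hf x)
  · rw [← he]
    exact HomotopyEquiv.quasiIso_hom e
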